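/- Fix an integer $\ell\ge 5$. All graphs are finite and simple; the length of a path or cycle is its number of edges. A *hole* of a graph $G$ is an induced cycle of $G$ of length at least four; a path or hole is *long* if its length is at least $\ell$, and *odd* if its length is odd. A *shortest long odd hole* is a long odd hole of $G$ of minimum length. For a hole $C$, a vertex $v\in V(G)\setminus V(C)$ is *$C$-major* if no three-vertex path of $C$ contains all neighbours of $v$ in $V(C)$; the hole $C$ is *clean* if no vertex of $G$ is $C$-major. A *long pyramid* in $G$ consists of vertices $v_0,v_1,v_2,v_3$ and induced paths $P_i$ of $G$ between $v_0$ and $v_i$ ($i=1,2,3$), such that $P_1,P_2,P_3$ are pairwise vertex-disjoint except for $v_0$; $v_1,v_2,v_3\neq v_0$, and at least two of $P_1,P_2,P_3$ have length at least $\ell$; $v_1,v_2,v_3$ are pairwise adjacent; and for $1\le i<j\le 3$ the only edge between $V(P_i)\setminus\{v_0\}$ and $V(P_j)\setminus\{v_0\}$ is $v_iv_j$. A *long jewel* in $G$ consists of vertices $u,v$, two induced paths $Q_1,Q_2$ of $G$ between $u$ and $v$ whose lengths have different parity, and an induced path $P$ of $G$ between $u$ and $v$ of length at least $\ell$, such that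 no interior vertex of $P$ equals or is adjacent to an interior vertex of $Q_1$ or $Q_2$; its *order* is $\max(|V(Q_1)|,|V(Q_2)|)$. The graph $G$ is a *candidate* if it contains no long pyramid, no long jewel of order at most $\ell+2$, and no long odd hole of length at most $2\ell+2$. **Theorem 3.6.** There is an algorithm which, given a candidate $G$ (by its adjacency matrix), runs in time $O(|G|^5)$, where $|G|$ is the number of vertices of $G$, and either outputs a long odd hole of $G$, or correctly decides that $G$ has no clean shortest long odd hole. Here an algorithm is a program for a random access machine whose words have $O(\log |G|)$ bits and whose elementary operations cost one step each; the program and the implied constants may depend on $\ell$ only. -/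

import Mathlib

/-! ## Induced paths, holes, pyramids, jewels and candidates -/

/-- An induced path of `G` between `u` and `v`, with its vertices listed in order from `u` to `v`;
`length` is its number of edges. (A graph embedding `↪g` reflects adjacency, so its image is an
induced subgraph.) -/
structure InducedPath {V : Type*} (G : SimpleGraph V) (u v : V) where
  length : ℕ
  emb : SimpleGraph.pathGraph (length + 1) ↪g G
  first_eq : emb 0 = u
  last_eq : emb (Fin.last length) = v

namespace InducedPath

/-- The vertex set `V(P)`. -/
def support {V : Type*} {G : SimpleGraph V} {u v : V} (P : InducedPath G u v) : Set V :=
  Set.range P.emb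

/-- The interior `P^*`: the vertices of `P` that are not ends of `P`. -/
def interior {V : Type*} {G : SimpleGraph V} {u v : V} (P : InducedPath G u v) : Set V :=
  {x | x ∈ P.support ∧ x ≠ u ∧ x ≠ v}

end InducedPath

/-- A hole of `G`: an induced cycle of length at least four, with its vertices listed in cyclic
order. -/
structure Hole {V : Type*} (G : SimpleGraph V) where
  length : ℕ
  four_le : 4 ≤ length
  emb : SimpleGraph.cycleGraph length ↪g G

namespace Hole

/-- The hole `C` is odd, and it is long, that is, of length at least `ℓ`. -/
def IsLongOdd {V : Type*} {G : SimpleGraph V} (ℓ : ℕ) (C : Hole G) : Prop :=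
  ℓ ≤ C.length ∧ Odd C.length

/-- `C` is a long odd hole of `G` of minimum length. -/
def IsShortestLongOdd {V : Type*} {G : SimpleGraph V} (ℓ : ℕ) (C : Hole G) : Prop :=
  C.IsLongOdd ℓ ∧ ∀ D : Hole G, D.IsLongOdd ℓ → C.length ≤ D.length

/-- `v` is `C`-major: it is not in `C`, and no three-vertex path `a - b - c` of `C` contains all
the neighbours of `v` in `V(C)`. -/
def IsMajor {V : Type*} {G : SimpleGraph V} (C : Hole G) (v : V) : Prop :=
  v ∉ Set.range C.emb ∧
    ¬ ∃ a b c : Fin C.length,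
      a ≠ c ∧ (SimpleGraph.cycleGraph C.length).Adj a b ∧
      (SimpleGraph.cycleGraph C.length).Adj b c ∧
      ∀ j : Fin C.length, G.Adj v (C.emb j) → j = a ∨ j = b ∨ j = c

/-- A hole is clean if no vertex is major for it. -/
def IsClean {V : Type*} {G : SimpleGraph V} (C : Hole G) : Prop :=
  ∀ v : V, ¬ C.IsMajor v

end Hole

/-- `G` contains a long pyramid, with apex `v₀`, base `{b 0, b 1, b 2}`, formed by `P 0, P 1, P 2`,
at least two of which have length at least `ℓ`. -/
def HasLongPyramid {V : Type*} (ℓ : ℕ) (G : SimpleGraph V) : Prop :=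
  ∃ (v₀ : V) (b : Fin 3 → V) (P : ∀ i, InducedPath G v₀ (b i)),
    (∀ i j, i ≠ j → (P i).support ∩ (P j).support = {v₀}) ∧
    (∀ i, b i ≠ v₀) ∧
    (∃ i j, i ≠ j ∧ ℓ ≤ (P i).length ∧ ℓ ≤ (P j).length) ∧
    (∀ i j, i ≠ j → G.Adj (b i) (b j)) ∧
    (∀ i j, i ≠ j → ∀ x ∈ (P i).support, ∀ y ∈ (P j).support,
      x ≠ v₀ → y ≠ v₀ → G.Adj x y → x = b i ∧ y = b j)

/-- `G` contains a long jewel of order at most `k`, formed by `Q₁, Q₂, P`; the order is the larger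
of the numbers of vertices of `Q₁` and `Q₂`. -/
def HasLongJewel {V : Type*} (ℓ k : ℕ) (G : SimpleGraph V) : Prop :=
  ∃ (u v : V) (Q₁ Q₂ P : InducedPath G u v),
    Q₁.length % 2 ≠ Q₂.length % 2 ∧
    ℓ ≤ P.length ∧
    (∀ x ∈ P.interior, ∀ y ∈ Q₁.interior ∪ Q₂.interior, x ≠ y ∧ ¬ G.Adj x y) ∧
    max (Q₁.length + 1) (Q₂.length + 1) ≤ k

/-- `G` is a candidate: it contains no long pyramid, no long jewel of order at most `ℓ + 2`, and no
long odd hole of length at most `2ℓ + 2`. -/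
def IsCandidate {V : Type*} (ℓ : ℕ) (G : SimpleGraph V) : Prop :=
  ¬ HasLongPyramid ℓ G ∧
  ¬ HasLongJewel ℓ (ℓ + 2) G ∧
  ¬ ∃ C : Hole G, C.IsLongOdd ℓ ∧ C.length ≤ 2 * ℓ + 2

/-! ## A word RAM

Structured programs acting on finitely many registers and a random access memory. Every constant,
register read, memory read, arithmetic operation, comparison, assignment, memory write and branch
costs one step. All numbers that occur (addresses and intermediate results included) have to be
smaller than a bound `B`, the word size being `log₂ B`; a program that exceeds it has no
execution. -/

namespace RAM

/-- Binary operations on words; subtraction is truncated, and the comparisons return `0` or `1`. -/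
inductive Op where
  | add | sub | mul | lt | eq

def Op.eval : Op → ℕ → ℕ → ℕ
  | .add, a, b => a + b
  | .sub, a, b => a - b
  | .mul, a, b => a * b
  | .lt, a, b => if a < b then 1 else 0
  | .eq, a, b => if a = b then 1 else 0

/-- The contents of the registers and of the memory cells. -/
structure State where
  reg : ℕ → ℕ
  mem : ℕ → ℕ

/-- Expressions: constants, registers, the contents of the memory cell with a given address, and
binary operations. -/
inductive Expr where
  | const (k : ℕ)
  | reg (x : ℕ)
  | load (addr : Expr)
  | bin (o : Op) (e f : Expr)

def Expr.eval (s : State) : Expr → ℕ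
  | .const k => k
  | .reg x => s.reg x
  | .load a => s.mem (a.eval s)
  | .bin o e f => o.eval (e.eval s) (f.eval s)

/-- The number of steps it takes to evaluate an expression. -/
def Expr.cost : Expr → ℕ
  | .const _ => 1
  | .reg _ => 1
  | .load a => a.cost + 1
  | .bin _ e f => e.cost + f.cost + 1

/-- All values that occur when the expression is evaluated are smaller than `B`. -/
def Expr.Fits (B : ℕ) (s : State) : Expr → Prop
  | .const k => k < B
  | .reg x => s.reg x < B
  | .load a => a.Fits B s ∧ s.mem (a.eval s) < B
  | .bin o e f => e.Fits B s ∧ f.Fits B s ∧ o.eval (e.eval s) (f.eval s) < B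

/-- Programs. A test `e` succeeds if its value is not zero. -/
inductive Program where
  | skip
  | assign (x : ℕ) (e : Expr)
  | store (addr e : Expr)
  | seq (p q : Program)
  | ite (e : Expr) (p q : Program)
  | loop (e : Expr) (p : Program)

/-- `Exec B p s t s'`: started in state `s`, the program `p` halts after exactly `t` steps in state
`s'`, and all numbers computed on the way are smaller than `B`. Here `loop e p` is
`while e ≠ 0 do p`. -/
inductive Exec (B : ℕ) : Program → State → ℕ → State → Prop where
  | skip (s : State) : Exec B .skip s 1 s
  | assign (x : ℕ) (e : Expr) (s : State) (he : e.Fits B s) :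
      Exec B (.assign x e) s (e.cost + 1) ⟨Function.update s.reg x (e.eval s), s.mem⟩
  | store (a e : Expr) (s : State) (ha : a.Fits B s) (he : e.Fits B s) :
      Exec B (.store a e) s (a.cost + e.cost + 1)
        ⟨s.reg, Function.update s.mem (a.eval s) (e.eval s)⟩
  | seq {p q : Program} {s s₁ s₂ : State} {t₁ t₂ : ℕ}
      (hp : Exec B p s t₁ s₁) (hq : Exec B q s₁ t₂ s₂) :
      Exec B (.seq p q) s (t₁ + t₂) s₂
  | ite_true {e : Expr} {p q : Program} {s s₁ : State} {t : ℕ}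
      (hf : e.Fits B s) (he : e.eval s ≠ 0) (hp : Exec B p s t s₁) :
      Exec B (.ite e p q) s (e.cost + 1 + t) s₁
  | ite_false {e : Expr} {p q : Program} {s s₁ : State} {t : ℕ}
      (hf : e.Fits B s) (he : e.eval s = 0) (hq : Exec B q s t s₁) :
      Exec B (.ite e p q) s (e.cost + 1 + t) s₁
  | loop_true {e : Expr} {p : Program} {s s₁ s₂ : State} {t₁ t₂ : ℕ}
      (hf : e.Fits B s) (he : e.eval s ≠ 0)
      (hp : Exec B p s t₁ s₁) (hl : Exec B (.loop e p) s₁ t₂ s₂) :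
      Exec B (.loop e p) s (e.cost + 1 + t₁ + t₂) s₂
  | loop_false {e : Expr} {p : Program} {s : State}
      (hf : e.Fits B s) (he : e.eval s = 0) :
      Exec B (.loop e p) s (e.cost + 1) s

/-- Programs are deterministic: the number of steps and the final state are determined by the
program and the initial state. -/
theorem Exec.unique {B : ℕ} {p : Program} {s s₁ s₂ : State} {t₁ t₂ : ℕ}
    (h₁ : Exec B p s t₁ s₁) (h₂ : Exec B p s t₂ s₂) : t₁ = t₂ ∧ s₁ = s₂ := by
  induction h₁ generalizing t₂ s₂ with
  | skip s => cases h₂; exact ⟨rfl, rfl⟩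
  | assign x e s he => cases h₂; exact ⟨rfl, rfl⟩
  | store a e s ha he => cases h₂; exact ⟨rfl, rfl⟩
  | seq _ _ ihp ihq =>
    cases h₂ with
    | seq hp hq =>
      obtain ⟨rfl, rfl⟩ := ihp hp
      obtain ⟨rfl, rfl⟩ := ihq hq
      exact ⟨rfl, rfl⟩
  | ite_true _ he _ ih =>
    cases h₂ with
    | ite_true _ _ hp => obtain ⟨rfl, rfl⟩ := ih hp; exact ⟨rfl, rfl⟩
    | ite_false _ he' _ => exact absurd he' he
  | ite_false _ he _ ih =>
    cases h₂ with
    | ite_true _ he' _ => exact absurd he he'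
    | ite_false _ _ hq => obtain ⟨rfl, rfl⟩ := ih hq; exact ⟨rfl, rfl⟩
  | loop_true _ he _ _ ihp ihl =>
    cases h₂ with
    | loop_true _ _ hp hl =>
      obtain ⟨rfl, rfl⟩ := ihp hp
      obtain ⟨rfl, rfl⟩ := ihl hl
      exact ⟨rfl, rfl⟩
    | loop_false _ he' => exact absurd he' he
  | loop_false _ he =>
    cases h₂ with
    | loop_true _ he' _ _ => exact absurd he he'
    | loop_false _ _ => exact ⟨rfl, rfl⟩

open Classical in
/-- The initial state for the input graph `G` with vertex set `{0, …, n - 1}`: register `0` holds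
`n`, the cells `0, …, n² - 1` hold the adjacency matrix row by row, and everything else is `0`. -/
noncomputable def inputState {n : ℕ} (G : SimpleGraph (Fin n)) : State where
  reg := fun x => if x = 0 then n else 0
  mem := fun a => if ∃ i j : Fin n, a = i.val * n + j.val ∧ G.Adj i j then 1 else 0

/-- The final state `s` reports a long odd hole of `G`: register `0` holds its length `k`, and the
`k` memory cells from the address in register `1` on hold its vertices in cyclic order. -/
def ReportsLongOddHole {n : ℕ} (ℓ : ℕ) (G : SimpleGraph (Fin n)) (s : State) : Prop :=
  ∃ C : Hole G, C.IsLongOdd ℓ ∧ s.reg 0 = C.length ∧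
    ∀ i : Fin C.length, s.mem (s.reg 1 + i.val) = (C.emb i).val

end RAM

/-! ## Induced paths and holes as sequences -/

section Sequences

variable {V : Type*} {G : SimpleGraph V}

/-! Let `C` be a clean shortest long odd hole, of length `N`, in a candidate; then `N ≥ 2ℓ + 3`. The
key fact is `Tight.geodesic`: `C` is isometric in `G` up to nearly half its length. Hence a path of
`C` of length `m`, with `m` a little below `N / 2`, is a shortest path of `G`, and any other
shortest path with the same ends may take its place: the result is again a hole of length `N`
(`Tight.isHoleSeq_reroute`), and it is clean if `m` is slightly smaller still
(`Tight.cleanSeq_reroute`). Cutting `C` into three paths of length about `N / 3` and exchanging them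
one after the other gives `exists_triple`: for some three vertices, any shortest paths between them
form a long odd hole. So it suffices to compute one shortest path for every pair of vertices, in
`O(n ^ 4)` steps, and to test for each of the `n ^ 3` triples, in `O(n ^ 2)` steps, whether the
three stored paths form a long odd hole. A positive test is right in any graph; only the negative
answer relies on the theory (`exists_good`).

For isometry, take a walk `f 0, …, f p` of minimum length that joins two vertices of `C` and is
shorter than both paths of `C` between them (`Shortcut`). Minimality makes it an induced path with
interior disjoint from `C`, and cleanness confines the neighbours in `C` of each interior vertex to
three consecutive vertices. Suppose first that among the interior vertices only `f 1` and `f (p -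
1)` have neighbours in `C`. The interior closes up with either of two arcs of `C` to a hole shorter
than `N`. If one of these is long and odd, `N` was not minimal; if one of the replaced arcs is
short, there is a long jewel or again a shorter long odd hole; otherwise one end of the interior
sees exactly two consecutive vertices of `C`, and there is a long pyramid (`Bridge.false`).

If other interior vertices have neighbours in `C`, minimality of `p` forces these onto one arc, of
length `p + 1` or `p + 2`, along which the walk runs almost in parallel. With length `p + 2`, going
round the other arc gives a long odd hole of length `N - 2`. With length `p + 1`, either such a hole
appears again, or the walk and the arc form a ladder, and `Ladder.false` reroutes the hole through
part of the walk until no rung is left. -/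

/-- `f 0, …, f r` are the vertices, in order, of an induced path. -/
structure IsPathSeq (G : SimpleGraph V) (r : ℕ) (f : ℕ → V) : Prop where
  inj : ∀ i j, i ≤ r → j ≤ r → f i = f j → i = j
  adj : ∀ i j, i ≤ r → j ≤ r → (G.Adj (f i) (f j) ↔ i + 1 = j ∨ j + 1 = i)

/-- `c` is `N`-periodic, and `c 0, …, c (N - 1)` are the vertices, in cyclic order, of an induced
cycle. -/
structure IsHoleSeq (G : SimpleGraph V) (N : ℕ) (c : ℕ → V) : Prop where
  -- Triangles are admitted; the sequence becomes a `Hole` only when its length is at least four.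
  three_le : 3 ≤ N
  per : ∀ i, c (i + N) = c i
  inj : ∀ i j, i < N → j < N → c i = c j → i = j
  adj : ∀ i j, i < N → j < N →
    (G.Adj (c i) (c j) ↔ i + 1 = j ∨ j + 1 = i ∨ (i = 0 ∧ j + 1 = N) ∨ (j = 0 ∧ i + 1 = N))

namespace IsPathSeq

variable {r : ℕ} {f : ℕ → V}

lemma reverse (hf : IsPathSeq G r f) : IsPathSeq G r (fun i => f (r - i)) where
  inj i j hi hj h := by
    have := hf.inj (r - i) (r - j) (by omega) (by omega) h
    omega
  adj i j hi hj := by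
    rw [hf.adj (r - i) (r - j) (by omega) (by omega)]
    omega

lemma sub (hf : IsPathSeq G r f) {x s : ℕ} (h : x + s ≤ r) : IsPathSeq G s (fun i => f (x + i)) where
  inj i j hi hj h := by
    have := hf.inj (x + i) (x + j) (by omega) (by omega) h
    omega
  adj i j hi hj := by
    rw [hf.adj (x + i) (x + j) (by omega) (by omega)]
    omega

lemma single (v : V) : IsPathSeq G 0 (fun _ => v) where
  inj i j hi hj _ := by omega
  adj i j hi hj := by
    simp only [SimpleGraph.irrefl, false_iff]
    omega

/-- The concatenation of two induced paths joined by one edge. -/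
lemma glue {a b : ℕ} {g : ℕ → V} (hf : IsPathSeq G a f) (hg : IsPathSeq G b g)
    (hne : ∀ i j, i ≤ a → j ≤ b → f i ≠ g j)
    (hadj : ∀ i j, i ≤ a → j ≤ b → (G.Adj (f i) (g j) ↔ i = a ∧ j = 0)) :
    IsPathSeq G (a + b + 1) (fun i => if i ≤ a then f i else g (i - (a + 1))) where
  inj i j hi hj h := by
    split_ifs at h with h1 h2 h2
    · exact hf.inj i j h1 h2 h
    · exact absurd h (hne _ _ h1 (by omega))
    · exact absurd h.symm (hne _ _ h2 (by omega))
    · have := hg.inj _ _ (by omega) (by omega) h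
      omega
  adj i j hi hj := by
    split_ifs with h1 h2 h2
    · exact hf.adj i j h1 h2
    · rw [hadj _ _ h1 (by omega)]; omega
    · rw [G.adj_comm, hadj _ _ h2 (by omega)]; omega
    · rw [hg.adj _ _ (by omega) (by omega)]; omega

/-- The induced path given by a sequence. -/
def toInducedPath (hf : IsPathSeq G r f) {u v : V} (hu : f 0 = u) (hv : f r = v) :
    InducedPath G u v where
  length := r
  emb :=
    { toFun := fun i => f i.val
      inj' := fun i j h => Fin.ext (hf.inj _ _ (by omega) (by omega) h)
      map_rel_iff' := by
        intro i j
        rw [SimpleGraph.pathGraph_adj]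
        exact hf.adj _ _ (by omega) (by omega) }
  first_eq := hu
  last_eq := hv

lemma mem_support (hf : IsPathSeq G r f) {u v : V} (hu : f 0 = u) (hv : f r = v) {x : V} :
    x ∈ (hf.toInducedPath hu hv).support ↔ ∃ i ≤ r, f i = x := by
  constructor
  · rintro ⟨i, rfl⟩
    exact ⟨i.val, Nat.lt_succ_iff.1 i.2, rfl⟩
  · rintro ⟨i, hi, rfl⟩
    exact ⟨(⟨i, Nat.lt_succ_iff.2 hi⟩ : Fin (r + 1)), rfl⟩

lemma mem_interior (hf : IsPathSeq G r f) {u v : V} (hu : f 0 = u) (hv : f r = v) {x : V}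
    (hx : x ∈ (hf.toInducedPath hu hv).interior) : ∃ i, 0 < i ∧ i < r ∧ f i = x := by
  obtain ⟨h, h1, h2⟩ := hx
  obtain ⟨i, hi, rfl⟩ := (hf.mem_support hu hv).1 h
  refine ⟨i, Nat.pos_of_ne_zero ?_, lt_of_le_of_ne hi ?_, rfl⟩
  · rintro rfl; exact h1 hu
  · rintro rfl; exact h2 hv

end IsPathSeq

/-- The clause `2 ≤ N` excludes the cycle on one vertex, where `0` would count as its own
predecessor. -/
lemma cycleGraph_adj_iff {N : ℕ} (i j : Fin N) :
    (SimpleGraph.cycleGraph N).Adj i j ↔ i.val + 1 = j.val ∨ j.val + 1 = i.val ∨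
      (i.val = 0 ∧ j.val + 1 = N ∧ 2 ≤ N) ∨ (j.val = 0 ∧ i.val + 1 = N ∧ 2 ≤ N) := by
  rw [SimpleGraph.cycleGraph_adj', Fin.sub_def, Fin.sub_def]
  have key : ∀ a b : ℕ, a < N → b < N → ((N - b + a) % N = 1 ↔ b + 1 = a ∨
      (a = 0 ∧ b + 1 = N ∧ 2 ≤ N)) := by
    intro a b ha hb
    by_cases h : b ≤ a
    · rw [show N - b + a = (a - b) + N by omega, Nat.add_mod_right,
        Nat.mod_eq_of_lt (by omega)]
      omega
    · rw [Nat.mod_eq_of_lt (by omega)]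
      omega
  simp only
  rw [key _ _ i.2 j.2, key _ _ j.2 i.2]
  omega

namespace IsHoleSeq

variable {N : ℕ} {c : ℕ → V}

lemma per_mul (hc : IsHoleSeq G N c) (i k : ℕ) : c (i + N * k) = c i := by
  induction k with
  | zero => rfl
  | succ k ih => rw [Nat.mul_succ, ← Nat.add_assoc, hc.per, ih]

lemma apply_mod (hc : IsHoleSeq G N c) (i : ℕ) : c (i % N) = c i := by
  conv_rhs => rw [← Nat.mod_add_div i N]
  rw [hc.per_mul]

/-- Moving the window by one step only trades the index `x` for `x + N`, which denotes the same
vertex. Windows keep the later index arithmetic free of remainders, so that it stays linear. -/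
lemma inj_window (hc : IsHoleSeq G N c) (x : ℕ) : ∀ i j, x ≤ i → i < x + N → x ≤ j → j < x + N →
    c i = c j → i = j := by
  induction x with
  | zero =>
    intro i j _ hi _ hj
    exact hc.inj i j (by omega) (by omega)
  | succ x ih =>
    have key : ∀ i, x + 1 ≤ i → i < x + 1 + N → ∃ i', x ≤ i' ∧ i' < x + N ∧ c i' = c i ∧
        (i = i' ∧ i ≠ x ∨ i = x + N ∧ i' = x) := by
      intro i h1 h2
      by_cases h : i = x + N
      · exact ⟨x, le_rfl, by have := hc.three_le; omega, by rw [h, hc.per], by omega⟩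
      · exact ⟨i, by omega, by omega, rfl, by omega⟩
    intro i j h1 h2 h3 h4 h
    obtain ⟨i', hi1, hi2, hi3, hi4⟩ := key i h1 h2
    obtain ⟨j', hj1, hj2, hj3, hj4⟩ := key j h3 h4
    have := ih i' j' hi1 hi2 hj1 hj2 (by rw [hi3, hj3, h])
    omega

lemma adj_window (hc : IsHoleSeq G N c) (x : ℕ) : ∀ i j, x ≤ i → i < x + N → x ≤ j → j < x + N →
    (G.Adj (c i) (c j) ↔
      i + 1 = j ∨ j + 1 = i ∨ (i = x ∧ j + 1 = x + N) ∨ (j = x ∧ i + 1 = x + N)) := by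
  have h3 := hc.three_le
  induction x with
  | zero =>
    intro i j _ hi _ hj
    rw [hc.adj i j (by omega) (by omega)]
    omega
  | succ x ih =>
    have key : ∀ i, x + 1 ≤ i → i < x + 1 + N → ∃ i', x ≤ i' ∧ i' < x + N ∧ c i' = c i ∧
        (i = i' ∧ i ≠ x ∨ i = x + N ∧ i' = x) := by
      intro i h1 h2
      by_cases h : i = x + N
      · exact ⟨x, le_rfl, by omega, by rw [h, hc.per], by omega⟩
      · exact ⟨i, by omega, by omega, rfl, by omega⟩
    intro i j h1 h2 h3 h4
    obtain ⟨i', hi1, hi2, hi3, hi4⟩ := key i h1 h2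
    obtain ⟨j', hj1, hj2, hj3, hj4⟩ := key j h3 h4
    rw [← hi3, ← hj3, ih i' j' hi1 hi2 hj1 hj2]
    omega

lemma rotate (hc : IsHoleSeq G N c) (x : ℕ) : IsHoleSeq G N (fun i => c (i + x)) where
  three_le := hc.three_le
  per i := by rw [Nat.add_right_comm, hc.per]
  inj i j hi hj h := by
    have := hc.inj_window x (i + x) (j + x) (by omega) (by omega) (by omega) (by omega) h
    omega
  adj i j hi hj := by
    rw [hc.adj_window x (i + x) (j + x) (by omega) (by omega) (by omega) (by omega)]
    omega

/-- The hole traversed backwards from `c x`. -/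
lemma reflect (hc : IsHoleSeq G N c) (x : ℕ) : IsHoleSeq G N (fun i => c (x + (N - i % N))) where
  three_le := hc.three_le
  per i := by simp
  inj i j hi hj h := by
    simp only [Nat.mod_eq_of_lt hi, Nat.mod_eq_of_lt hj] at h
    have := hc.inj_window (x + 1) _ _ (by omega) (by omega) (by omega) (by omega) h
    omega
  adj i j hi hj := by
    simp only [Nat.mod_eq_of_lt hi, Nat.mod_eq_of_lt hj]
    rw [hc.adj_window (x + 1) _ _ (by omega) (by omega) (by omega) (by omega)]
    omega

lemma reflect_apply (hc : IsHoleSeq G N c) {x i : ℕ} (hi : i < N) (hx : i ≤ x) :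
    c (x + (N - i % N)) = c (x - i) := by
  rw [Nat.mod_eq_of_lt hi, show x + (N - i) = (x - i) + N by omega, hc.per]

lemma arc (hc : IsHoleSeq G N c) (x : ℕ) {r : ℕ} (hr : r + 2 ≤ N) :
    IsPathSeq G r (fun i => c (x + i)) where
  inj i j hi hj h := by
    have := hc.inj_window x _ _ (by omega) (by omega) (by omega) (by omega) h
    omega
  adj i j hi hj := by
    rw [hc.adj_window x _ _ (by omega) (by omega) (by omega) (by omega)]
    omega

lemma exists_lt (hc : IsHoleSeq G N c) (i : ℕ) : ∃ j < N, c j = c i :=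
  ⟨i % N, Nat.mod_lt _ (by have := hc.three_le; omega), hc.apply_mod i⟩

/-- Every vertex of the hole occurs in every window of length `N`. -/
lemma exists_window (hc : IsHoleSeq G N c) (x i : ℕ) : ∃ j, x ≤ j ∧ j < x + N ∧ c j = c i := by
  have h0 : 0 < N := by have := hc.three_le; omega
  obtain ⟨j, hj, hji⟩ := hc.exists_lt i
  -- The least index from `x` on that is congruent to `j`; the extra `N` prevents truncation.
  refine ⟨x + (j + N - x % N) % N, by omega, by have := Nat.mod_lt (j + N - x % N) h0; omega, ?_⟩
  rw [← hji, ← hc.apply_mod (x + _), ← hc.apply_mod j]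
  congr 1
  have hx := Nat.mod_lt x h0
  rw [← Nat.mod_add_mod, Nat.add_mod_mod, show x % N + (j + N - x % N) = j + N by omega,
    Nat.add_mod_right]

/-- Two induced paths joined by two edges at their ends form a hole. -/
lemma of_glue {a b : ℕ} {f g : ℕ → V} (hab : 1 ≤ a + b) (hf : IsPathSeq G a f)
    (hg : IsPathSeq G b g) (hne : ∀ i j, i ≤ a → j ≤ b → f i ≠ g j)
    (hadj : ∀ i j, i ≤ a → j ≤ b → (G.Adj (f i) (g j) ↔ i = a ∧ j = 0 ∨ i = 0 ∧ j = b)) :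
    IsHoleSeq G (a + b + 2)
      (fun i => if i % (a + b + 2) ≤ a then f (i % (a + b + 2))
        else g (i % (a + b + 2) - (a + 1))) where
  three_le := by omega
  per i := by simp
  inj i j hi hj h := by
    simp only [Nat.mod_eq_of_lt hi, Nat.mod_eq_of_lt hj] at h
    split_ifs at h with h1 h2 h2
    · exact hf.inj i j h1 h2 h
    · exact absurd h (hne _ _ h1 (by omega))
    · exact absurd h.symm (hne _ _ h2 (by omega))
    · have := hg.inj _ _ (by omega) (by omega) h
      omega
  adj i j hi hj := by
    simp only [Nat.mod_eq_of_lt hi, Nat.mod_eq_of_lt hj]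
    split_ifs with h1 h2 h2
    · rw [hf.adj i j h1 h2]; omega
    · rw [hadj _ _ h1 (by omega)]; omega
    · rw [G.adj_comm, hadj _ _ h2 (by omega)]; omega
    · rw [hg.adj _ _ (by omega) (by omega)]; omega

/-- The hole given by a sequence. -/
def toHole (hc : IsHoleSeq G N c) (hN : 4 ≤ N) : Hole G where
  length := N
  four_le := hN
  emb :=
    { toFun := fun i => c i.val
      inj' := fun i j h => Fin.ext (hc.inj _ _ i.2 j.2 h)
      map_rel_iff' := by
        intro i j
        rw [cycleGraph_adj_iff]
        refine (hc.adj _ _ i.2 j.2).trans ?_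
        omega }

end IsHoleSeq

/-- The periodic sequence of the vertices of a hole. -/
def Hole.seq (C : Hole G) (i : ℕ) : V :=
  C.emb ⟨i % C.length, Nat.mod_lt _ (by have := C.four_le; omega)⟩

lemma Hole.isHoleSeq (C : Hole G) : IsHoleSeq G C.length C.seq where
  three_le := by have := C.four_le; omega
  per i := by simp [Hole.seq]
  inj i j hi hj h := by
    have := C.emb.injective h
    simpa [Nat.mod_eq_of_lt hi, Nat.mod_eq_of_lt hj] using this
  adj i j hi hj := by
    have h4 := C.four_le
    simp only [Hole.seq, SimpleGraph.Embedding.map_adj_iff, cycleGraph_adj_iff,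
      Nat.mod_eq_of_lt hi, Nat.mod_eq_of_lt hj]
    omega

end Sequences

/-! ## Shortest long odd holes in candidates -/

section Tight

variable {V : Type*} {G : SimpleGraph V}

/-- `N` is the minimum length of a long odd hole of `G`, and `G` is a candidate. -/
structure Tight (ℓ N : ℕ) (G : SimpleGraph V) : Prop where
  five_le : 5 ≤ ℓ
  len : 2 * ℓ + 3 ≤ N
  odd : N % 2 = 1
  no_pyramid : ¬ HasLongPyramid ℓ G
  no_jewel : ¬ HasLongJewel ℓ (ℓ + 2) G
  min : ∀ M c, IsHoleSeq G M c → ℓ ≤ M → M % 2 = 1 → N ≤ M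

/-- Two paths leaving a common apex meet only there, and the only edge between their remainders
joins their last vertices. -/
def ApexPair (G : SimpleGraph V) (a : ℕ) (f : ℕ → V) (b : ℕ) (g : ℕ → V) : Prop :=
  ∀ i j, 0 < i → i ≤ a → 0 < j → j ≤ b → f i ≠ g j ∧ (G.Adj (f i) (g j) ↔ i = a ∧ j = b)

lemma ApexPair.symm {a b : ℕ} {f g : ℕ → V} (h : ApexPair G a f b g) : ApexPair G b g a f := by
  intro i j hi hi' hj hj'
  have := h j i hj hj' hi hi'
  refine ⟨this.1.symm, ?_⟩
  rw [G.adj_comm, this.2, and_comm]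

lemma hasLongPyramid_of_seq {ℓ a₀ a₁ a₂ : ℕ} {f₀ f₁ f₂ : ℕ → V} (v : V)
    (h₀ : IsPathSeq G a₀ f₀) (h₁ : IsPathSeq G a₁ f₁) (h₂ : IsPathSeq G a₂ f₂)
    (e₀ : f₀ 0 = v) (e₁ : f₁ 0 = v) (e₂ : f₂ 0 = v)
    (p₀ : 0 < a₀) (l₁ : ℓ ≤ a₁) (l₂ : ℓ ≤ a₂) (hℓ : 0 < ℓ)
    (h01 : ApexPair G a₀ f₀ a₁ f₁) (h02 : ApexPair G a₀ f₀ a₂ f₂) (h12 : ApexPair G a₁ f₁ a₂ f₂) :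
    HasLongPyramid ℓ G := by
  let a : Fin 3 → ℕ := ![a₀, a₁, a₂]
  let f : Fin 3 → ℕ → V := ![f₀, f₁, f₂]
  have hf : ∀ i, IsPathSeq G (a i) (f i) := by
    intro i; fin_cases i <;> assumption
  have ha : ∀ i, 0 < a i := by
    intro i; fin_cases i
    · exact p₀
    · exact hℓ.trans_le l₁
    · exact hℓ.trans_le l₂
  have he : ∀ i, f i 0 = v := by
    intro i; fin_cases i <;> assumption
  have hp : ∀ i j, i ≠ j → ApexPair G (a i) (f i) (a j) (f j) := by
    intro i j hij
    fin_cases i <;> fin_cases j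
    · exact absurd rfl hij
    · exact h01
    · exact h02
    · exact h01.symm
    · exact absurd rfl hij
    · exact h12
    · exact h02.symm
    · exact h12.symm
    · exact absurd rfl hij
  refine ⟨v, fun i => f i (a i), fun i => (hf i).toInducedPath (he i) rfl, ?_, ?_, ?_, ?_, ?_⟩
  · intro i j hij
    ext x
    simp only [Set.mem_inter_iff, IsPathSeq.mem_support, Set.mem_singleton_iff]
    constructor
    · rintro ⟨⟨s, hs, rfl⟩, ⟨t, ht, hst⟩⟩
      by_cases hs0 : s = 0
      · rw [hs0, he]
      · by_cases ht0 : t = 0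
        · rw [← hst, ht0, he]
        · exact absurd hst.symm
            (hp i j hij s t (Nat.pos_of_ne_zero hs0) hs (Nat.pos_of_ne_zero ht0) ht).1
    · rintro rfl
      exact ⟨⟨0, Nat.zero_le _, he i⟩, ⟨0, Nat.zero_le _, he j⟩⟩
  · intro i h
    have := (hf i).inj (a i) 0 le_rfl (Nat.zero_le _) (h.trans (he i).symm)
    have := ha i
    omega
  · exact ⟨1, 2, by decide, l₁, l₂⟩
  · intro i j hij
    exact (hp i j hij _ _ (ha i) le_rfl (ha j) le_rfl).2.2 ⟨rfl, rfl⟩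
  · intro i j hij x hx y hy hxv hyv hxy
    obtain ⟨s, hs, rfl⟩ := ((hf i).mem_support _ _).1 hx
    obtain ⟨t, ht, rfl⟩ := ((hf j).mem_support _ _).1 hy
    have hs0 : 0 < s := Nat.pos_of_ne_zero (by rintro rfl; exact hxv (he i))
    have ht0 : 0 < t := Nat.pos_of_ne_zero (by rintro rfl; exact hyv (he j))
    obtain ⟨rfl, rfl⟩ := (hp i j hij s t hs0 hs ht0 ht).2.1 hxy
    exact ⟨rfl, rfl⟩

lemma hasLongJewel_of_seq {ℓ k a b r : ℕ} {f g h : ℕ → V}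
    (hf : IsPathSeq G a f) (hg : IsPathSeq G b g) (hh : IsPathSeq G r h)
    (f0 : f 0 = h 0) (g0 : g 0 = h 0) (f1 : f a = h r) (g1 : g b = h r)
    (hpar : a % 2 ≠ b % 2) (hr : ℓ ≤ r) (ha : a + 1 ≤ k) (hb : b + 1 ≤ k)
    (hfh : ∀ i j, 0 < i → i < r → 0 < j → j < a → h i ≠ f j ∧ ¬ G.Adj (h i) (f j))
    (hgh : ∀ i j, 0 < i → i < r → 0 < j → j < b → h i ≠ g j ∧ ¬ G.Adj (h i) (g j)) :
    HasLongJewel ℓ k G := by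
  refine ⟨h 0, h r, hf.toInducedPath f0 f1, hg.toInducedPath g0 g1, hh.toInducedPath rfl rfl,
    hpar, hr, ?_, max_le ha hb⟩
  intro x hx y hy
  obtain ⟨i, hi0, hir, rfl⟩ := hh.mem_interior _ _ hx
  rcases hy with hy | hy
  · obtain ⟨j, hj0, hja, rfl⟩ := hf.mem_interior _ _ hy
    exact hfh i j hi0 hir hj0 hja
  · obtain ⟨j, hj0, hja, rfl⟩ := hg.mem_interior _ _ hy
    exact hgh i j hi0 hir hj0 hja

/-- The path `q 0, …, q r` extended by `x` in front. -/
lemma IsPathSeq.cons {r : ℕ} {q : ℕ → V} (hq : IsPathSeq G r q) {x : V}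
    (hx : ∀ i ≤ r, x ≠ q i) (hxa : ∀ i ≤ r, (G.Adj x (q i) ↔ i = 0)) :
    IsPathSeq G (r + 1) (fun i => if i = 0 then x else q (i - 1)) := by
  have := (IsPathSeq.single (G := G) x).glue hq (fun i j _ hj => hx j hj)
    (fun i j hi hj => by rw [hxa j hj]; omega)
  simpa using this

/-- The path `q 0, …, q r` extended by `x` at the end. -/
lemma IsPathSeq.snoc {r : ℕ} {q : ℕ → V} (hq : IsPathSeq G r q) {x : V}
    (hx : ∀ i ≤ r, q i ≠ x) (hxa : ∀ i ≤ r, (G.Adj (q i) x ↔ i = r)) :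
    IsPathSeq G (r + 1) (fun i => if i ≤ r then q i else x) :=
  hq.glue (IsPathSeq.single x) (fun i _ hi _ => hx i hi)
    (fun i j hi hj => by rw [hxa i hi]; omega)

/-! ### Detours that replace one arc of the hole -/

/-- The path `q 0, …, q r` is disjoint from the hole `c`, and the only edges between it and the
arc `c m, …, c N` are `q r - c m` and `q 0 - c N`. -/
structure Attach (G : SimpleGraph V) (N : ℕ) (c : ℕ → V) (r : ℕ) (q : ℕ → V) (m : ℕ) : Prop where
  hole : IsHoleSeq G N c
  path : IsPathSeq G r q
  disj : ∀ i j, i ≤ r → q i ≠ c j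
  lt : m < N
  -- The vertex `c 0` is written `c N`, which makes the arc an interval of indices. Edges to the
  -- vertices strictly between `c 0` and `c m` are unrestricted.
  adj : ∀ i j, i ≤ r → m ≤ j → j ≤ N → (G.Adj (q i) (c j) ↔ i = r ∧ j = m ∨ i = 0 ∧ j = N)

namespace Tight

variable {ℓ N : ℕ} {c : ℕ → V} {r : ℕ} {q : ℕ → V} {m : ℕ}

/-- The path `q` closes up with the arc `c m, …, c N` to a hole of length `N - m + r + 2`. The
hypotheses say that it is shorter than `N`, odd and long. -/
lemma outer_odd (T : Tight ℓ N G) (A : Attach G N c r q m) (hrm : r + 2 < m)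
    (hpar : (r + m) % 2 = 0) (hlong : ℓ + m ≤ N + r + 2) : False := by
  have h5 := T.five_le
  have hodd := T.odd
  have hlt := A.lt
  have := IsHoleSeq.of_glue (by omega) A.path (A.hole.arc m (r := N - m) (by omega))
    (fun i j hi _ => A.disj i _ hi)
    (fun i j hi hj => by rw [A.adj i _ hi (by omega) (by omega)]; omega)
  have := T.min _ _ this (by omega) (by omega)
  omega

/-- The ends of the jewel are `c 0` and `c m`. Its two short paths are the detour through `q`, of
length `r + 2`, and the arc `c 0, …, c m`; the long one is the remaining arc. Edges between `q` and
the short arc do no harm, since a jewel allows them between `Q₁` and `Q₂`. -/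
lemma outer_jewel (T : Tight ℓ N G) (A : Attach G N c r q m) (hrm : r + 2 < m)
    (hpar : (r + m) % 2 = 1) (hm : m ≤ ℓ + 1) : False := by
  have h5 := T.five_le
  have hN := T.len
  have hlt := A.lt
  have hcons := A.path.cons (x := c N) (fun i hi => (A.disj i N hi).symm)
    (fun i hi => by rw [G.adj_comm, A.adj i N hi (by omega) le_rfl]; omega)
  have hQ := hcons.snoc (x := c m)
    (fun i hi => by
      split_ifs with h
      · intro h'
        have := A.hole.inj_window m _ _ (by omega) (by omega) (by omega) (by omega) h'
        omega
      · exact A.disj _ _ (by omega))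
    (fun i hi => by
      split_ifs with h
      · rw [A.hole.adj_window m _ _ (by omega) (by omega) (by omega) (by omega)]
        omega
      · rw [A.adj _ _ (by omega) le_rfl (by omega)]
        omega)
  refine T.no_jewel (hasLongJewel_of_seq hQ (A.hole.arc 0 (r := m) (by omega))
    (A.hole.arc m (r := N - m) (by omega)).reverse ?_ ?_ ?_ ?_ ?_ ?_ ?_ ?_ ?_ ?_)
  · simp only [Nat.zero_le, if_true]
    congr 1
    omega
  · simp only [Nat.sub_zero, show m + (N - m) = N by omega]
    rw [← A.hole.per 0]
    simp
  · simp
  · simp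
  · omega
  · omega
  · omega
  · omega
  · intro i j hi hi' hj hj'
    simp only [show j ≤ r + 1 by omega, show j ≠ 0 by omega, if_true, if_false]
    refine ⟨(A.disj _ _ (by omega)).symm, ?_⟩
    rw [G.adj_comm, A.adj _ _ (by omega) (by omega) (by omega)]
    omega
  · intro i j hi hi' hj hj'
    constructor
    · intro h
      have := A.hole.inj _ _ (by omega) (by omega) h
      omega
    · rw [A.hole.adj _ _ (by omega) (by omega)]
      omega

/-- One parity of `r + m` yields a shorter long odd hole, the other a long jewel. The bound `ℓ + 1`
on `m` comes from the order `ℓ + 2` of the excluded jewels. -/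
lemma outer_small (T : Tight ℓ N G) (A : Attach G N c r q m) (hrm : r + 2 < m)
    (hm : m ≤ ℓ + 1) : False := by
  have hN := T.len
  rcases Nat.mod_two_eq_zero_or_one (r + m) with h | h
  · exact T.outer_odd A hrm h (by omega)
  · exact T.outer_jewel A hrm h hm

end Tight

/-- Any two neighbours of `y` in the hole have distance at most two in the hole. -/
def Close (G : SimpleGraph V) (N : ℕ) (c : ℕ → V) (y : V) : Prop :=
  ∀ i j, i ≤ j → j < i + N → G.Adj y (c i) → G.Adj y (c j) → j ≤ i + 2 ∨ i + N ≤ j + 2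

lemma Close.rotate {N : ℕ} {c : ℕ → V} {y : V} (h : Close G N c y) (x : ℕ) :
    Close G N (fun i => c (i + x)) y := by
  intro i j hij hj hi' hj'
  have := h (i + x) (j + x) (by omega) (by omega) hi' hj'
  omega

lemma IsHoleSeq.shift_eq {N : ℕ} {c : ℕ → V} (hc : IsHoleSeq G N c) {i j : ℕ} (h : c i = c j)
    (d : ℕ) : c (i + d) = c (j + d) := by
  have h0 : 0 < N := by have := hc.three_le; omega
  have : i % N = j % N := by
    refine hc.inj _ _ (Nat.mod_lt _ h0) (Nat.mod_lt _ h0) ?_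
    rw [hc.apply_mod, hc.apply_mod, h]
  rw [← hc.apply_mod (i + d), ← hc.apply_mod (j + d), Nat.add_mod, this, ← Nat.add_mod]

/-- To bound the distances in a hole between the vertices related by `R`, it is enough to look at one
turn of the hole. -/
lemma IsHoleSeq.spread_of_window {N : ℕ} {c : ℕ → V} (hc : IsHoleSeq G N c) {R : V → V → Prop}
    (hR : ∀ a b, R a b → R b a) {n : ℕ} (x : ℕ)
    (h : ∀ i j, x ≤ i → i ≤ j → j < x + N → R (c i) (c j) → j ≤ i + n ∨ i + N ≤ j + n)
    (i j : ℕ) (hij : i ≤ j) (hj : j < i + N) (hr : R (c i) (c j)) :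
    j ≤ i + n ∨ i + N ≤ j + n := by
  obtain ⟨i', h1, h2, h3⟩ := hc.exists_window x i
  obtain ⟨j', h4, h5, h6⟩ := hc.exists_window x j
  rw [← h3, ← h6] at hr
  have hs : c j' = c (i' + (j - i)) := by
    rw [hc.shift_eq h3, h6]
    congr 1
    omega
  have key : j' = i' + (j - i) ∨ j' + N = i' + (j - i) := by
    by_cases hlt : i' + (j - i) < x + N
    · exact Or.inl (hc.inj_window x _ _ h4 h5 (by omega) hlt hs)
    · right
      rw [← hc.per j'] at hs
      exact hc.inj_window (x + N) _ _ (by omega) (by omega) (by omega) (by omega) hs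
  rcases le_total i' j' with hle | hle
  · have := h i' j' h1 hle h5 hr
    omega
  · have := h j' i' h4 hle h2 (hR _ _ hr)
    omega

lemma IsHoleSeq.close_of_window {N : ℕ} {c : ℕ → V} (hc : IsHoleSeq G N c) (x : ℕ) {y : V}
    (h : ∀ i j, x ≤ i → i ≤ j → j < x + N → G.Adj y (c i) → G.Adj y (c j) →
      j ≤ i + 2 ∨ i + N ≤ j + 2) : Close G N c y := fun i j hij hj hi' hj' =>
  hc.spread_of_window (R := fun a b => G.Adj y a ∧ G.Adj y b) (fun _ _ h => h.symm) x
    (fun i j h1 h2 h3 h4 => h i j h1 h2 h3 h4.1 h4.2) i j hij hj ⟨hi', hj'⟩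

/-! ### Bridges between two distant places of a hole -/

/-- A path outside a hole whose interior has no neighbours in the hole, while its ends attach to
subpaths of the hole with at most three vertices that are far apart. -/
structure Bridge (G : SimpleGraph V) (N : ℕ) (c : ℕ → V) (r : ℕ) (q : ℕ → V) (m α β : ℕ) :
    Prop where
  hole : IsHoleSeq G N c
  path : IsPathSeq G r q
  one_le : 1 ≤ r
  disj : ∀ i j, i ≤ r → q i ≠ c j
  mid : ∀ i j, 0 < i → i < r → ¬ G.Adj (q i) (c j)
  α_le : α ≤ 2
  β_le : β ≤ 2
  αβ_le : α + β ≤ m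
  m_le : m ≤ N
  short : r + 2 < m
  short' : r + 2 + m < N + α + β
  left_first : G.Adj (q 0) (c 0)
  left_last : G.Adj (q 0) (c α)
  left : ∀ j, j < N → G.Adj (q 0) (c j) → j ≤ α
  right_first : G.Adj (q r) (c (m - β))
  right_last : G.Adj (q r) (c m)
  right : ∀ j, m - β ≤ j → j < m - β + N → G.Adj (q r) (c j) → j ≤ m

namespace Bridge

variable {ℓ N : ℕ} {c : ℕ → V} {r : ℕ} {q : ℕ → V} {m α β : ℕ}

/-- Reading the bridge from its other end, with the hole starting at the first neighbour of `q r`,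
exchanges the two arcs that the bridge can replace. Statements about one arc then hold for the
other. -/
lemma complement (B : Bridge G N c r q m α β) :
    Bridge G N (fun i => c (i + (m - β))) r (fun i => q (r - i)) (N - m + α + β) β α := by
  obtain ⟨hole, path, one_le, disj, mid, α_le, β_le, αβ_le, m_le, short, short', left_first,
    left_last, left, right_first, right_last, right⟩ := B
  refine ⟨hole.rotate _, path.reverse, one_le, fun i j hi => disj _ _ (by omega),
    fun i j hi hi' => mid _ _ (by omega) (by omega), β_le, α_le, by omega, by omega, by omega,
    by omega, ?_, ?_, ?_, ?_, ?_, ?_⟩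
  · simpa using right_first
  · simpa [show β + (m - β) = m by omega] using right_last
  · intro j hj h
    have := right (j + (m - β)) (by omega) (by omega) (by simpa using h)
    omega
  · rw [← hole.per, Nat.zero_add] at left_first
    simpa [show N - m + α + β - α + (m - β) = N by omega] using left_first
  · simpa [show N - m + α + β + (m - β) = α + N by omega, hole.per] using left_last
  · intro j hj hj' h
    have h' : G.Adj (q 0) (c (j + (m - β) - N)) := by
      rw [← hole.per, show j + (m - β) - N + N = j + (m - β) by omega]
      simpa using h
    have := left _ (by omega) h'
    omega

/-- Traversing path and hole backwards exchanges `α` and `β` but keeps the arc of length `m`. -/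
lemma reflect (B : Bridge G N c r q m α β) (hm : m < N) :
    Bridge G N (fun i => c (m + (N - i % N))) r (fun i => q (r - i)) m β α := by
  obtain ⟨hole, path, one_le, disj, mid, α_le, β_le, αβ_le, m_le, short, short', left_first,
    left_last, left, right_first, right_last, right⟩ := B
  refine ⟨hole.reflect m, path.reverse, one_le, fun i j hi => disj _ _ (by omega),
    fun i j hi hi' => mid _ _ (by omega) (by omega), β_le, α_le, by omega, by omega, by omega,
    by omega, ?_, ?_, ?_, ?_, ?_, ?_⟩
  · simpa [hole.per] using right_last
  · rw [hole.reflect_apply (by omega) (by omega)]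
    simpa using right_first
  · intro j hj h
    simp only [Nat.mod_eq_of_lt hj, Nat.sub_zero] at h
    by_contra hcon
    have := right (m + (N - j)) (by omega) (by omega) h
    omega
  · rw [hole.reflect_apply (by omega) (by omega)]
    simpa [show m - (m - α) = α by omega] using left_last
  · rw [hole.reflect_apply hm le_rfl]
    simpa using left_first
  · intro j hj hj' h
    by_contra hcon
    simp only [Nat.sub_self] at h
    by_cases hjN : j < N
    · rw [Nat.mod_eq_of_lt hjN] at h
      have := left _ (by omega) h
      omega
    · rw [show j = (j - N) + N by omega, Nat.add_mod_right, Nat.mod_eq_of_lt (by omega),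
        show m + (N - (j - N)) = (m - (j - N)) + N by omega, hole.per] at h
      have := left _ (by omega) h
      omega

/-- The arc from `c m` to `c N` runs from the last neighbour of `q r` to the first neighbour of `q
0`, so it contains no other neighbour of the bridge. -/
lemma attach (B : Bridge G N c r q m α β) (hm : m < N) : Attach G N c r q m := by
  refine ⟨B.hole, B.path, B.disj, hm, ?_⟩
  have h1 := B.one_le
  have h2 := B.α_le
  have h3 := B.short
  have h4 := B.β_le
  intro i j hi hj hj'
  constructor
  · intro h
    by_cases hi0 : i = 0
    · by_cases hjN : j = N
      · exact Or.inr ⟨hi0, hjN⟩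
      · have := B.left j (by omega) (hi0 ▸ h)
        omega
    · by_cases hir : i = r
      · subst hir
        have := B.right j (by omega) (by omega) h
        exact Or.inl ⟨rfl, by omega⟩
      · exact absurd h (B.mid i j (by omega) (by omega))
  · rintro (⟨rfl, rfl⟩ | ⟨rfl, rfl⟩)
    · exact B.right_last
    · have := B.left_first
      rwa [← B.hole.per, Nat.zero_add] at this

lemma adj_right (B : Bridge G N c r q m α β) {j : ℕ} (h1 : 1 ≤ j) (h2 : j ≤ N)
    (h : G.Adj (q r) (c j)) : m ≤ j + β ∧ j ≤ m := by
  have h3 := B.short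
  have h4 := B.β_le
  have h5 := B.m_le
  by_cases hj : m - β ≤ j
  · exact ⟨by omega, B.right j hj (by omega) h⟩
  · have := B.right (j + N) (by omega) (by omega) (by rwa [B.hole.per])
    omega

lemma adj_left (B : Bridge G N c r q m 1 β) {j : ℕ} (h1 : 1 ≤ j) (h2 : j ≤ N) :
    G.Adj (q 0) (c j) ↔ j = 1 ∨ j = N := by
  constructor
  · intro h
    by_cases hj : j = N
    · exact Or.inr hj
    · have := B.left j (by omega) h
      omega
  · rintro (rfl | rfl)
    · exact B.left_last
    · have := B.left_first
      rwa [← B.hole.per, Nat.zero_add] at this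

/-- The base is the triangle `q 0`, `c 1`, `c N`. As `c m` is the only neighbour of `q r` in the
hole, it is the apex, and the three paths are the bridge and the two arcs from `c m`. -/
lemma pyramid_zero (B : Bridge G N c r q m 1 0) (hℓ : 0 < ℓ) (h1 : ℓ + 1 ≤ m) (h2 : ℓ + m ≤ N) :
    HasLongPyramid ℓ G := by
  have hr := B.one_le
  have hs := B.short
  have hright : ∀ j, 1 ≤ j → j ≤ N → (G.Adj (q r) (c j) ↔ j = m) := fun j h h' =>
    ⟨fun hh => by have := B.adj_right h h' hh; omega, fun hh => hh ▸ B.right_last⟩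
  have hleft : ∀ j, 1 ≤ j → j ≤ N → (G.Adj (q 0) (c j) ↔ j = 1 ∨ j = N) :=
    fun j h h' => B.adj_left h h'
  have hq : ∀ i j, i ≤ r → 1 ≤ j → j ≤ N →
      (G.Adj (q i) (c j) ↔ i = r ∧ j = m ∨ i = 0 ∧ (j = 1 ∨ j = N)) := by
    intro i j hi hj hj'
    by_cases hi0 : i = 0
    · rw [hi0, hleft j hj hj']; omega
    · by_cases hir : i = r
      · rw [hir, hright j hj hj']; omega
      · have := B.mid i j (by omega) (by omega)
        simp only [this, false_iff]
        omega
  refine hasLongPyramid_of_seq (c m)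
    (B.path.reverse.cons (x := c m) (fun i hi => (B.disj _ _ (by omega)).symm)
      (fun i hi => by rw [G.adj_comm, hq _ _ (by omega) (by omega) (by omega)]; omega))
    (B.hole.arc 1 (r := m - 1) (by omega)).reverse (B.hole.arc m (r := N - m) (by omega))
    (by simp) (congrArg c (by omega)) (by simp) (by omega) (by omega) (by omega) hℓ ?_ ?_ ?_
  · intro i j hi hi' hj hj'
    simp only [show i ≠ 0 by omega, if_false]
    refine ⟨B.disj _ _ (by omega), ?_⟩
    rw [hq _ _ (by omega) (by omega) (by omega)]
    omega
  · intro i j hi hi' hj hj'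
    simp only [show i ≠ 0 by omega, if_false]
    refine ⟨B.disj _ _ (by omega), ?_⟩
    rw [hq _ _ (by omega) (by omega) (by omega)]
    omega
  · intro i j hi hi' hj hj'
    constructor
    · intro h
      have := B.hole.inj_window 1 _ _ (by omega) (by omega) (by omega) (by omega) h
      omega
    · rw [B.hole.adj_window 1 _ _ (by omega) (by omega) (by omega) (by omega)]
      omega

/-- The base is again `q 0`, `c 1`, `c N`, but the apex is `q r`, which enters the two arcs at `c (m
- 2)` and `c m`. The vertex `c (m - 1)` is left out, so it does not matter whether `q r` is adjacent
to it. -/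
lemma pyramid_two (B : Bridge G N c r q m 1 2) (hℓ : 0 < ℓ) (h1 : ℓ + 2 ≤ m)
    (h2 : ℓ + m ≤ N + 1) (hm : m < N) : HasLongPyramid ℓ G := by
  have hr := B.one_le
  have hs := B.short
  have hleft : ∀ j, 1 ≤ j → j ≤ N → (G.Adj (q 0) (c j) ↔ j = 1 ∨ j = N) :=
    fun j h h' => B.adj_left h h'
  have hq : ∀ i j, i < r → 1 ≤ j → j ≤ N →
      (G.Adj (q i) (c j) ↔ i = 0 ∧ (j = 1 ∨ j = N)) := by
    intro i j hi hj hj'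
    by_cases hi0 : i = 0
    · rw [hi0, hleft j hj hj']; omega
    · have := B.mid i j (by omega) (by omega)
      simp only [this, false_iff]
      omega
  refine hasLongPyramid_of_seq (q r) B.path.reverse
    ((B.hole.arc 1 (r := m - 3) (by omega)).reverse.cons (x := q r)
      (fun i hi => B.disj _ _ le_rfl) (fun i hi => ?_))
    ((B.hole.arc m (r := N - m) (by omega)).cons (x := q r)
      (fun i hi => B.disj _ _ le_rfl) (fun i hi => ?_))
    (by simp) (by simp) (by simp) (by omega) (by omega) (by omega) hℓ ?_ ?_ ?_
  · constructor
    · intro h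
      have := B.adj_right (by omega) (by omega) h
      omega
    · rintro rfl
      have := B.right_first
      rwa [show m - 2 = 1 + (m - 3 - 0) by omega] at this
  · constructor
    · intro h
      have := B.adj_right (by omega) (by omega) h
      omega
    · rintro rfl
      exact B.right_last
  · intro i j hi hi' hj hj'
    simp only [show j ≠ 0 by omega, if_false]
    refine ⟨B.disj _ _ (by omega), ?_⟩
    rw [hq _ _ (by omega) (by omega) (by omega)]
    omega
  · intro i j hi hi' hj hj'
    simp only [show j ≠ 0 by omega, if_false]
    refine ⟨B.disj _ _ (by omega), ?_⟩
    rw [hq _ _ (by omega) (by omega) (by omega)]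
    omega
  · intro i j hi hi' hj hj'
    simp only [show j ≠ 0 by omega, show i ≠ 0 by omega, if_false]
    constructor
    · intro h
      have := B.hole.inj_window 1 _ _ (by omega) (by omega) (by omega) (by omega) h
      omega
    · rw [B.hole.adj_window 1 _ _ (by omega) (by omega) (by omega) (by omega)]
      omega

/-- By `outer_small` both replaceable arcs have length at least `ℓ + 2`. The lengths of the two
resulting holes add up to `N + 2r + 4 - α - β`, so if `α + β` is even then one of them is odd, and
it is long and shorter than `N`. If `α + β` is odd, exactly one of `α`, `β` is `1`, and there is a
long pyramid. -/
lemma false (B : Bridge G N c r q m α β) (T : Tight ℓ N G) : False := by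
  have h5 := T.five_le
  have hN := T.len
  have hodd := T.odd
  have h1 := B.α_le
  have h2 := B.β_le
  have h3 := B.αβ_le
  have h4 := B.m_le
  have h6 := B.short
  have h7 := B.short'
  have h8 := B.one_le
  have hm' : ℓ + 2 ≤ N - m + α + β := by
    by_contra hcon
    exact T.outer_small (B.complement.attach (by omega)) (by omega) (by omega)
  have hmN : m < N := by omega
  have hm : ℓ + 2 ≤ m := by
    by_contra hcon
    exact T.outer_small (B.attach hmN) (by omega) (by omega)
  have key : ∀ {c : ℕ → V} {q : ℕ → V} {β : ℕ}, β ≠ 1 → β ≤ 2 → ℓ + 2 ≤ N - m + 1 + β →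
      Bridge G N c r q m 1 β → False := by
    intro c q β hβ1 hβ2 hβ3 B
    obtain rfl | rfl : β = 0 ∨ β = 2 := by omega
    · exact T.no_pyramid (B.pyramid_zero (by omega) (by omega) (by omega))
    · exact T.no_pyramid (B.pyramid_two (by omega) (by omega) (by omega) hmN)
  by_cases hα1 : α = 1
  · by_cases hβ1 : β = 1
    · rcases Nat.mod_two_eq_zero_or_one (r + m) with h | h
      · exact T.outer_odd (B.attach hmN) h6 h (by omega)
      · exact T.outer_odd (B.complement.attach (by omega)) (by omega) (by omega) (by omega)
    · subst hα1
      exact key hβ1 h2 hm' B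
  · by_cases hβ1 : β = 1
    · subst hβ1
      exact key hα1 h1 (by omega) (B.reflect hmN)
    · rcases Nat.mod_two_eq_zero_or_one (r + m) with h | h
      · exact T.outer_odd (B.attach hmN) h6 h (by omega)
      · exact T.outer_odd (B.complement.attach (by omega)) (by omega) (by omega) (by omega)

end Bridge

end Tight

/-! ### Paths with interior away from the hole, and ladders -/

section Shape

variable {V : Type*} {G : SimpleGraph V} {ℓ N : ℕ}

/-- The first neighbour is sought among `c (u - 2), c (u - 1), c u` and the last among `c u, c (u +
1), c (u + 2)`. For `N ≥ 7` both lie within one stretch shorter than the hole, so closeness bounds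
their difference by two. -/
lemma Close.exists_span {c : ℕ → V} {x : V} (hx : Close G N c x) (hc : IsHoleSeq G N c)
    (hN : 7 ≤ N) {u : ℕ} (hu : 2 ≤ u) (h : G.Adj x (c u)) :
    ∃ a α, a ≤ u ∧ u ≤ a + α ∧ α ≤ 2 ∧ G.Adj x (c a) ∧ G.Adj x (c (a + α)) ∧
      ∀ j, a ≤ j → j < a + N → G.Adj x (c j) → j ≤ a + α := by
  obtain ⟨a, ha1, ha2, ha3, ha4⟩ :
      ∃ a, u ≤ a + 2 ∧ a ≤ u ∧ G.Adj x (c a) ∧ ∀ j, u ≤ j + 2 → j < a → ¬ G.Adj x (c j) := by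
    by_cases h2 : G.Adj x (c (u - 2))
    · exact ⟨u - 2, by omega, by omega, h2, fun j _ _ => by omega⟩
    by_cases h1 : G.Adj x (c (u - 1))
    · refine ⟨u - 1, by omega, by omega, h1, fun j hj hj' => ?_⟩
      rwa [show j = u - 2 by omega]
    · refine ⟨u, by omega, le_rfl, h, fun j hj hj' => ?_⟩
      obtain rfl | rfl : j = u - 2 ∨ j = u - 1 := by omega
      · exact h2
      · exact h1
  obtain ⟨b, hb1, hb2, hb3, hb4⟩ :
      ∃ b, b ≤ u + 2 ∧ u ≤ b ∧ G.Adj x (c b) ∧ ∀ j, j ≤ u + 2 → b < j → ¬ G.Adj x (c j) := by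
    by_cases h2 : G.Adj x (c (u + 2))
    · exact ⟨u + 2, by omega, by omega, h2, fun j _ _ => by omega⟩
    by_cases h1 : G.Adj x (c (u + 1))
    · refine ⟨u + 1, by omega, by omega, h1, fun j hj hj' => ?_⟩
      rwa [show j = u + 2 by omega]
    · refine ⟨u, by omega, le_rfl, h, fun j hj hj' => ?_⟩
      obtain rfl | rfl : j = u + 2 ∨ j = u + 1 := by omega
      · exact h2
      · exact h1
  have hab := hx a b (by omega) (by omega) ha3 hb3
  refine ⟨a, b - a, ha2, by omega, by omega, ha3, by rwa [show a + (b - a) = b by omega], ?_⟩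
  intro j hj hj' hxj
  by_contra hcon
  rcases hx u j (by omega) (by omega) h hxj with h' | h'
  · exact hb4 j h' (by omega) hxj
  · refine ha4 (j - N) (by omega) (by omega) ?_
    rwa [← hc.per, show j - N + N = j by omega]

lemma Tight.shape_of_le (T : Tight ℓ N G) {c q : ℕ → V} {r : ℕ} (hc : IsHoleSeq G N c)
    (hq : IsPathSeq G r q) (hr : 1 ≤ r) (disj : ∀ i j, i ≤ r → q i ≠ c j)
    (mid : ∀ i j, 0 < i → i < r → ¬ G.Adj (q i) (c j))
    (clA : Close G N c (q 0)) (clB : Close G N c (q r)) {u v : ℕ}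
    (hu : G.Adj (q 0) (c u)) (hv : G.Adj (q r) (c v)) (h1 : u + r + 2 < v)
    (h2 : v + r + 2 < u + N) : False := by
  have hN := T.len
  have h5 := T.five_le
  -- One full turn is added to the indices, so that `u - 2` is not truncated in `exists_span`.
  rw [← hc.per] at hu hv
  obtain ⟨a, α, ha1, ha2, ha3, ha4, ha5, ha6⟩ := clA.exists_span hc (by omega) (by omega) hu
  obtain ⟨b, β, hb1, hb2, hb3, hb4, hb5, hb6⟩ := clB.exists_span hc (by omega) (by omega) hv
  have B : Bridge G N (fun i => c (i + a)) r q (b + β - a) α β :=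
    { hole := hc.rotate a
      path := hq
      one_le := hr
      disj := fun i j hi => disj _ _ hi
      mid := fun i j hi hi' => mid _ _ hi hi'
      α_le := ha3
      β_le := hb3
      αβ_le := by omega
      m_le := by omega
      short := by omega
      short' := by omega
      left_first := by simpa using ha4
      left_last := by simpa [Nat.add_comm α a] using ha5
      left := fun j hj h => by
        have := ha6 (j + a) (by omega) (by omega) h
        omega
      right_first := by simpa [show b + β - a - β + a = b by omega] using hb4
      right_last := by simpa [show b + β - a + a = b + β by omega] using hb5
      right := fun j hj hj' h => by
        have := hb6 (j + a) (by omega) (by omega) h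
        omega }
  exact B.false T

/-- A path outside a shortest long odd hole, with no neighbours of its interior in the hole, is not
a shortcut. -/
lemma Tight.shape (T : Tight ℓ N G) {c q : ℕ → V} {r : ℕ} (hc : IsHoleSeq G N c)
    (hq : IsPathSeq G r q) (hr : 1 ≤ r) (disj : ∀ i j, i ≤ r → q i ≠ c j)
    (mid : ∀ i j, 0 < i → i < r → ¬ G.Adj (q i) (c j))
    (clA : Close G N c (q 0)) (clB : Close G N c (q r)) {u v : ℕ}
    (hu : G.Adj (q 0) (c u)) (hv : G.Adj (q r) (c v))
    (h : u + r + 2 < v ∧ v + r + 2 < u + N ∨ v + r + 2 < u ∧ u + r + 2 < v + N) : False := by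
  rcases h with h | h
  · exact T.shape_of_le hc hq hr disj mid clA clB hu hv h.1 h.2
  · exact T.shape_of_le hc hq.reverse hr (fun i j hi => disj _ _ (by omega))
      (fun i j hi hi' => mid _ _ (by omega) (by omega)) (by simpa using clB) (by simpa using clA)
      (by simpa using hv) (by simpa using hu) h.1 h.2

/-- A path `f 0, …, f p` from `c 0` to `c (p + 1)` in which every edge between the interior and the
hole is of the form `f i - c i` or `f i - c (i + 1)`, the two end edges excepted. -/
structure Ladder (G : SimpleGraph V) (N : ℕ) (c f : ℕ → V) (p : ℕ) : Prop where
  hole : IsHoleSeq G N c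
  path : IsPathSeq G p f
  first : f 0 = c 0
  last : f p = c (p + 1)
  short : 2 * p + 3 ≤ N
  disj : ∀ i j, 0 < i → i < p → f i ≠ c j
  adj : ∀ i j, 0 < i → i < p → j < N → G.Adj (f i) (c j) →
    j = i ∨ j = i + 1 ∨ i = 1 ∧ j = 0 ∨ i + 1 = p ∧ j = p + 1

namespace Ladder

variable {c f : ℕ → V} {p : ℕ}

/-- Reversal turns the rungs `f i - c i` into rungs `f i - c (i + 1)`, so only the latter need
treatment. -/
lemma reverse (L : Ladder G N c f p) :
    Ladder G N (fun i => c ((p + 1) + (N - i % N))) (fun i => f (p - i)) p where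
  hole := L.hole.reflect _
  path := L.path.reverse
  first := by simp [L.last, L.hole.per]
  last := by
    have := L.short
    rw [L.hole.reflect_apply (by omega) le_rfl]
    simpa using L.first
  short := L.short
  disj i j hi hi' := L.disj _ _ (by omega) (by omega)
  adj i j hi hi' hj h := by
    have hs := L.short
    by_cases hjp : j ≤ p + 1
    · rw [L.hole.reflect_apply hj hjp] at h
      have := L.adj _ _ (by omega) (by omega) (by omega) h
      omega
    · simp only [Nat.mod_eq_of_lt hj] at h
      have := L.adj _ _ (by omega) (by omega) (by omega) h
      omega

/-- Reroute the hole through `f 0, …, f i`. -/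
lemma shift (L : Ladder G N c f p) {i : ℕ} (hi : 0 < i) (hip : i + 1 < p)
    (h : G.Adj (f i) (c (i + 1))) : ∃ c', Ladder G N c' (fun x => f (x + i)) (p - i) := by
  have hs := L.short
  have hglue := IsHoleSeq.of_glue (f := f) (g := fun j => c (i + 1 + j)) (a := i) (b := N - i - 2)
    (by omega) (by simpa using L.path.sub (x := 0) (s := i) (by omega))
    (L.hole.arc (i + 1) (by omega))
    (fun x y hx hy hxy => by
      by_cases hx0 : x = 0
      · rw [hx0, L.first] at hxy
        have := L.hole.inj _ _ (by omega) (by omega) hxy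
        omega
      · exact L.disj x _ (by omega) (by omega) hxy)
    (fun x y hx hy => by
      by_cases hx0 : x = 0
      · rw [hx0, L.first, L.hole.adj _ _ (by omega) (by omega)]
        omega
      · constructor
        · intro hxy
          have := L.adj x _ (by omega) (by omega) (by omega) hxy
          omega
        · rintro (⟨rfl, rfl⟩ | hxy)
          · exact h
          · omega)
  -- The vertices `c 0, …, c i` give way to equally many, `f 0, …, f i`, so the length is still `N`.
  -- The new hole need not be clean, which is why a ladder does not ask for it.
  rw [show i + (N - i - 2) + 2 = N by omega] at hglue
  refine ⟨_, ⟨hglue.rotate i, ?_, ?_, ?_, by omega, ?_, ?_⟩⟩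
  · simpa [Nat.add_comm] using L.path.sub (x := i) (s := p - i) (by omega)
  · simp [Nat.mod_eq_of_lt (show i < N by omega)]
  · simp only [show p - i + i = p by omega, show p - i + 1 + i = p + 1 by omega,
      Nat.mod_eq_of_lt (show p + 1 < N by omega), show ¬ (p + 1 ≤ i) by omega, if_false, L.last]
    congr 1
    omega
  · intro x y hx hxp
    split_ifs with hy
    · intro hxy
      have := L.path.inj _ _ (by omega) (by omega) hxy
      omega
    · exact L.disj _ _ (by omega) (by omega)
  · intro x y hx hxp hyN hxy
    by_cases hyi : y + i < N
    · rw [Nat.mod_eq_of_lt hyi] at hxy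
      split_ifs at hxy with hy
      · rw [L.path.adj _ _ (by omega) (by omega)] at hxy
        omega
      · have := L.adj _ _ (by omega) (by omega) (by omega) hxy
        omega
    · rw [show y + i = (y + i - N) + N by omega, Nat.add_mod_right,
        Nat.mod_eq_of_lt (by omega), if_pos (by omega),
        L.path.adj _ _ (by omega) (by omega)] at hxy
      omega

lemma attach (L : Ladder G N c f p) (hp : 2 ≤ p) :
    Attach G N c (p - 2) (fun i => f (1 + i)) (p + 1) where
  hole := L.hole
  path := L.path.sub (by omega)
  disj i j hi := L.disj _ _ (by omega) (by omega)
  lt := by have := L.short; omega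
  adj i j hi hj hj' := by
    have hs := L.short
    constructor
    · intro h
      by_cases hjN : j = N
      · rw [hjN, ← Nat.zero_add N, L.hole.per, ← L.first, L.path.adj _ _ (by omega) (by omega)] at h
        omega
      · have := L.adj _ _ (by omega) (by omega) (by omega) h
        by_cases hjp : j = p + 1
        · rw [hjp, ← L.last, L.path.adj _ _ (by omega) (by omega)] at h
          omega
        · omega
    · rintro (⟨rfl, rfl⟩ | ⟨rfl, rfl⟩)
      · rw [← L.last, L.path.adj _ _ (by omega) (by omega)]
        omega
      · rw [← Nat.zero_add j, L.hole.per, ← L.first, L.path.adj _ _ (by omega) (by omega)]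
        omega

/-- Induction on `p`: a rung `f i - c (i + 1)` allows a reroute that leaves a shorter ladder, and a
rung `f i - c i` does so after reversal. Without such rungs the vertices `f 2, …, f (p - 2)` have no
neighbours in the hole, while the neighbours of `f 1` and `f (p - 1)` are confined by the
definition; hence `Tight.shape` applies. -/
lemma false (T : Tight ℓ N G) {c f : ℕ → V} {p : ℕ} (L : Ladder G N c f p) : False := by
  induction p using Nat.strong_induction_on generalizing c f with
  | _ p ih =>
    have h5 := T.five_le
    have hs := L.short
    have hN := T.len
    have hnot : ∀ {c f : ℕ → V}, Ladder G N c f p → ∀ i, 0 < i → i + 1 < p →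
        ¬ G.Adj (f i) (c (i + 1)) := by
      intro c f L i hi hip h
      obtain ⟨c', L'⟩ := L.shift hi hip h
      exact ih _ (by omega) L'
    have hnot' : ∀ i, 1 < i → i < p → ¬ G.Adj (f i) (c i) := by
      intro i hi hip h
      refine hnot L.reverse (p - i) (by omega) (by omega) ?_
      rw [L.hole.reflect_apply (by omega) (by omega)]
      simpa [show p - (p - i) = i by omega, show p + 1 - (p - i + 1) = i by omega] using h
    by_cases h0 : p = 0
    · subst h0
      have := L.hole.inj 0 1 (by omega) (by omega) (by rw [← L.first, L.last])
      omega
    by_cases h1 : p = 1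
    · subst h1
      have : G.Adj (f 0) (f 1) := (L.path.adj 0 1 (by omega) (by omega)).2 (by omega)
      rw [L.first, L.last, L.hole.adj _ _ (by omega) (by omega)] at this
      omega
    by_cases h2 : p = 2
    -- Here the single vertex `f 1` replaces the two interior vertices of an arc of length three.
    · exact T.outer_small (L.attach (by omega)) (by omega) (by omega)
    have A := L.attach (by omega)
    have hlast : f p = c (p + 1) := L.last
    refine T.shape (u := 0) (v := p + 1) L.hole A.path (by omega) A.disj ?_ ?_ ?_ ?_ ?_
      (Or.inl ⟨by omega, by omega⟩)
    · intro i j hi hi' h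
      obtain ⟨j', hj, hj'⟩ := L.hole.exists_lt j
      rw [← hj'] at h
      have := L.adj _ _ (by omega) (by omega) hj h
      obtain rfl | rfl : j' = 1 + i ∨ j' = 1 + i + 1 := by omega
      · exact hnot' _ (by omega) (by omega) h
      · exact hnot L _ (by omega) (by omega) h
    · apply L.hole.close_of_window 0
      intro i j _ hij hj hi' hj'
      have h1 := L.adj _ _ (by omega) (by omega) (by omega) hi'
      have h2 := L.adj _ _ (by omega) (by omega) (by omega) hj'
      omega
    · apply L.hole.close_of_window 0
      intro i j _ hij hj hi' hj'
      have h1 := L.adj _ _ (by omega) (by omega) (by omega) hi'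
      have h2 := L.adj _ _ (by omega) (by omega) (by omega) hj'
      omega
    · have := (A.adj 0 N (by omega) (by omega) le_rfl).2 (Or.inr ⟨rfl, rfl⟩)
      rwa [← Nat.zero_add N, L.hole.per] at this
    · exact (A.adj _ _ le_rfl le_rfl (by omega)).2 (Or.inl ⟨rfl, rfl⟩)

end Ladder

end Shape

/-! ### Clean shortest long odd holes are isometric -/

section Geodesic

variable {V : Type*} {G : SimpleGraph V} {ℓ N : ℕ}

/-- There is a walk of length at most `n` from `x` to `y`. -/
def Reach (G : SimpleGraph V) (n : ℕ) (x y : V) : Prop := ∃ w : G.Walk x y, w.length ≤ n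

namespace Reach

lemma refl (x : V) (n : ℕ) : Reach G n x x := ⟨.nil, Nat.zero_le _⟩

lemma of_adj {x y : V} (h : G.Adj x y) : Reach G 1 x y := ⟨h.toWalk, by simp⟩

lemma symm {n : ℕ} {x y : V} (h : Reach G n x y) : Reach G n y x := by
  obtain ⟨w, hw⟩ := h
  exact ⟨w.reverse, by simpa using hw⟩

lemma trans {n m k : ℕ} {x y z : V} (h : Reach G n x y) (h' : Reach G m y z) (hk : n + m ≤ k) :
    Reach G k x z := by
  obtain ⟨w, hw⟩ := h
  obtain ⟨w', hw'⟩ := h'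
  exact ⟨w.append w', by rw [SimpleGraph.Walk.length_append]; omega⟩

lemma of_seq {f : ℕ → V} {p : ℕ} (hf : ∀ i < p, G.Adj (f i) (f (i + 1))) {i j : ℕ} (hij : i ≤ j)
    (hj : j ≤ p) : Reach G (j - i) (f i) (f j) := by
  induction j, hij using Nat.le_induction with
  | base => exact refl _ _
  | succ j hij ih => exact (ih (by omega)).trans (of_adj (hf j (by omega))) (by omega)

lemma exists_seq {n : ℕ} {x y : V} (h : Reach G n x y) :
    ∃ p ≤ n, ∃ f : ℕ → V, f 0 = x ∧ f p = y ∧ ∀ i < p, G.Adj (f i) (f (i + 1)) := by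
  obtain ⟨w, hw⟩ := h
  exact ⟨w.length, hw, w.getVert, w.getVert_zero, w.getVert_length,
    fun i hi => w.adj_getVert_succ hi⟩

end Reach

/-- A shortest walk is an induced path. -/
lemma isPathSeq_of_shortest {f : ℕ → V} {p : ℕ} (hf : ∀ i < p, G.Adj (f i) (f (i + 1)))
    (hno : ∀ p' < p, ¬ Reach G p' (f 0) (f p)) : IsPathSeq G p f := by
  have hreach : ∀ {i j : ℕ}, i ≤ j → j ≤ p → Reach G (j - i) (f i) (f j) :=
    fun hij hj => Reach.of_seq hf hij hj
  have hne : ∀ i j, i < j → j ≤ p → f i ≠ f j := by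
    intro i j hij hj h
    have h1 := hreach (Nat.zero_le i) (by omega)
    rw [h] at h1
    exact hno (p - (j - i)) (by omega) (h1.trans (hreach hj le_rfl) (by omega))
  have hnadj : ∀ i j, i + 1 < j → j ≤ p → ¬ G.Adj (f i) (f j) := by
    intro i j hij hj h
    exact hno (i + 1 + (p - j)) (by omega)
      (((hreach (Nat.zero_le i) (by omega)).trans (Reach.of_adj h) le_rfl).trans
        (hreach hj le_rfl) (by omega))
  constructor
  · intro i j hi hj h
    rcases lt_trichotomy i j with hij | hij | hij
    · exact absurd h (hne i j hij hj)
    · exact hij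
    · exact absurd h.symm (hne j i hij hi)
  · intro i j hi hj
    constructor
    · intro h
      by_contra hcon
      rcases lt_trichotomy i j with hij | hij | hij
      · exact hnadj i j (by omega) hj h
      · exact G.irrefl (hij ▸ h)
      · exact hnadj j i (by omega) hi h.symm
    · rintro (rfl | rfl)
      · exact hf i (by omega)
      · exact (hf j (by omega)).symm

/-- Vertices of the hole that are joined by a walk of length `n` have distance at most `n` in the
hole. -/
def Geodesic (G : SimpleGraph V) (N : ℕ) (c : ℕ → V) (n : ℕ) : Prop :=
  ∀ s t, s ≤ t → t < s + N → Reach G n (c s) (c t) → t ≤ s + n ∨ s + N ≤ t + n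

lemma Geodesic.rotate {c : ℕ → V} {n : ℕ} (h : Geodesic G N c n) (x : ℕ) :
    Geodesic G N (fun i => c (i + x)) n := by
  intro s t hst ht hr
  have := h (s + x) (t + x) (by omega) (by omega) hr
  omega

lemma Geodesic.reflect {c : ℕ → V} {n : ℕ} (h : Geodesic G N c n) (hc : IsHoleSeq G N c) (x : ℕ) :
    Geodesic G N (fun i => c (x + (N - i % N))) n := by
  refine (hc.reflect x).spread_of_window (fun _ _ h => h.symm) 0 ?_
  intro s t _ hst ht hr
  simp only [Nat.mod_eq_of_lt (show t < N by omega), Nat.mod_eq_of_lt (show s < N by omega)] at hr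
  have := h _ _ (by omega) (by omega) hr.symm
  omega

/-- No vertex is major for the hole. -/
def CleanSeq (G : SimpleGraph V) (N : ℕ) (c : ℕ → V) : Prop :=
  ∀ y, (∀ j, y ≠ c j) → Close G N c y

lemma CleanSeq.rotate {c : ℕ → V} (h : CleanSeq G N c) (hc : IsHoleSeq G N c) (x : ℕ) :
    CleanSeq G N (fun i => c (i + x)) := by
  intro y hy
  refine (h y fun j => ?_).rotate x
  obtain ⟨j', h1, h2, h3⟩ := hc.exists_window x j
  rw [← h3]
  simpa [show j' - x + x = j' by omega] using hy (j' - x)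

lemma CleanSeq.reflect {c : ℕ → V} (h : CleanSeq G N c) (hc : IsHoleSeq G N c) (x : ℕ) :
    CleanSeq G N (fun i => c (x + (N - i % N))) := by
  intro y hy
  have hcl : Close G N c y := by
    refine h y fun j => ?_
    obtain ⟨j', h1, h2, h3⟩ := hc.exists_window (x + 1) j
    rw [← h3]
    have : y ≠ c (x + (N - (x + N - j') % N)) := hy _
    rwa [Nat.mod_eq_of_lt (by omega), show x + (N - (x + N - j')) = j' by omega] at this
  apply (hc.reflect x).close_of_window 0
  intro s t _ hst ht hs ht'
  simp only [Nat.mod_eq_of_lt (show t < N by omega), Nat.mod_eq_of_lt (show s < N by omega)]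
    at hs ht'
  have := hcl _ _ (by omega) (by omega) ht' hs
  omega

/-- A walk between two vertices of a clean hole that is shorter than both paths of the hole between
them, of minimum length. -/
structure Shortcut (G : SimpleGraph V) (N : ℕ) (c f : ℕ → V) (p m : ℕ) : Prop where
  hole : IsHoleSeq G N c
  clean : CleanSeq G N c
  geo : ∀ p' < p, Geodesic G N c p'
  walk : ∀ i < p, G.Adj (f i) (f (i + 1))
  first : f 0 = c 0
  last : f p = c m
  short : 2 * p + 3 ≤ N
  lt : p < m
  lt' : p + m < N

namespace Shortcut

variable {c f : ℕ → V} {p m : ℕ}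

lemma reverse (S : Shortcut G N c f p m) :
    Shortcut G N (fun i => c (m + (N - i % N))) (fun i => f (p - i)) p m where
  hole := S.hole.reflect _
  clean := S.clean.reflect S.hole _
  geo p' hp' := (S.geo p' hp').reflect S.hole _
  walk i hi := by
    have := (S.walk (p - (i + 1)) (by omega)).symm
    rwa [show p - (i + 1) + 1 = p - i by omega] at this
  first := by simp [S.last, S.hole.per]
  last := by
    have := S.lt'
    rw [S.hole.reflect_apply (by omega) le_rfl]
    simpa using S.first
  short := S.short
  lt := S.lt
  lt' := S.lt'

/-- The walk is kept and the hole is turned round at `c 0`, which exchanges the two arcs between the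
ends of the walk. -/
lemma flip (S : Shortcut G N c f p m) :
    Shortcut G N (fun i => c (0 + (N - i % N))) f p (N - m) where
  hole := S.hole.reflect _
  clean := S.clean.reflect S.hole _
  geo p' hp' := (S.geo p' hp').reflect S.hole _
  walk := S.walk
  first := by
    rw [S.first, ← S.hole.per 0]
    simp
  last := by
    have := S.lt'
    have := S.lt
    rw [S.last, Nat.mod_eq_of_lt (by omega)]
    congr 1
    omega
  short := S.short
  lt := by have := S.lt'; omega
  lt' := by have := S.lt; have := S.lt'; omega

lemma reach (S : Shortcut G N c f p m) {i j : ℕ} (hij : i ≤ j) (hj : j ≤ p) :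
    Reach G (j - i) (f i) (f j) := Reach.of_seq S.walk hij hj

lemma path (S : Shortcut G N c f p m) : IsPathSeq G p f := by
  have hlt := S.lt
  have hlt' := S.lt'
  refine isPathSeq_of_shortest S.walk fun p' hp' h => ?_
  rw [S.first, S.last] at h
  have := S.geo p' hp' 0 m (by omega) (by omega) h
  omega

/-- If `f i` reaches `c j` within `e` steps, then `c j` is as close to `c 0` and to `c m` as
that says. -/
lemma near (S : Shortcut G N c f p m) {i j e : ℕ} (hi : i ≤ p) (hj : j < N)
    (h : Reach G e (f i) (c j)) :
    (i + e < p → j ≤ i + e ∨ N ≤ j + (i + e)) ∧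
    (e < i → (j ≤ m + (p - i + e) ∧ m ≤ j + (p - i + e)) ∨
      j + N ≤ m + (p - i + e) ∨ m + N ≤ j + (p - i + e)) := by
  have hlt := S.lt
  have hlt' := S.lt'
  constructor
  · intro he
    have := S.geo (i + e) he 0 j (by omega) (by omega)
      (by rw [← S.first]; exact (S.reach (Nat.zero_le i) hi).trans h (by omega))
    omega
  · intro he
    have hr : Reach G (p - i + e) (c m) (c j) := by
      rw [← S.last]
      exact (S.reach hi le_rfl).symm.trans h le_rfl
    rcases le_total j m with hjm | hjm
    · have := S.geo (p - i + e) (by omega) j m hjm (by omega) hr.symm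
      omega
    · have := S.geo (p - i + e) (by omega) m j hjm (by omega) hr
      omega

/-- A common vertex would split the walk into two shorter ones, both geodesic by minimality, and
then the ends would have distance at most `p` in the hole. -/
lemma disj (S : Shortcut G N c f p m) {i : ℕ} (hi : 0 < i) (hip : i < p) (j : ℕ) : f i ≠ c j := by
  obtain ⟨j', hj, hj'⟩ := S.hole.exists_lt j
  rw [← hj']
  intro h
  have hlt := S.lt
  have hlt' := S.lt'
  have := S.near (i := i) (j := j') (e := 0) (by omega) hj (h ▸ Reach.refl _ _)
  omega

lemma near_adj (S : Shortcut G N c f p m) {i j : ℕ} (hi : i ≤ p) (hj : j < N)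
    (h : G.Adj (f i) (c j)) :
    (i + 1 < p → j ≤ i + 1 ∨ N ≤ j + (i + 1)) ∧
    (1 < i → (j ≤ m + (p - i + 1) ∧ m ≤ j + (p - i + 1)) ∨
      j + N ≤ m + (p - i + 1) ∨ m + N ≤ j + (p - i + 1)) :=
  S.near hi hj (Reach.of_adj h)

lemma close (S : Shortcut G N c f p m) {i : ℕ} (hi : 0 < i) (hip : i < p) :
    Close G N c (f i) := S.clean _ (S.disj hi hip)

lemma adj_first (S : Shortcut G N c f p m) (hp : 0 < p) : G.Adj (f 1) (c 0) := by
  rw [← S.first]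
  exact (S.walk 0 hp).symm

lemma adj_last (S : Shortcut G N c f p m) (hp : 0 < p) : G.Adj (f (p - 1)) (c m) := by
  have := S.walk (p - 1) (by omega)
  rwa [show p - 1 + 1 = p by omega, S.last] at this

/-- Since `f 1` is adjacent to `c 0`, cleanness places `j` among `N - 2`, `N - 1`. Then the walk `c
(i + 1), f i, …, f 1, c j` has length `i + 1 < p` but is shorter than both arcs. -/
lemma no_left (S : Shortcut G N c f p m) {i : ℕ} (hi : 1 < i) (hip : i + 1 < p)
    (h : G.Adj (f i) (c (i + 1))) {j : ℕ} (hmj : m < j) (hj : j < N) : ¬ G.Adj (f 1) (c j) := by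
  intro hj'
  have hlt := S.lt
  have hlt' := S.lt'
  have hs := S.short
  have h1 := S.close (i := 1) (by omega) (by omega) 0 j (by omega) (by omega)
    (S.adj_first (by omega)) hj'
  have h2 := S.geo (i + 1) hip (i + 1) j (by omega) (by omega)
    (((Reach.of_adj h).symm.trans (S.reach hi.le (by omega)).symm le_rfl).trans
      (Reach.of_adj hj') (by omega))
  omega

lemma no_right (S : Shortcut G N c f p m) {i : ℕ} (hi : 1 < i) (hip : i + 1 < p)
    (h : G.Adj (f i) (c i)) (hm : m = p + 1) {j : ℕ} (hmj : m < j) (hj : j < N) :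
    ¬ G.Adj (f (p - 1)) (c j) := by
  have hlt' := S.lt'
  have := S.reverse.no_left (i := p - i) (j := m + N - j) (by omega) (by omega)
    (by
      rw [S.hole.reflect_apply (by omega) (by omega)]
      simpa [show p - (p - i) = i by omega, show m - (p - i + 1) = i by omega] using h)
    (by omega) (by omega)
  rwa [Nat.mod_eq_of_lt (by omega), show m + (N - (m + N - j)) = j by omega] at this

/-- The walk from `c j` through `f i` and `f i'` to `c j'` has length `|i - i'| + 2 < p`, so
minimality applies to it. By `near_adj` the two vertices lie on opposite arcs, too far from `c 0`
and `c m` to be that close in the hole. -/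
lemma one_side (S : Shortcut G N c f p m) {i j i' j' : ℕ} (hi : 1 < i) (hip : i + 1 < p)
    (hi' : 1 < i') (hip' : i' + 1 < p) (hj : j ≤ m) (h : G.Adj (f i) (c j)) (hj' : m < j')
    (hjN : j' < N) : ¬ G.Adj (f i') (c j') := by
  intro h'
  have hlt := S.lt
  have hlt' := S.lt'
  have hs := S.short
  have h1 := S.near_adj (by omega) (by omega) h
  have h2 := S.near_adj (by omega) (by omega) h'
  rcases le_total i i' with hii | hii
  · have := S.geo (i' - i + 2) (by omega) j j' (by omega) (by omega)
      (((Reach.of_adj h).symm.trans (S.reach hii (by omega)) le_rfl).trans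
        (Reach.of_adj h') (by omega))
    omega
  · have := S.geo (i - i' + 2) (by omega) j j' (by omega) (by omega)
      (((Reach.of_adj h).symm.trans (S.reach hii (by omega)).symm le_rfl).trans
        (Reach.of_adj h') (by omega))
    omega

/-- By `near_adj`, `j` is `i` or `i + 1`, and `no_left` excludes `i + 1`. Now `j = i` forces `m = p
+ 1` and `k = N - 1`, and the interior of the walk closes up with `c m, …, c (N - 1)` to an odd hole
of length `N - 2`. -/
lemma false_of_left (T : Tight ℓ N G) (S : Shortcut G N c f p m) {i j : ℕ} (hi : 1 < i)
    (hip : i + 1 < p) (hj : j ≤ m) (h : G.Adj (f i) (c j)) {k : ℕ} (hmk : m < k) (hk : k < N)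
    (h' : G.Adj (f 1) (c k)) : False := by
  have hlt := S.lt
  have hlt' := S.lt'
  have hs := S.short
  have hN := T.len
  have h1 := S.near_adj (by omega) (by omega) h
  obtain rfl | rfl : j = i ∨ j = i + 1 := by omega
  swap
  · exact S.no_left hi hip h hmk hk h'
  have hm : m = p + 1 := by
    by_contra hcon
    omega
  have hleft : ∀ k, m < k → k < N → G.Adj (f 1) (c k) → k = N - 1 := by
    intro k hmk hk h'
    have h2 := S.close (i := 1) (by omega) (by omega) 0 k (by omega) (by omega)
      (S.adj_first (by omega)) h'
    have h3 := S.geo (j + 1) hip j k (by omega) (by omega)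
      (((Reach.of_adj h).symm.trans (S.reach hi.le (by omega)).symm le_rfl).trans
        (Reach.of_adj h') (by omega))
    omega
  have hkN := hleft k hmk hk h'
  subst hkN
  have A : Attach G N (fun i => c (i + (N - 1))) (p - 2) (fun i => f (1 + i)) (m + 1) :=
    { hole := S.hole.rotate _
      path := S.path.sub (by omega)
      disj := fun i j hi => S.disj (by omega) (by omega) _
      lt := by omega
      adj := by
        intro x y hx hy hyN
        have hcy : c (y + (N - 1)) = c (y - 1) := by
          rw [show y + (N - 1) = y - 1 + N by omega, S.hole.per]
        simp only [hcy]
        by_cases hym : y = m + 1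
        · rw [hym, Nat.add_sub_cancel, ← S.last, S.path.adj _ _ (by omega) (by omega)]
          omega
        · constructor
          · intro hxy
            by_cases hx0 : x = 0
            · subst hx0
              have := hleft (y - 1) (by omega) (by omega) hxy
              omega
            · by_cases hxp : x = p - 2
              · rw [show 1 + x = p - 1 by omega] at hxy
                exact absurd hxy (S.no_right hi hip h hm (by omega) (by omega))
              · exact absurd hxy (S.one_side hi hip (by omega) (by omega) hj h (by omega)
                  (by omega))
          · rintro (hxy | ⟨rfl, rfl⟩)
            · omega
            · exact h' }
  exact T.outer_odd A (by omega) (by omega) (by omega)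

/-- The edge `f i - c j` puts `m` between `p + 1` and `p + 2`, and it keeps every interior vertex of
the walk free of neighbours on the other arc. -/
lemma false_of_mid (T : Tight ℓ N G) (S : Shortcut G N c f p m) {i j : ℕ} (hi : 1 < i)
    (hip : i + 1 < p) (hj : j ≤ m) (h : G.Adj (f i) (c j)) : False := by
  have hlt := S.lt
  have hlt' := S.lt'
  have hs := S.short
  have hN := T.len
  have h1 := S.near_adj (by omega) (by omega) h
  have hright : ∀ x y, 0 < x → x < p → y < N → G.Adj (f x) (c y) → y ≤ m := by
    intro x y hx hxp hy hxy
    by_contra hcon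
    by_cases hx1 : x = 1
    · exact S.false_of_left T hi hip hj h (by omega) hy (hx1 ▸ hxy)
    · by_cases hxp1 : x = p - 1
      · refine S.reverse.false_of_left T (i := p - i) (j := m - j) (k := m + N - y) (by omega)
          (by omega) (by omega) ?_ (by omega) (by omega) ?_
        · rw [S.hole.reflect_apply (by omega) (by omega)]
          simpa [show p - (p - i) = i by omega, show m - (m - j) = j by omega] using h
        · rwa [Nat.mod_eq_of_lt (by omega), show m + (N - (m + N - y)) = y by omega, ← hxp1]
      · exact S.one_side hi hip (by omega) (by omega) hj h (by omega) hy hxy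
  -- For `m = p + 1` the shortcut is a ladder. For `m = p + 2` the other arc completes the interior
  -- of the walk to an odd hole of length `N - 2`.
  by_cases hm : m = p + 1
  · subst hm
    refine Ladder.false T (c := c) (f := f) (p := p)
      ⟨S.hole, S.path, S.first, S.last, S.short, fun i j hi hi' => S.disj hi hi' j, ?_⟩
    intro x y hx hxp hy hxy
    have h2 := hright x y hx hxp hy hxy
    by_cases hx1 : x = 1
    · have h3 := S.close hx hxp 0 y (by omega) (by omega)
        (by rw [hx1]; exact S.adj_first (by omega)) hxy
      omega
    · by_cases hxp1 : x = p - 1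
      · have h3 := S.close hx hxp y (p + 1) (by omega) (by omega) hxy
          (by rw [hxp1]; exact S.adj_last (by omega))
        omega
      · have h3 := S.near_adj (by omega) (by omega) hxy
        omega
  · have A : Attach G N c (p - 2) (fun i => f (1 + i)) m :=
      { hole := S.hole
        path := S.path.sub (by omega)
        disj := fun i j hi => S.disj (by omega) (by omega) _
        lt := by omega
        adj := by
          intro x y hx hy hyN
          by_cases hym : y = m
          · rw [hym, ← S.last, S.path.adj _ _ (by omega) (by omega)]
            omega
          · by_cases hyN' : y = N
            · rw [hyN', ← Nat.zero_add N, S.hole.per, ← S.first,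
                S.path.adj _ _ (by omega) (by omega)]
              omega
            · constructor
              · intro hxy
                have := hright _ _ (by omega) (by omega) (by omega) hxy
                omega
              · omega }
    exact T.outer_odd A (by omega) (by omega) (by omega)

lemma false (T : Tight ℓ N G) (S : Shortcut G N c f p m) : False := by
  have hlt := S.lt
  have hlt' := S.lt'
  have hs := S.short
  by_cases hp0 : p = 0
  · subst hp0
    have := S.hole.inj 0 m (by omega) (by omega) (by rw [← S.first, ← S.last])
    omega
  by_cases hp1 : p = 1
  · subst hp1
    have := S.adj_last (by omega)
    rw [show 1 - 1 = 0 by rfl, S.first, S.hole.adj _ _ (by omega) (by omega)] at this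
    omega
  have hfirst := S.adj_first (by omega)
  have hlast := S.adj_last (by omega)
  by_cases hp2 : p = 2
  · subst hp2
    have := S.close (i := 1) (by omega) (by omega) 0 m (by omega) (by omega) hfirst hlast
    omega
  refine T.shape (u := 0) (v := m) (r := p - 2) S.hole
    (S.path.sub (x := 1) (by omega)) (by omega)
    (fun i j hi => S.disj (by omega) (by omega) j) ?_ (S.close (by omega) (by omega))
    (S.close (by omega) (by omega)) hfirst (by rwa [show 1 + (p - 2) = p - 1 by omega])
    (Or.inl ⟨by omega, by omega⟩)
  intro i j hi hi' h
  obtain ⟨j', hj, hj'⟩ := S.hole.exists_lt j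
  rw [← hj'] at h
  by_cases hjm : j' ≤ m
  · exact S.false_of_mid T (by omega) (by omega) hjm h
  · refine S.flip.false_of_mid T (i := 1 + i) (j := N - j') (by omega) (by omega) (by omega) ?_
    rwa [Nat.mod_eq_of_lt (by omega), show 0 + (N - (N - j')) = j' by omega]

end Shortcut

/-- A clean shortest long odd hole is isometric up to nearly half its length. -/
lemma Tight.geodesic (T : Tight ℓ N G) {c : ℕ → V} (hc : IsHoleSeq G N c) (hcl : CleanSeq G N c)
    (n : ℕ) (hn : 2 * n + 3 ≤ N) : Geodesic G N c n := by
  induction n using Nat.strong_induction_on with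
  | _ n ih =>
    intro s t hst ht hr
    by_contra hcon
    obtain ⟨p, hp, f, f0, f1, hf⟩ := hr.exists_seq
    -- A walk of exactly `n` edges is a minimal shortcut; a shorter one is covered by induction.
    by_cases hpn : p = n
    · subst hpn
      exact Shortcut.false T (c := fun i => c (i + s)) (f := f) (p := p) (m := t - s)
        { hole := hc.rotate s
          clean := hcl.rotate hc s
          geo := fun p' hp' => (ih p' hp' (by omega)).rotate s
          walk := hf
          first := by simpa using f0
          last := by simpa [show t - s + s = t by omega] using f1
          short := hn
          lt := by omega
          lt' := by omega }
    · have := ih p (by omega) (by omega) s t hst ht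
        (by rw [← f0, ← f1]; exact Reach.of_seq hf (Nat.zero_le p) le_rfl)
      omega

end Geodesic

/-! ### Exchanging paths of the hole for shortest paths -/

section Replace

variable {V : Type*} {G : SimpleGraph V} {ℓ N : ℕ}

/-- The cyclic sequence `c` with `c 0, …, c m` replaced by `f 0, …, f m`. -/
def reroute (N : ℕ) (c f : ℕ → V) (m i : ℕ) : V := if i % N ≤ m then f (i % N) else c i

lemma Tight.not_reach (T : Tight ℓ N G) {c f : ℕ → V} {m : ℕ} (hc : IsHoleSeq G N c)
    (hcl : CleanSeq G N c) (f0 : f 0 = c 0) (f1 : f m = c m) (hm : 2 * m + 3 ≤ N) {p : ℕ}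
    (hp : p < m) : ¬ Reach G p (f 0) (f m) := by
  intro h
  rw [f0, f1] at h
  have := T.geodesic hc hcl p (by omega) 0 m (by omega) (by omega) h
  omega

/-- A path of a clean shortest long odd hole may be replaced by any shortest path. -/
lemma Tight.isHoleSeq_reroute (T : Tight ℓ N G) {c f : ℕ → V} {m : ℕ} (hc : IsHoleSeq G N c)
    (hcl : CleanSeq G N c) (hf : ∀ i < m, G.Adj (f i) (f (i + 1))) (f0 : f 0 = c 0)
    (f1 : f m = c m) (hm1 : 1 ≤ m) (hm : 2 * m + 3 ≤ N) : IsHoleSeq G N (reroute N c f m) := by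
  have hpath := isPathSeq_of_shortest hf fun p hp => T.not_reach hc hcl f0 f1 hm hp
  -- `e = 0` is for a common vertex, `e = 1` for an edge. Measuring from both `c 0` and `c m` leaves
  -- only `N ≤ 2 * m + 2 * e`.
  have near : ∀ i j e, e ≤ 1 → i + e ≤ m → e ≤ i → m < j → j < N → Reach G e (f i) (c j) → False := by
    intro i j e he hie hei hmj hj h
    have h1 := T.geodesic hc hcl (i + e) (by omega) 0 j (by omega) (by omega)
      (by rw [← f0]; exact (Reach.of_seq hf (Nat.zero_le i) (by omega)).trans h (by omega))
    have h2 := T.geodesic hc hcl (m - i + e) (by omega) m j (by omega) (by omega)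
      (by rw [← f1]; exact (Reach.of_seq hf (show i ≤ m by omega) le_rfl).symm.trans h (by omega))
    omega
  have hglue := IsHoleSeq.of_glue (a := m) (b := N - m - 2) (f := f)
    (g := fun j => c (m + 1 + j)) (by omega) hpath (hc.arc (m + 1) (by omega))
    (fun i j hi hj h => by
      by_cases hi0 : i = 0
      · rw [hi0, f0] at h
        have := hc.inj _ _ (by omega) (by omega) h
        omega
      · exact near i (m + 1 + j) 0 (by omega) (by omega) (by omega) (by omega) (by omega)
          (h ▸ Reach.refl _ _))
    (fun i j hi hj => by
      by_cases hi0 : i = 0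
      · rw [hi0, f0, hc.adj _ _ (by omega) (by omega)]
        omega
      · by_cases him : i = m
        · rw [him, f1, hc.adj _ _ (by omega) (by omega)]
          omega
        · constructor
          · intro h
            exact (near i (m + 1 + j) 1 (by omega) (by omega) (by omega) (by omega) (by omega)
              (Reach.of_adj h)).elim
          · omega)
  rw [show m + (N - m - 2) + 2 = N by omega] at hglue
  convert hglue using 2 with i
  simp only [reroute]
  split_ifs with h
  · rfl
  · rw [show m + 1 + (i % N - (m + 1)) = i % N by omega, hc.apply_mod]

/-- The new hole is clean again if the replaced path is short enough. -/
lemma Tight.cleanSeq_reroute (T : Tight ℓ N G) {c f : ℕ → V} {m : ℕ} (hc : IsHoleSeq G N c)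
    (hcl : CleanSeq G N c) (hf : ∀ i < m, G.Adj (f i) (f (i + 1))) (f0 : f 0 = c 0)
    (f1 : f m = c m) (hm1 : 1 ≤ m) (hm : 2 * m + 5 ≤ N) : CleanSeq G N (reroute N c f m) := by
  intro y hy
  apply (T.isHoleSeq_reroute hc hcl hf f0 f1 hm1 (by omega)).close_of_window 0
  intro i j _ hij hj hyi hyj
  have val : ∀ i, i < N → i ≤ m → reroute N c f m i = f i := fun i h h' => by
    rw [reroute, Nat.mod_eq_of_lt h, if_pos h']
  have val' : ∀ i, i < N → (i = 0 ∨ m ≤ i) → reroute N c f m i = c i := fun i h h' => by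
    rw [reroute, Nat.mod_eq_of_lt h]
    split_ifs with him
    · obtain rfl | rfl : i = 0 ∨ i = m := by omega
      · exact f0
      · exact f1
    · rfl
  -- With both neighbours on the new path, `y` would shorten that path if they were more than two
  -- apart.
  by_cases hjm : j ≤ m
  · rw [val i (by omega) (by omega)] at hyi
    rw [val j (by omega) (by omega)] at hyj
    by_contra hcon
    exact T.not_reach hc hcl f0 f1 (by omega) (p := i + 2 + (m - j)) (by omega)
      (((Reach.of_seq hf (Nat.zero_le i) (by omega)).trans
        ((Reach.of_adj hyi).symm.trans (Reach.of_adj hyj) le_rfl) le_rfl).trans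
        (Reach.of_seq hf hjm le_rfl) (by omega))
  rw [val' j (by omega) (by omega)] at hyj
  -- A removed vertex of the old hole has no neighbour beyond `c m`, so `y` lies off the old hole
  -- too, whose cleanness applies.
  have hyc : ∀ k, y ≠ c k := by
    intro k hk
    obtain ⟨k', hk', hkk⟩ := hc.exists_lt k
    rw [← hkk] at hk
    by_cases h : k' = 0 ∨ m ≤ k'
    · exact hy k' (by rw [hk, val' k' hk' h])
    · rw [hk, hc.adj _ _ hk' (by omega)] at hyj
      omega
  by_cases hi : i = 0 ∨ m ≤ i
  · rw [val' i (by omega) hi] at hyi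
    exact hcl y hyc i j hij (by omega) hyi hyj
  · rw [val i (by omega) (by omega)] at hyi
    -- The two distance estimates leave either the desired closeness or `N ≤ 2 * m + 4`, so the
    -- bound is `2 * m + 5 ≤ N`.
    have hr : Reach G 2 (f i) (c j) := (Reach.of_adj hyi).symm.trans (Reach.of_adj hyj) le_rfl
    have h1 := T.geodesic hc hcl (i + 2) (by omega) 0 j (by omega) (by omega)
      (by rw [← f0]; exact (Reach.of_seq hf (Nat.zero_le i) (by omega)).trans hr (by omega))
    have h2 := T.geodesic hc hcl (m - i + 2) (by omega) m j (by omega) (by omega)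
      (by rw [← f1]; exact (Reach.of_seq hf (show i ≤ m by omega) le_rfl).symm.trans hr (by omega))
    omega

/-- Three sequences, without their last terms, one after the other. -/
def concat₃ {W : Type*} (f₁ f₂ f₃ : ℕ → W) (m₁ m₂ i : ℕ) : W :=
  if i < m₁ then f₁ i else if i < m₁ + m₂ then f₂ (i - m₁) else f₃ (i - (m₁ + m₂))

/-- The paths are exchanged one at a time, the hole being rotated so that the next path starts at
`0`. Only the first two exchanges have to preserve cleanness, hence the weaker bound on `m₃`. -/
lemma Tight.isHoleSeq_concat (T : Tight ℓ N G) {c f₁ f₂ f₃ : ℕ → V} {m₁ m₂ m₃ : ℕ}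
    (hc : IsHoleSeq G N c) (hcl : CleanSeq G N c) (hm : m₁ + m₂ + m₃ = N)
    (h₁ : 1 ≤ m₁) (h₂ : 1 ≤ m₂) (h₃ : 1 ≤ m₃)
    (l₁ : 2 * m₁ + 5 ≤ N) (l₂ : 2 * m₂ + 5 ≤ N) (l₃ : 2 * m₃ + 3 ≤ N)
    (w₁ : ∀ i < m₁, G.Adj (f₁ i) (f₁ (i + 1))) (s₁ : f₁ 0 = c 0) (t₁ : f₁ m₁ = c m₁)
    (w₂ : ∀ i < m₂, G.Adj (f₂ i) (f₂ (i + 1))) (s₂ : f₂ 0 = c m₁) (t₂ : f₂ m₂ = c (m₁ + m₂))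
    (w₃ : ∀ i < m₃, G.Adj (f₃ i) (f₃ (i + 1))) (s₃ : f₃ 0 = c (m₁ + m₂)) (t₃ : f₃ m₃ = c 0) :
    IsHoleSeq G N (fun i => concat₃ f₁ f₂ f₃ m₁ m₂ (i % N)) := by
  have hc1 := T.isHoleSeq_reroute hc hcl w₁ s₁ t₁ h₁ (by omega)
  have hcl1 := (T.cleanSeq_reroute hc hcl w₁ s₁ t₁ h₁ l₁).rotate hc1 m₁
  replace hc1 := hc1.rotate m₁
  generalize hd1 : (fun i => reroute N c f₁ m₁ (i + m₁)) = d₁ at hc1 hcl1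
  have e1 : ∀ i, i + m₁ < N → d₁ i = c (i + m₁) := by
    intro i hi
    rw [← hd1]
    simp only [reroute, Nat.mod_eq_of_lt hi]
    split_ifs with h
    · obtain rfl : i = 0 := by omega
      simpa using t₁
    · rfl
  have e1' : ∀ i, i < m₁ → d₁ (i + m₂ + m₃) = f₁ i := by
    intro i hi
    rw [← hd1]
    simp only [reroute, show i + m₂ + m₃ + m₁ = i + N by omega, Nat.add_mod_right,
      Nat.mod_eq_of_lt (show i < N by omega), if_pos hi.le]
  have s2 : f₂ 0 = d₁ 0 := by rw [s₂, e1 0 (by omega), Nat.zero_add]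
  have t2 : f₂ m₂ = d₁ m₂ := by rw [t₂, e1 m₂ (by omega), Nat.add_comm]
  have hc2 := T.isHoleSeq_reroute hc1 hcl1 w₂ s2 t2 h₂ (by omega)
  have hcl2 := (T.cleanSeq_reroute hc1 hcl1 w₂ s2 t2 h₂ l₂).rotate hc2 m₂
  replace hc2 := hc2.rotate m₂
  generalize hd2 : (fun i => reroute N d₁ f₂ m₂ (i + m₂)) = d₂ at hc2 hcl2
  have e2 : ∀ i, 0 < i → i + m₂ < N → d₂ i = d₁ (i + m₂) := by
    intro i h0 hi
    rw [← hd2]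
    simp only [reroute, Nat.mod_eq_of_lt hi, if_neg (show ¬ (i + m₂ ≤ m₂) by omega)]
  have e2' : ∀ i, i ≤ m₂ → d₂ (i + m₃ + m₁) = f₂ i := by
    intro i hi
    rw [← hd2]
    simp only [reroute, show i + m₃ + m₁ + m₂ = i + N by omega, Nat.add_mod_right,
      Nat.mod_eq_of_lt (show i < N by omega), if_pos hi]
  have s3 : f₃ 0 = d₂ 0 := by
    rw [s₃, ← t₂, ← e2' m₂ le_rfl, ← hc2.per 0]
    congr 1
    omega
  have t3 : f₃ m₃ = d₂ m₃ := by
    rw [t₃, e2 m₃ h₃ (by omega), ← s₁, ← e1' 0 h₁]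
    congr 1
    omega
  have hc3 := (T.isHoleSeq_reroute hc2 hcl2 w₃ s3 t3 h₃ l₃).rotate m₃
  have key : ∀ i < N, reroute N d₂ f₃ m₃ (i + m₃) = concat₃ f₁ f₂ f₃ m₁ m₂ i := by
    intro i hi
    simp only [reroute, concat₃]
    by_cases h1 : i + m₃ < N
    · rw [Nat.mod_eq_of_lt h1]
      by_cases h2 : i < m₁
      · rw [if_pos h2, ← e1' i h2]
        by_cases h3 : i = 0
        · subst h3
          rw [if_pos (by omega), Nat.zero_add, Nat.zero_add, t3, e2 m₃ h₃ (by omega),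
            Nat.add_comm]
        · rw [if_neg (by omega), e2 _ (by omega) (by omega)]
          congr 1
          omega
      · rw [if_neg (by omega), if_neg h2, if_pos (by omega), ← e2' (i - m₁) (by omega)]
        congr 1
        omega
    · have : (i + m₃) % N = i - (m₁ + m₂) := by
        rw [show i + m₃ = i - (m₁ + m₂) + N by omega, Nat.add_mod_right,
          Nat.mod_eq_of_lt (by omega)]
      rw [this, if_pos (by omega), if_neg (by omega), if_neg (by omega)]
  have hN : 0 < N := by omega
  convert hc3 using 2 with i
  rw [← key _ (Nat.mod_lt i hN)]
  exact (hc3.apply_mod i)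

lemma Hole.cleanSeq {C : Hole G} (hC : C.IsClean) : CleanSeq G C.length C.seq := by
  intro y hy
  have h4 := C.four_le
  have hseq : ∀ i (h : i < C.length), C.seq i = C.emb ⟨i, h⟩ := fun i h => by
    simp only [Hole.seq, Nat.mod_eq_of_lt h]
  have hnot := hC y
  rw [Hole.IsMajor, not_and_not_right] at hnot
  obtain ⟨a, b, d, _, hab, hbd, hall⟩ := hnot (by
    rintro ⟨j, rfl⟩
    exact hy j.val (hseq j.val j.2).symm)
  rw [cycleGraph_adj_iff] at hab hbd
  apply C.isHoleSeq.close_of_window 0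
  intro i j _ hij hj hi' hj'
  have hi := hall ⟨i, by omega⟩ (by rwa [← hseq])
  have hj := hall ⟨j, by omega⟩ (by rwa [← hseq])
  simp only [Fin.ext_iff] at hi hj
  omega

lemma Hole.tight (hℓ : 5 ≤ ℓ) (hG : IsCandidate ℓ G) {C : Hole G} (hC : C.IsShortestLongOdd ℓ) :
    Tight ℓ C.length G where
  five_le := hℓ
  len := by
    by_contra hcon
    have := hC.1.2
    exact hG.2.2 ⟨C, hC.1, by rw [Nat.odd_iff] at this; omega⟩
  odd := Nat.odd_iff.1 hC.1.2
  no_pyramid := hG.1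
  no_jewel := hG.2.1
  min M c hc hM hM' := hC.2 (hc.toHole (by omega)) ⟨hM, Nat.odd_iff.2 hM'⟩

/-- `m` is the distance between `x` and `y`. -/
def IsDist (G : SimpleGraph V) (m : ℕ) (x y : V) : Prop := Reach G m x y ∧ ∀ p < m, ¬ Reach G p x y

/-- A clean shortest long odd hole gives three vertices such that any three shortest paths between
them form a long odd hole. -/
theorem exists_triple (hℓ : 5 ≤ ℓ) (hG : IsCandidate ℓ G) {C : Hole G}
    (hC : C.IsShortestLongOdd ℓ) (hcl : C.IsClean) :
    ∃ (u v w : V) (m₁ m₂ m₃ : ℕ), IsDist G m₁ u v ∧ IsDist G m₂ v w ∧ IsDist G m₃ w u ∧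
      ℓ ≤ m₁ + m₂ + m₃ ∧ (m₁ + m₂ + m₃) % 2 = 1 ∧ ∀ f₁ f₂ f₃ : ℕ → V,
        (∀ i < m₁, G.Adj (f₁ i) (f₁ (i + 1))) → f₁ 0 = u → f₁ m₁ = v →
        (∀ i < m₂, G.Adj (f₂ i) (f₂ (i + 1))) → f₂ 0 = v → f₂ m₂ = w →
        (∀ i < m₃, G.Adj (f₃ i) (f₃ (i + 1))) → f₃ 0 = w → f₃ m₃ = u →
        IsHoleSeq G (m₁ + m₂ + m₃)
          (fun i => concat₃ f₁ f₂ f₃ m₁ m₂ (i % (m₁ + m₂ + m₃))) := by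
  have T := Hole.tight hℓ hG hC
  have hc := C.isHoleSeq
  have hcs := Hole.cleanSeq hcl
  have hlen := T.len
  have hodd := T.odd
  generalize C.seq = c at hc hcs
  generalize C.length = N at *
  have hdist : ∀ s m, 2 * m + 3 ≤ N → IsDist G m (c s) (c (s + m)) := by
    intro s m hm
    constructor
    · have := Reach.of_seq (G := G) (f := fun i => c (s + i)) (p := m) (fun i hi => by
        rw [hc.adj_window s _ _ (by omega) (by omega) (by omega) (by omega)]
        omega) (Nat.zero_le m) le_rfl
      simpa using this
    · intro p hp h
      have := T.geodesic hc hcs p (by omega) s (s + m) (by omega) (by omega) h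
      omega
  -- Here `N ≥ 13`, and the bounds are sharp there: `13 = 4 + 4 + 5`.
  obtain ⟨a, b, hab, ha, hb, ha1, hb1⟩ : ∃ a b, a + a + b = N ∧ 2 * a + 5 ≤ N ∧ 2 * b + 3 ≤ N ∧
      1 ≤ a ∧ 1 ≤ b := ⟨(N + 1) / 3, N - 2 * ((N + 1) / 3), by omega, by omega, by omega, by omega,
      by omega⟩
  have h3 := hdist (a + a) b hb
  rw [hab, ← Nat.zero_add N, hc.per] at h3
  refine ⟨c 0, c a, c (a + a), a, a, b, ?_, hdist a a (by omega), h3, by omega, by omega, ?_⟩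
  · simpa using hdist 0 a (by omega)
  · intro f₁ f₂ f₃ w₁ s₁ t₁ w₂ s₂ t₂ w₃ s₃ t₃
    rw [hab]
    exact T.isHoleSeq_concat hc hcs hab ha1 ha1 hb1 ha ha hb w₁ s₁ t₁ w₂ s₂ t₂ w₃ s₃ t₃

end Replace

/-! ## Total correctness of word RAM programs -/

namespace RAM

/-- Started in `s`, the program halts within `T` steps in a state that satisfies `Q`. -/
def Ends (B : ℕ) (p : Program) (s : State) (T : ℕ) (Q : State → Prop) : Prop :=
  ∃ t s', Exec B p s t s' ∧ t ≤ T ∧ Q s'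

/-- The state with register `x` set to `v`. -/
def State.set (s : State) (x v : ℕ) : State := ⟨Function.update s.reg x v, s.mem⟩

/-- The state with memory cell `a` set to `v`. -/
def State.put (s : State) (a v : ℕ) : State := ⟨s.reg, Function.update s.mem a v⟩

@[simp] lemma State.set_mem (s : State) (x v : ℕ) : (s.set x v).mem = s.mem := rfl

@[simp] lemma State.put_reg (s : State) (a v : ℕ) : (s.put a v).reg = s.reg := rfl

@[simp] lemma State.set_reg (s : State) (x v y : ℕ) :
    (s.set x v).reg y = if y = x then v else s.reg y := by
  simp [State.set, Function.update_apply]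

@[simp] lemma State.put_mem (s : State) (a v b : ℕ) :
    (s.put a v).mem b = if b = a then v else s.mem b := by
  simp [State.put, Function.update_apply]

namespace Ends

variable {B : ℕ} {s : State} {T : ℕ} {Q : State → Prop}

lemma mono {p : Program} {T' : ℕ} {Q' : State → Prop} (h : Ends B p s T Q) (hT : T ≤ T')
    (hQ : ∀ s', Q s' → Q' s') : Ends B p s T' Q' := by
  obtain ⟨t, s', he, ht, hq⟩ := h
  exact ⟨t, s', he, ht.trans hT, hQ _ hq⟩

lemma skip (h : Q s) : Ends B .skip s 1 Q := ⟨1, s, .skip s, le_rfl, h⟩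

lemma assign {x : ℕ} {e : Expr} (he : e.Fits B s) (h : Q (s.set x (e.eval s))) :
    Ends B (.assign x e) s (e.cost + 1) Q := ⟨_, _, .assign x e s he, le_rfl, h⟩

lemma store {a e : Expr} (ha : a.Fits B s) (he : e.Fits B s)
    (h : Q (s.put (a.eval s) (e.eval s))) :
    Ends B (.store a e) s (a.cost + e.cost + 1) Q := ⟨_, _, .store a e s ha he, le_rfl, h⟩

/-- The run of `q` is part of the postcondition of `p`, so no intermediate assertion has to be
named. -/
lemma seq {p q : Program} {T' : ℕ} (h : Ends B p s T (fun s' => Ends B q s' T' Q)) :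
    Ends B (.seq p q) s (T + T') Q := by
  obtain ⟨t, s', he, ht, t', s'', he', ht', hq⟩ := h
  exact ⟨_, _, .seq he he', add_le_add ht ht', hq⟩

lemma ite {e : Expr} {p q : Program} (he : e.Fits B s) (h₁ : e.eval s ≠ 0 → Ends B p s T Q)
    (h₂ : e.eval s = 0 → Ends B q s T Q) : Ends B (.ite e p q) s (e.cost + 1 + T) Q := by
  by_cases h : e.eval s = 0
  · obtain ⟨t, s', hx, ht, hq⟩ := h₂ h
    exact ⟨_, _, .ite_false he h hx, by omega, hq⟩
  · obtain ⟨t, s', hx, ht, hq⟩ := h₁ h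
    exact ⟨_, _, .ite_true he h hx, by omega, hq⟩

end Ends

lemma Op.eval_lt_le (a b : ℕ) : Op.eval .lt a b ≤ 1 := by
  show (if a < b then 1 else 0) ≤ 1
  split_ifs <;> omega

lemma Op.eval_eq_le (a b : ℕ) : Op.eval .eq a b ≤ 1 := by
  show (if a = b then 1 else 0) ≤ 1
  split_ifs <;> omega

/-- Run the body for register `x` equal to `0, 1, …` up to the value of register `b`, exclusive. -/
def forLoop (x b : ℕ) (body : Program) : Program :=
  .seq (.assign x (.const 0)) (.loop (.bin .lt (.reg x) (.reg b))
    (.seq body (.assign x (.bin .add (.reg x) (.const 1)))))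

/-- Each round pays four steps for the test and four for the increment; the initial assignment and
the last test cost six. -/
lemma Ends.forLoop {B : ℕ} {x b N T : ℕ} {body : Program} {s : State} {I : ℕ → State → Prop}
    (hxb : x ≠ b) (hB : 1 < B) (hNB : N < B) (hb : s.reg b = N) (h0 : I 0 (s.set x 0))
    (hbody : ∀ i < N, ∀ s, I i s → s.reg x = i → s.reg b = N → Ends B body s T
      (fun s' => s'.reg x = i ∧ s'.reg b = N ∧ I (i + 1) (s'.set x (i + 1)))) :
    Ends B (forLoop x b body) s (N * (T + 8) + 6) (I N) := by
  have hloop : ∀ k i s, i + k = N → I i s → s.reg x = i → s.reg b = N →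
      Ends B (.loop (.bin .lt (.reg x) (.reg b))
        (.seq body (.assign x (.bin .add (.reg x) (.const 1))))) s (k * (T + 8) + 4) (I N) := by
    intro k
    induction k with
    | zero =>
      intro i s hi hI hx hb
      have hval : (Expr.bin .lt (.reg x) (.reg b)).eval s = 0 := by
        simp only [Expr.eval, Op.eval, hx, hb]
        exact if_neg (by omega)
      refine ⟨_, _, .loop_false ⟨?_, ?_, ?_⟩ hval, by simp [Expr.cost], ?_⟩
      · simp only [Expr.Fits]; omega
      · simp only [Expr.Fits]; omega
      · exact (Op.eval_lt_le _ _).trans_lt hB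
      · obtain rfl : i = N := by omega
        exact hI
    | succ k ih =>
      intro i s hi hI hx hb
      have hval : (Expr.bin .lt (.reg x) (.reg b)).eval s ≠ 0 := by
        simp only [Expr.eval, Op.eval, hx, hb]
        rw [if_pos (by omega)]
        exact one_ne_zero
      obtain ⟨t, s', he, ht, hx', hb', hI'⟩ := hbody i (by omega) s hI hx hb
      have hinc : Exec B (.assign x (.bin .add (.reg x) (.const 1))) s' 4 (s'.set x (i + 1)) := by
        have := Exec.assign (B := B) x (.bin .add (.reg x) (.const 1)) s' ⟨by
          simp only [Expr.Fits]; omega, by simp only [Expr.Fits]; omega, by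
          simp only [Expr.eval, Op.eval]; omega⟩
        simpa only [Expr.eval, Op.eval, hx', Expr.cost, State.set] using this
      obtain ⟨t', s'', he', ht', hI''⟩ := ih (i + 1) (s'.set x (i + 1)) (by omega) hI' (by simp)
        (by simp [Ne.symm hxb, hb'])
      refine ⟨_, _, .loop_true ⟨?_, ?_, ?_⟩ hval (.seq he hinc) he', ?_, hI''⟩
      · simp only [Expr.Fits]; omega
      · simp only [Expr.Fits]; omega
      · exact (Op.eval_lt_le _ _).trans_lt hB
      · simp only [Expr.cost]
        rw [Nat.succ_mul]
        omega
  refine (Ends.seq (Ends.assign (Q := fun s' => Ends B _ s' (N * (T + 8) + 4) (I N)) ?_ ?_)).mono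
    ?_ (fun _ h => h)
  · simp only [Expr.Fits]; omega
  · exact hloop N 0 _ (by omega) h0 (by simp [Expr.eval]) (by simp [Ne.symm hxb, hb])
  · simp only [Expr.cost]; omega

/-! ### Memory layout -/

/-- The index of an entry of an `n × n` table, its row and column being in registers `a` and `b`. -/
def idx (a b : ℕ) : Expr := .bin .add (.bin .mul (.reg a) (.reg 0)) (.reg b)

/-- The registers `0`, `1`, `13` hold `n`, `n²`, `3n²`; the memory holds the tables `A`, `D`, `P`
at `0`, `n²`, `2n²`. -/
structure Tables (n : ℕ) (A D : Fin n → Fin n → ℕ) (P : Fin n → Fin n → Fin n) (s : State) :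
    Prop where
  reg0 : s.reg 0 = n
  reg1 : s.reg 1 = n * n
  reg13 : s.reg 13 = n * n + n * n + n * n
  memA : ∀ i j : Fin n, s.mem (i * n + j) = A i j
  memD : ∀ i j : Fin n, s.mem (n * n + (i * n + j)) = D i j
  memP : ∀ i j : Fin n, s.mem (n * n + n * n + (i * n + j)) = P i j

lemma index_lt {n : ℕ} (i j : Fin n) : i.val * n + j.val < n * n := by
  have : (i.val + 1) * n ≤ n * n := Nat.mul_le_mul_right n i.2
  have := j.2
  rw [Nat.succ_mul] at *
  omega

lemma index_inj {n : ℕ} {i j i' j' : Fin n} (h : i.val * n + j.val = i'.val * n + j'.val) :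
    i = i' ∧ j = j' := by
  have hn : 0 < n := i.pos
  have h1 : i.val = i'.val := by
    have := congrArg (· / n) h
    simpa [Nat.add_comm _ (_ : ℕ), Nat.add_mul_div_right, hn, Nat.div_eq_of_lt] using this
  refine ⟨Fin.ext h1, Fin.ext ?_⟩
  rw [h1] at h
  omega

namespace Tables

variable {n : ℕ} {A D : Fin n → Fin n → ℕ} {P : Fin n → Fin n → Fin n} {s : State}

lemma set (h : Tables n A D P s) {x : ℕ} (v : ℕ) (h0 : x ≠ 0) (h1 : x ≠ 1) (h13 : x ≠ 13) :
    Tables n A D P (s.set x v) where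
  reg0 := by simp [h0.symm, h.reg0]
  reg1 := by simp [h1.symm, h.reg1]
  reg13 := by simp [h13.symm, h.reg13]
  memA := h.memA
  memD := h.memD
  memP := h.memP

lemma put_buffer (h : Tables n A D P s) (k v : ℕ) :
    Tables n A D P (s.put (n * n + n * n + n * n + k) v) where
  reg0 := h.reg0
  reg1 := h.reg1
  reg13 := h.reg13
  memA i j := by
    have := index_lt i j
    rw [State.put_mem, if_neg (by omega), h.memA]
  memD i j := by
    have := index_lt i j
    rw [State.put_mem, if_neg (by omega), h.memD]
  memP i j := by
    have := index_lt i j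
    rw [State.put_mem, if_neg (by omega), h.memP]

lemma putD (h : Tables n A D P s) (u v : Fin n) (x : ℕ) :
    Tables n A (fun i j => if i = u ∧ j = v then x else D i j) P
      (s.put (n * n + (u * n + v)) x) where
  reg0 := h.reg0
  reg1 := h.reg1
  reg13 := h.reg13
  memA i j := by
    have := index_lt i j
    rw [State.put_mem, if_neg (by omega), h.memA]
  memD i j := by
    rw [State.put_mem, h.memD]
    refine if_congr ⟨fun hh => index_inj (by omega), ?_⟩ rfl rfl
    rintro ⟨rfl, rfl⟩
    rfl
  memP i j := by
    have := index_lt u v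
    rw [State.put_mem, if_neg (by omega), h.memP]

lemma putP (h : Tables n A D P s) (u v x : Fin n) :
    Tables n A D (fun i j => if i = u ∧ j = v then x else P i j)
      (s.put (n * n + n * n + (u * n + v)) x) where
  reg0 := h.reg0
  reg1 := h.reg1
  reg13 := h.reg13
  memA i j := by
    have := index_lt i j
    rw [State.put_mem, if_neg (by omega), h.memA]
  memD i j := by
    have := index_lt i j
    rw [State.put_mem, if_neg (by omega), h.memD]
  memP i j := by
    rw [State.put_mem, h.memP, apply_ite Fin.val]
    refine if_congr ⟨fun hh => index_inj (by omega), ?_⟩ rfl rfl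
    rintro ⟨rfl, rfl⟩
    rfl

variable {B a b : ℕ} {u v : Fin n}

lemma idx_eval (h : Tables n A D P s) (ha : s.reg a = u) (hb : s.reg b = v) :
    (idx a b).eval s = u * n + v := by
  simp only [idx, Expr.eval, Op.eval, ha, hb, h.reg0]

lemma idx_fits (h : Tables n A D P s) (ha : s.reg a = u) (hb : s.reg b = v) (hB : n * n < B) :
    (idx a b).Fits B s := by
  have h1 := index_lt u v
  have hu := u.2
  have hn : n ≤ n * n := Nat.le_mul_of_pos_left n (by omega)
  have hv := v.2
  simp only [idx, Expr.Fits, Expr.eval, Op.eval, ha, hb, h.reg0]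
  omega

end Tables

/-- An entry of the table at address `0`. -/
def cellA (a b : ℕ) : Expr := .load (idx a b)

/-- The address of an entry of the table at `n²`. -/
def addrD (a b : ℕ) : Expr := .bin .add (.reg 1) (idx a b)

/-- The address of an entry of the table at `2n²`. -/
def addrP (a b : ℕ) : Expr := .bin .add (.bin .add (.reg 1) (.reg 1)) (idx a b)

namespace Tables

variable {n : ℕ} {A D : Fin n → Fin n → ℕ} {P : Fin n → Fin n → Fin n} {s : State}
  {B a b : ℕ} {u v : Fin n}

lemma cellA_eval (h : Tables n A D P s) (ha : s.reg a = u) (hb : s.reg b = v) :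
    (cellA a b).eval s = A u v := by
  simp only [cellA, Expr.eval, h.idx_eval ha hb, h.memA]

lemma cellA_fits (h : Tables n A D P s) (ha : s.reg a = u) (hb : s.reg b = v) (hB : n * n < B)
    (hA : A u v < B) : (cellA a b).Fits B s := by
  refine ⟨h.idx_fits ha hb hB, ?_⟩
  rwa [h.idx_eval ha hb, h.memA]

lemma addrD_eval (h : Tables n A D P s) (ha : s.reg a = u) (hb : s.reg b = v) :
    (addrD a b).eval s = n * n + (u * n + v) := by
  simp only [addrD, Expr.eval, Op.eval, h.idx_eval ha hb, h.reg1]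

lemma addrD_fits (h : Tables n A D P s) (ha : s.reg a = u) (hb : s.reg b = v)
    (hB : n * n + n * n + n * n < B) : (addrD a b).Fits B s := by
  have := index_lt u v
  refine ⟨?_, h.idx_fits ha hb (by omega), ?_⟩
  · simp only [Expr.Fits, h.reg1]; omega
  · simp only [Expr.eval, Op.eval, h.idx_eval ha hb, h.reg1]; omega

lemma addrP_eval (h : Tables n A D P s) (ha : s.reg a = u) (hb : s.reg b = v) :
    (addrP a b).eval s = n * n + n * n + (u * n + v) := by
  simp only [addrP, Expr.eval, Op.eval, h.idx_eval ha hb, h.reg1]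

lemma addrP_fits (h : Tables n A D P s) (ha : s.reg a = u) (hb : s.reg b = v)
    (hB : n * n + n * n + n * n < B) : (addrP a b).Fits B s := by
  have := index_lt u v
  refine ⟨⟨?_, ?_, ?_⟩, h.idx_fits ha hb (by omega), ?_⟩
  · simp only [Expr.Fits, h.reg1]; omega
  · simp only [Expr.Fits, h.reg1]; omega
  · simp only [Expr.eval, Op.eval, h.reg1]; omega
  · simp only [Expr.eval, Op.eval, h.idx_eval ha hb, h.reg1]; omega

lemma cellD_eval (h : Tables n A D P s) (ha : s.reg a = u) (hb : s.reg b = v) :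
    (Expr.load (addrD a b)).eval s = D u v := by
  rw [Expr.eval, h.addrD_eval ha hb, h.memD]

lemma cellD_fits (h : Tables n A D P s) (ha : s.reg a = u) (hb : s.reg b = v)
    (hB : n * n + n * n + n * n < B) (hD : D u v < B) : (Expr.load (addrD a b)).Fits B s := by
  refine ⟨h.addrD_fits ha hb hB, ?_⟩
  rwa [h.addrD_eval ha hb, h.memD]

lemma cellP_eval (h : Tables n A D P s) (ha : s.reg a = u) (hb : s.reg b = v) :
    (Expr.load (addrP a b)).eval s = P u v := by
  rw [Expr.eval, h.addrP_eval ha hb, h.memP]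

lemma cellP_fits (h : Tables n A D P s) (ha : s.reg a = u) (hb : s.reg b = v)
    (hB : n * n + n * n + n * n < B) : (Expr.load (addrP a b)).Fits B s := by
  refine ⟨h.addrP_fits ha hb hB, ?_⟩
  rw [h.addrP_eval ha hb, h.memP]
  have h1 := (P u v).2
  have hn : n ≤ n * n := Nat.le_mul_of_pos_left n (by omega)
  omega

end Tables

end RAM

namespace RAM

/-! ## Distance tables -/

section Tables

variable {n : ℕ} {G : SimpleGraph (Fin n)}

/-- The contents of the tables after the vertices at distance at most `t` have been found: `D u v`
is `0` or the distance plus one, and `P u v` is the last vertex but one of a shortest path from `u`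
to `v`. -/
structure IsDistTable (G : SimpleGraph (Fin n)) (t : ℕ) (D : Fin n → Fin n → ℕ)
    (P : Fin n → Fin n → Fin n) : Prop where
  sound : ∀ u v, D u v ≠ 0 → D u v = 1 ∧ u = v ∨
    D u (P u v) ≠ 0 ∧ D u (P u v) + 1 = D u v ∧ G.Adj (P u v) v
  complete : ∀ p ≤ t, ∀ u v, Reach G p u v → D u v ≠ 0 ∧ D u v ≤ p + 1
  le : ∀ u v, D u v ≤ t + 2

lemma Reach.eq_of_zero {V : Type*} {H : SimpleGraph V} {x y : V} (h : Reach H 0 x y) : x = y := by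
  obtain ⟨w, hw⟩ := h
  exact SimpleGraph.Walk.eq_of_length_eq_zero (Nat.le_zero.1 hw)

lemma Reach.succ_cases {V : Type*} {H : SimpleGraph V} {t : ℕ} {x y : V}
    (h : Reach H (t + 1) x y) : Reach H t x y ∨ ∃ w, Reach H t x w ∧ H.Adj w y := by
  obtain ⟨p, hp, f, f0, f1, hf⟩ := h.exists_seq
  by_cases hpt : p ≤ t
  · left
    rw [← f0, ← f1]
    exact (Reach.of_seq hf (Nat.zero_le p) le_rfl).trans (Reach.refl _ 0) (by omega)
  · obtain rfl : p = t + 1 := by omega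
    refine Or.inr ⟨f t, ?_, f1 ▸ hf t (by omega)⟩
    rw [← f0]
    exact Reach.of_seq hf (Nat.zero_le t) (by omega)

namespace IsDistTable

variable {t : ℕ} {D : Fin n → Fin n → ℕ} {P : Fin n → Fin n → Fin n}

lemma initial (P : Fin n → Fin n → Fin n) :
    IsDistTable G 0 (fun u v => if u = v then 1 else 0) P where
  sound u v h := by
    left
    by_contra hcon
    by_cases huv : u = v <;> simp_all
  complete p hp u v h := by
    obtain rfl : p = 0 := by omega
    simp [Reach.eq_of_zero h]
  le u v := by
    split_ifs <;> omega

/-- Only a zero entry is overwritten, and chains of predecessors never meet one. The invariant for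
`t` thus survives in the middle of a round, which is why it allows entries `t + 2`. -/
lemma update (h : IsDistTable G t D P) {u v w : Fin n} (hv : D u v = 0) (hw : D u w = t + 1)
    (hwv : G.Adj w v) :
    IsDistTable G t (fun i j => if i = u ∧ j = v then t + 2 else D i j)
      (fun i j => if i = u ∧ j = v then w else P i j) where
  sound i j hij := by
    by_cases hc : i = u ∧ j = v
    · obtain ⟨rfl, rfl⟩ := hc
      simp [hwv.ne, hw, hwv]
    · simp only [if_neg hc] at hij ⊢
      rcases h.sound i j hij with h' | ⟨h1, h2, h3⟩
      · exact Or.inl h'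
      · rw [if_neg]
        · exact Or.inr ⟨h1, h2, h3⟩
        · rintro ⟨rfl, h4⟩
          rw [h4] at h1
          exact h1 hv
  complete p hp i j hr := by
    have := h.complete p hp i j hr
    rw [if_neg]
    · exact this
    · rintro ⟨rfl, rfl⟩
      exact this.1 hv
  le i j := by
    split_ifs
    · exact le_rfl
    · exact h.le i j

lemma reach (h : IsDistTable G t D P) {d : ℕ} {u v : Fin n} (hd : D u v = d + 1) :
    Reach G d u v := by
  induction d generalizing v with
  | zero =>
    rcases h.sound u v (by omega) with h' | h'
    · rw [h'.2]
      exact Reach.refl _ _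
    · omega
  | succ d ih =>
    rcases h.sound u v (by omega) with h' | h'
    · omega
    · exact (ih (v := P u v) (by omega)).trans (Reach.of_adj h'.2.2) le_rfl

/-- A vertex at distance `t + 1` has a neighbour at distance `t`, whose entry is `t + 1`; the
hypothesis says that all such neighbours have been used. -/
lemma succ (h : IsDistTable G t D P)
    (hdone : ∀ u v w, D u w = t + 1 → G.Adj w v → D u v ≠ 0) : IsDistTable G (t + 1) D P where
  sound := h.sound
  complete p hp u v hr := by
    by_cases hpt : p ≤ t
    · exact h.complete p hpt u v hr
    obtain rfl : p = t + 1 := by omega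
    rcases Reach.succ_cases hr with hr' | ⟨w, hr', hw⟩
    · have := h.complete t le_rfl u v hr'
      omega
    · obtain ⟨h1, h2⟩ := h.complete t le_rfl u w hr'
      refine ⟨?_, h.le u v⟩
      by_cases h3 : D u w = t + 1
      · exact hdone u v w h3 hw
      · have h4 := (h.reach (d := D u w - 1) (u := u) (v := w) (by omega)).trans
          (Reach.of_adj hw) (k := t) (by omega)
        exact (h.complete t le_rfl u v h4).1
  le u v := (h.le u v).trans (by omega)

/-- Following the table from `x` gives a shortest path from `x` to `a`. -/
lemma walk (h : IsDistTable G t D P) {a x : Fin n} {d : ℕ} (hd : D a x = d + 1) :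
    (∀ i < d, G.Adj ((P a)^[i] x) ((P a)^[i + 1] x)) ∧ (P a)^[d] x = a := by
  have key : ∀ i ≤ d, D a ((P a)^[i] x) = d - i + 1 := by
    intro i
    induction i with
    | zero => intro _; simpa using hd
    | succ i ih =>
      intro hi
      have hi' := ih (by omega)
      rw [Function.iterate_succ_apply']
      rcases h.sound a ((P a)^[i] x) (by omega) with h' | h' <;> omega
  constructor
  · intro i hi
    have := key i hi.le
    rw [Function.iterate_succ_apply']
    rcases h.sound a ((P a)^[i] x) (by omega) with h' | h'
    · omega
    · exact h'.2.2.symm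
  · have := key d le_rfl
    rcases h.sound a ((P a)^[d] x) (by omega) with h' | h'
    · exact h'.2.symm
    · omega

lemma eq_of_isDist (h : IsDistTable G t D P) {m : ℕ} {x a : Fin n} (hm : m ≤ t)
    (hx : IsDist G m x a) : D a x = m + 1 := by
  obtain ⟨h1, h2⟩ := h.complete m hm a x hx.1.symm
  by_contra hcon
  exact hx.2 (D a x - 1) (by omega) (h.reach (by omega)).symm

end IsDistTable

end Tables

/-! ## Computing the distance tables -/

open Classical in
/-- The adjacency matrix. -/
noncomputable def adjTable {n : ℕ} (G : SimpleGraph (Fin n)) (i j : Fin n) : ℕ :=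
  if G.Adj i j then 1 else 0

lemma adjTable_le {n : ℕ} (G : SimpleGraph (Fin n)) (i j : Fin n) : adjTable G i j ≤ 1 := by
  rw [adjTable]
  split_ifs <;> omega

lemma adjTable_ne_zero {n : ℕ} (G : SimpleGraph (Fin n)) (i j : Fin n) :
    adjTable G i j ≠ 0 ↔ G.Adj i j := by
  rw [adjTable]
  split_ifs with h <;> simp [h]

/-- Extend shortest paths of length `t` from `u` to `w` by `v`, for `t, u, v, w` in the registers
`2, 3, 4, 5`. -/
def extendStep : Program :=
  .ite (.load (addrD 3 4)) .skip
    (.ite (.bin .eq (.load (addrD 3 5)) (.bin .add (.reg 2) (.const 1)))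
      (.ite (cellA 5 4)
        (.seq (.store (addrD 3 4) (.bin .add (.reg 2) (.const 2))) (.store (addrP 3 4) (.reg 5)))
        .skip)
      .skip)

/-- Breadth first search from all vertices at once. -/
def distances : Program :=
  forLoop 2 0 (forLoop 3 0 (forLoop 4 0 (forLoop 5 0 extendStep)))

/-- `(a, b, c)` precedes `(u, v, w)` in the lexicographic order. -/
def Before {n : ℕ} (a b c : Fin n) (u v w : ℕ) : Prop :=
  a.val < u ∨ a.val = u ∧ (b.val < v ∨ b.val = v ∧ c.val < w)

/-- The state in round `t` of the search after all triples before `(u, v, w)`. -/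
def SearchState {n : ℕ} (G : SimpleGraph (Fin n)) (t u v w : ℕ) (s : State) : Prop :=
  s.reg 2 = t ∧ ∃ D P, Tables n (adjTable G) D P s ∧ IsDistTable G t D P ∧
    ∀ a b c, Before a b c u v w → D a c = t + 1 → G.Adj c b → D a b ≠ 0

variable {n B : ℕ} {G : SimpleGraph (Fin n)}

lemma SearchState.set {t u v w : ℕ} {s : State} (h : SearchState G t u v w s) {x y : ℕ}
    (h0 : x ≠ 0) (h1 : x ≠ 1) (h2 : x ≠ 2) (h13 : x ≠ 13) : SearchState G t u v w (s.set x y) := by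
  obtain ⟨h1', D, P, hT, hD, hd⟩ := h
  exact ⟨by simp [h2.symm, h1'], D, P, hT.set y h0 h1 h13, hD, hd⟩

lemma SearchState.congr {t u v w u' v' w' : ℕ} {s : State} (h : SearchState G t u v w s)
    (hb : ∀ a b c : Fin n, Before a b c u' v' w' → Before a b c u v w) :
    SearchState G t u' v' w' s := by
  obtain ⟨h1', D, P, hT, hD, hd⟩ := h
  exact ⟨h1', D, P, hT, hD, fun a b c h => hd a b c (hb a b c h)⟩

lemma SearchState.reg0 {t u v w : ℕ} {s : State} (h : SearchState G t u v w s) : s.reg 0 = n := by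
  obtain ⟨_, D, P, hT, _⟩ := h
  exact hT.reg0

lemma extendStep_ends (hB : 10 * (n * n) + 10 * n + 10 < B) {t : ℕ} (ht : t < n) {u v w : Fin n}
    {s : State} (h : SearchState G t u v w s) (h3 : s.reg 3 = u) (h4 : s.reg 4 = v)
    (h5 : s.reg 5 = w) :
    Ends B extendStep s 100 (fun s' => SearchState G t u v (w + 1) s' ∧
      ∀ x, s'.reg x = s.reg x) := by
  obtain ⟨h2, D, P, hT, hD, hd⟩ := h
  have hskip : (D u w = t + 1 → G.Adj w v → D u v ≠ 0) → SearchState G t u v (w + 1) s := by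
    intro hh
    refine ⟨h2, D, P, hT, hD, fun a b c habc => ?_⟩
    by_cases hb : Before a b c u v w
    · exact hd a b c hb
    · have : a = u ∧ b = v ∧ c = w := by
        simp only [Before, Fin.ext_iff] at *
        omega
      obtain ⟨rfl, rfl, rfl⟩ := this
      exact hh
  have hDB : ∀ i j, D i j < B := fun i j => by have := hD.le i j; omega
  have hn3 : n * n + n * n + n * n < B := by omega
  refine Ends.mono (Ends.ite (T := 80) (hT.cellD_fits h3 h4 hn3 (hDB _ _)) ?_ ?_)
    (by simp [Expr.cost, addrD, idx]) (fun _ h => h)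
  · intro hne
    rw [hT.cellD_eval h3 h4] at hne
    exact (Ends.skip ⟨hskip fun _ _ => hne, fun _ => rfl⟩).mono (by omega) (fun _ h => h)
  intro hz
  rw [hT.cellD_eval h3 h4] at hz
  have heq : (Expr.bin .eq (.load (addrD 3 5)) (.bin .add (.reg 2) (.const 1))).eval s =
      if D u w = t + 1 then 1 else 0 := by
    simp only [Expr.eval, Op.eval, h2, hT.addrD_eval h3 h5, hT.memD]
  refine Ends.mono (Ends.ite (T := 50) ⟨hT.cellD_fits h3 h5 hn3 (hDB _ _), ⟨?_, ?_, ?_⟩,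
    (Op.eval_eq_le _ _).trans_lt (by omega)⟩ ?_ ?_)
    (by simp [Expr.cost, addrD, idx]) (fun _ h => h)
  · simp only [Expr.Fits]; omega
  · simp only [Expr.Fits]; omega
  · simp only [Expr.eval, Op.eval]; omega
  swap
  · intro hne
    rw [heq] at hne
    refine (Ends.skip ⟨hskip fun h => ?_, fun _ => rfl⟩).mono (by omega) (fun _ h => h)
    simp [h] at hne
  intro hone
  rw [heq] at hone
  have hw : D u w = t + 1 := by
    by_contra hcon
    simp [hcon] at hone
  refine Ends.mono (Ends.ite (T := 30) (hT.cellA_fits h5 h4 (by omega)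
    ((adjTable_le G _ _).trans_lt (by omega))) ?_ ?_)
    (by simp [Expr.cost, cellA, idx]) (fun _ h => h)
  swap
  · intro hne
    rw [hT.cellA_eval h5 h4] at hne
    exact (Ends.skip ⟨hskip fun _ h => absurd hne ((adjTable_ne_zero _ _ _).2 h),
      fun _ => rfl⟩).mono (by omega) (fun _ h => h)
  intro hadj
  rw [hT.cellA_eval h5 h4, adjTable_ne_zero] at hadj
  refine Ends.mono (Ends.seq (Ends.store (hT.addrD_fits h3 h4 hn3) ⟨?_, ?_, ?_⟩
    (Ends.store ?_ ?_ ⟨?_, fun _ => rfl⟩))) (by simp [Expr.cost, addrD, addrP, idx])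
    (fun _ h => h)
  · simp only [Expr.Fits]; omega
  · simp only [Expr.Fits]; omega
  · simp only [Expr.eval, Op.eval]; omega
  · rw [hT.addrD_eval h3 h4]
    exact (hT.putD u v _).addrP_fits h3 h4 hn3
  · simp only [Expr.Fits, State.put_reg]; omega
  have hT' := hT.putD u v (t + 2)
  have hev : (Expr.bin .add (.reg 2) (.const 2)).eval s = t + 2 := by
    simp only [Expr.eval, Op.eval, h2]
  rw [hT.addrD_eval h3 h4, hev, hT'.addrP_eval (by simpa using h3) (by simpa using h4)]
  simp only [Expr.eval, State.put_reg, h5]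
  refine ⟨h2, _, _, hT'.putP u v w, hD.update hz hw hadj, ?_⟩
  intro a b c habc
  by_cases hab : a = u ∧ b = v
  · simp [hab]
  · rw [if_neg hab]
    intro hac hcb
    -- The new entry is `t + 2`, so it creates no further obligations in this round.
    have hac' : D a c = t + 1 := by
      split_ifs at hac
      · omega
      · exact hac
    refine hd a b c ?_ hac' hcb
    simp only [Before, Fin.ext_iff] at *
    omega

/-- An inner loop ends with its index equal to `n`, which in the lexicographic order amounts to
raising the next outer index and restarting at `0`. -/
lemma searchRound_ends (hB : 10 * (n * n) + 10 * n + 10 < B) {t : ℕ} (ht : t < n) {s : State}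
    (h : SearchState G t 0 0 0 s) :
    Ends B (forLoop 3 0 (forLoop 4 0 (forLoop 5 0 extendStep))) s
      (n * (n * (n * (100 + 8) + 6 + 8) + 6 + 8) + 6) (SearchState G t n 0 0) := by
  refine Ends.forLoop (I := fun u s => SearchState G t u 0 0 s) (by decide) (by omega) (by omega)
    h.reg0 (h.set (by decide) (by decide) (by decide) (by decide)) ?_
  intro u hu s hs h3 _
  refine (Ends.forLoop (N := n) (I := fun v s => SearchState G t u v 0 s ∧ s.reg 3 = u)
    (by decide) (by omega) (by omega) hs.reg0
    ⟨hs.set (by decide) (by decide) (by decide) (by decide), by simpa using h3⟩ ?_).mono le_rfl ?_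
  swap
  · intro s' hs'
    refine ⟨hs'.2, hs'.1.reg0, (hs'.1.congr ?_).set (by decide) (by decide) (by decide)
      (by decide)⟩
    intro a b c
    have := b.2
    simp only [Before]
    omega
  intro v hv s hs h4 _
  refine (Ends.forLoop (N := n) (I := fun w s => SearchState G t u v w s ∧ s.reg 3 = u ∧
    s.reg 4 = v) (by decide) (by omega) (by omega) hs.1.reg0
    ⟨hs.1.set (by decide) (by decide) (by decide) (by decide), by simpa using hs.2,
      by simpa using h4⟩ ?_).mono le_rfl ?_
  swap
  · intro s' hs'
    refine ⟨hs'.2.2, hs'.1.reg0, (hs'.1.congr ?_).set (by decide) (by decide) (by decide)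
      (by decide), by simpa using hs'.2.1⟩
    intro a b c
    have := c.2
    simp only [Before]
    omega
  intro w hw s hs h5 _
  refine (extendStep_ends hB ht (u := ⟨u, hu⟩) (v := ⟨v, hv⟩) (w := ⟨w, hw⟩) hs.1 hs.2.1 hs.2.2
    h5).mono le_rfl ?_
  intro s' hs'
  refine ⟨by rw [hs'.2, h5], hs'.1.reg0, hs'.1.set (by decide) (by decide) (by decide) (by decide),
    ?_, ?_⟩
  · simpa [hs'.2] using hs.2.1
  · simpa [hs'.2] using hs.2.2

lemma distances_ends (hB : 10 * (n * n) + 10 * n + 10 < B) {s : State} {D P}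
    (hT : Tables n (adjTable G) D P s) (hD : IsDistTable G 0 D P) :
    Ends B distances s (n * (n * (n * (n * (100 + 8) + 6 + 8) + 6 + 8) + 6 + 8) + 6)
      (fun s' => ∃ D P, Tables n (adjTable G) D P s' ∧ IsDistTable G n D P) := by
  refine Ends.forLoop (I := fun t s => ∃ D P, Tables n (adjTable G) D P s ∧ IsDistTable G t D P)
    (by decide) (by omega) (by omega) hT.reg0
    ⟨D, P, hT.set _ (by decide) (by decide) (by decide), hD⟩ ?_
  rintro t ht s ⟨D, P, hT, hD⟩ h2 _
  refine (searchRound_ends hB ht ⟨h2, D, P, hT, hD, ?_⟩).mono le_rfl ?_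
  · intro a b c h
    simp only [Before] at h
    omega
  · rintro s' ⟨h2', D, P, hT', hD', hd⟩
    exact ⟨h2', hT'.reg0, D, P, hT'.set _ (by decide) (by decide) (by decide),
      hD'.succ fun u v w => hd u v w (Or.inl u.2)⟩

end RAM

namespace RAM

/-! ## Testing one triple of vertices -/

/-- `1` if `i` and `j` are neighbours in the cycle `0, 1, …, k - 1`, for `k ≥ 3`. -/
def cyc (k i j : ℕ) : ℕ :=
  (if i + 1 = j then 1 else 0) + (if j + 1 = i then 1 else 0) +
    ((if i = 0 then 1 else 0) * (if j + 1 = k then 1 else 0) +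
      (if j = 0 then 1 else 0) * (if i + 1 = k then 1 else 0))

/-- The adjacency matrix of `b 0, …, b (k - 1)` is that of a cycle. -/
def IsCyc {n : ℕ} (G : SimpleGraph (Fin n)) (k : ℕ) (b : ℕ → Fin n) : Prop :=
  ∀ i < k, ∀ j < k, adjTable G (b i) (b j) = cyc k i j

variable {n B : ℕ} {G : SimpleGraph (Fin n)}

lemma IsCyc.congr {k : ℕ} {b b' : ℕ → Fin n} (h : IsCyc G k b) (hb : ∀ i < k, b' i = b i) :
    IsCyc G k b' := by
  intro i hi j hj
  rw [hb i hi, hb j hj]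
  exact h i hi j hj

lemma cyc_ne_zero_iff {k i j : ℕ} : cyc k i j ≠ 0 ↔
    i + 1 = j ∨ j + 1 = i ∨ (i = 0 ∧ j + 1 = k) ∨ (j = 0 ∧ i + 1 = k) := by
  rw [cyc]
  split_ifs <;> omega

/-- For `k ≥ 3` the four cases exclude each other; for `k = 2` they overlap. -/
lemma cyc_le {k i j : ℕ} (hk : 3 ≤ k) : cyc k i j ≤ 1 := by
  rw [cyc]
  split_ifs <;> omega

/-- The matrix alone forces the vertices to be distinct: equal vertices have equal rows, but a cycle
of length at least five has no two positions with the same neighbours. In a cycle of length four,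
opposite positions do. -/
lemma IsCyc.isHoleSeq {k : ℕ} {b : ℕ → Fin n} (hk : 5 ≤ k) (h : IsCyc G k b) :
    IsHoleSeq G k (fun i => b (i % k)) := by
  have hadj : ∀ i j, i < k → j < k → (G.Adj (b i) (b j) ↔
      i + 1 = j ∨ j + 1 = i ∨ (i = 0 ∧ j + 1 = k) ∨ (j = 0 ∧ i + 1 = k)) := by
    intro i j hi hj
    rw [← adjTable_ne_zero, h i hi j hj, cyc_ne_zero_iff]
  refine ⟨by omega, fun i => by simp, ?_, ?_⟩
  · intro i j hi hj hij
    simp only [Nat.mod_eq_of_lt hi, Nat.mod_eq_of_lt hj] at hij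
    have key : ∀ x < k, G.Adj (b i) (b x) ↔ G.Adj (b j) (b x) := fun x _ => by rw [hij]
    obtain ⟨x, hx, hxi⟩ : ∃ x, x < k ∧ (i + 1 = x ∨ x = 0 ∧ i + 1 = k) := by
      by_cases hik : i + 1 = k
      · exact ⟨0, by omega, by omega⟩
      · exact ⟨i + 1, by omega, by omega⟩
    obtain ⟨y, hy, hyi⟩ : ∃ y, y < k ∧ (y + 1 = i ∨ i = 0 ∧ y + 1 = k) := by
      by_cases hi0 : i = 0
      · exact ⟨k - 1, by omega, by omega⟩
      · exact ⟨i - 1, by omega, by omega⟩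
    have h1 := (hadj _ _ hj hx).1 ((key x hx).1 ((hadj _ _ hi hx).2 (by clear key hadj; omega)))
    have h2 := (hadj _ _ hj hy).1 ((key y hy).1 ((hadj _ _ hi hy).2
      (by clear key hadj h1; omega)))
    clear key hadj
    rcases hxi with hxi | hxi <;> rcases hyi with hyi | hyi <;>
      rcases h1 with h1 | h1 | h1 | h1 <;> rcases h2 with h2 | h2 | h2 | h2 <;> omega
  · intro i j hi hj
    simp only [Nat.mod_eq_of_lt hi, Nat.mod_eq_of_lt hj]
    exact hadj i j hi hj

lemma isCyc_of_isHoleSeq {k : ℕ} {b : ℕ → Fin n} (h : IsHoleSeq G k (fun i => b (i % k))) :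
    IsCyc G k b := by
  intro i hi j hj
  have hadj := h.adj i j hi hj
  simp only [Nat.mod_eq_of_lt hi, Nat.mod_eq_of_lt hj] at hadj
  rw [← adjTable_ne_zero, ← cyc_ne_zero_iff] at hadj
  have h1 := adjTable_le G (b i) (b j)
  have h2 := cyc_le (i := i) (j := j) h.three_le
  omega

/-- The cells from `3n²` on hold `b 0, …, b (k - 1)`. -/
def Buffer (k : ℕ) (b : ℕ → Fin n) (s : State) : Prop :=
  ∀ i < k, s.mem (n * n + n * n + n * n + i) = b i

/-- Append to the buffer the vertices of the path from the vertex in register `x` to the vertex in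
register `a`, the last one excepted. Register `7` holds the length of the buffer. -/
def follow (a x : ℕ) : Program :=
  .seq (.assign 8 (.reg x)) (.seq (.assign 12 (.bin .sub (.load (addrD a x)) (.const 1)))
    (forLoop 9 12 (.seq (.store (.bin .add (.reg 13) (.reg 7)) (.reg 8))
      (.seq (.assign 7 (.bin .add (.reg 7) (.const 1))) (.assign 8 (.load (addrP a 8)))))))

/-- The sequence `b 0, …, b (k - 1)` followed by `f 0, f 1, …`. -/
def append (k : ℕ) (b f : ℕ → Fin n) (i : ℕ) : Fin n := if i < k then b i else f (i - k)

variable {D : Fin n → Fin n → ℕ} {P : Fin n → Fin n → Fin n}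

/-- For an unreachable pair `D va vx = 0`, and truncated subtraction makes the path empty. This is
harmless, as the buffer is checked afterwards. -/
lemma follow_ends (hB : 10 * (n * n) + 10 * n + 10 < B) (hD : ∀ i j, D i j ≤ n + 2) {s : State}
    (hT : Tables n (adjTable G) D P s) {a x : ℕ} {va vx : Fin n} (ha2 : a ≤ 5)
    (hx2 : x ≤ 5) (ha : s.reg a = va) (hx : s.reg x = vx) {k : ℕ} {b : ℕ → Fin n}
    (hk : s.reg 7 = k) (hkn : k ≤ 2 * n + 2) (hb : Buffer k b s) :
    Ends B (follow a x) s (50 * (n + 1)) (fun s' => Tables n (adjTable G) D P s' ∧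
      (∀ r ≤ 6, s'.reg r = s.reg r) ∧ s'.reg 7 = k + (D va vx - 1) ∧
      Buffer (k + (D va vx - 1)) (append k b (fun i => (P va)^[i] vx)) s') := by
  have hD' := hD va vx
  have hn3 : n * n + n * n + n * n < B := by omega
  have hvx := vx.2
  have hT8 : Tables n (adjTable G) D P (s.set 8 vx) :=
    hT.set _ (by decide) (by decide) (by decide)
  have ha8 : (s.set 8 vx).reg a = va := by rw [State.set_reg, if_neg (by omega), ha]
  have hx8 : (s.set 8 vx).reg x = vx := by rw [State.set_reg, if_neg (by omega), hx]
  refine Ends.mono (Ends.seq (Ends.assign ?_ (Ends.seq (Ends.assign ?_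
    (Ends.forLoop (N := D va vx - 1) (T := 20)
      (I := fun i s' => Tables n (adjTable G) D P s' ∧ (∀ r ≤ 6, s'.reg r = s.reg r) ∧
        s'.reg 7 = k + i ∧ s'.reg 8 = ((P va)^[i] vx).val ∧
        Buffer (k + i) (append k b (fun i => (P va)^[i] vx)) s')
      (by decide) (by omega) (by omega) ?_ ?_ ?_))))) ?_ ?_
  · simp only [Expr.Fits]; omega
  · simp only [Expr.eval, hx]
    refine ⟨hT8.cellD_fits ha8 hx8 hn3 (by omega), ?_, ?_⟩
    · simp only [Expr.Fits]; omega
    · rw [hT8.cellD_eval ha8 hx8]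
      simp only [Expr.eval, Op.eval]; omega
  · simp only [Expr.eval, hx]
    simp only [State.set_reg, if_true]
    have := hT8.cellD_eval ha8 hx8
    simp only [Expr.eval] at this
    rw [this]
    rfl
  · simp only [Expr.eval, hx]
    refine ⟨((hT8.set _ (by decide) (by decide) (by decide)).set _ (by decide) (by decide)
      (by decide)), ?_, by simp [hk], by simp, ?_⟩
    · intro r hr
      simp only [State.set_reg]
      rw [if_neg (by omega), if_neg (by omega), if_neg (by omega)]
    · intro i hi
      have hik : i < k := by omega
      simp only [State.set_mem, append, if_pos hik]
      exact hb i hik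
  · rintro i hi s' ⟨hT', hr', h7, h8, hbuf⟩ h9 h12
    have hlast := ((P va)^[i] vx).2
    refine Ends.mono (Ends.seq (Ends.store ⟨?_, ?_, ?_⟩ ?_ (Ends.seq (Ends.assign ⟨?_, ?_, ?_⟩
      (Ends.assign ?_ ?_)))))
      (by simp [Expr.cost, addrP, idx]) (fun _ h => h)
    · simp only [Expr.Fits, hT'.reg13]; omega
    · simp only [Expr.Fits]; omega
    · simp only [Expr.eval, Op.eval, hT'.reg13]; omega
    · simp only [Expr.Fits]; omega
    · simp only [Expr.Fits, State.put_reg]; omega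
    · simp only [Expr.Fits]; omega
    · simp only [Expr.eval, Op.eval, State.put_reg]; omega
    all_goals
      have hput := hT'.put_buffer (k + i) ((P va)^[i] vx)
      have hset := hput.set (x := 7) (k + i + 1) (by decide) (by decide) (by decide)
      have hsa : ((s'.put (n * n + n * n + n * n + (k + i)) ((P va)^[i] vx)).set 7
          (k + i + 1)).reg a = va := by
        rw [State.set_reg, if_neg (by omega), State.put_reg, hr' a (by omega), ha]
      have hs8 : ((s'.put (n * n + n * n + n * n + (k + i)) ((P va)^[i] vx)).set 7
          (k + i + 1)).reg 8 = ((P va)^[i] vx).val := by simpa using h8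
      have e1 : (Expr.bin .add (.reg 13) (.reg 7)).eval s' = n * n + n * n + n * n + (k + i) := by
        simp only [Expr.eval, Op.eval, hT'.reg13, h7]
      have e2 : (Expr.reg 8).eval s' = ((P va)^[i] vx).val := h8
      rw [e1, e2]
      have e3 : (Expr.bin .add (.reg 7) (.const 1)).eval
          (s'.put (n * n + n * n + n * n + (k + i)) ((P va)^[i] vx)) = k + i + 1 := by
        simp only [Expr.eval, Op.eval, State.put_reg, h7]
      rw [e3]
    · exact hset.cellP_fits hsa hs8 hn3
    · rw [hset.cellP_eval hsa hs8]
      refine ⟨by simpa using h9, by simpa using h12, ?_, ?_, ?_, ?_, ?_⟩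
      · exact (hset.set _ (by decide) (by decide) (by decide)).set _ (by decide) (by decide)
          (by decide)
      · intro r hr
        simp only [State.set_reg, State.put_reg]
        rw [if_neg (by omega), if_neg (by omega), if_neg (by omega), hr' r hr]
      · simp [Nat.add_assoc]
      · simp [Function.iterate_succ_apply']
      · intro j hj
        simp only [State.set_mem, State.put_mem]
        by_cases hjk : j = k + i
        · rw [if_pos (by omega), hjk, append, if_neg (by omega), Nat.add_sub_cancel_left]
        · rw [if_neg (by omega)]
          exact hbuf j (by omega)
  · simp only [Expr.cost, addrD, idx]
    have : (D va vx - 1) * (20 + 8) ≤ (n + 1) * 28 := Nat.mul_le_mul (by omega) le_rfl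
    omega
  · rintro s' ⟨h1, h2, h3, _, h4⟩
    exact ⟨h1, h2, h3, h4⟩

/-- The adjacency of the vertices in the buffer with positions in registers `9` and `10`. -/
def bufferAdj : Expr :=
  .load (.bin .add (.bin .mul (.load (.bin .add (.reg 13) (.reg 9))) (.reg 0))
    (.load (.bin .add (.reg 13) (.reg 10))))

/-- The value `cyc k i j` for `i, j, k` in registers `9, 10, 7`. -/
def cycExpr : Expr :=
  .bin .add
    (.bin .add (.bin .eq (.bin .add (.reg 9) (.const 1)) (.reg 10))
      (.bin .eq (.bin .add (.reg 10) (.const 1)) (.reg 9)))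
    (.bin .add
      (.bin .mul (.bin .eq (.reg 9) (.const 0))
        (.bin .eq (.bin .add (.reg 10) (.const 1)) (.reg 7)))
      (.bin .mul (.bin .eq (.reg 10) (.const 0))
        (.bin .eq (.bin .add (.reg 9) (.const 1)) (.reg 7))))

/-- Set register `11` to `0` if the buffer holds a cycle, and register `14` to the parity of its
length. -/
def checkCycle : Program :=
  .seq (.assign 11 (.const 0)) (.seq (.assign 14 (.const 0))
    (forLoop 9 7 (.seq (.assign 14 (.bin .sub (.const 1) (.reg 14)))
      (forLoop 10 7 (.ite (.bin .eq bufferAdj cycExpr) .skip (.assign 11 (.const 1)))))))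

/-- The states differ at most in the registers `9`, `10`, `11`, `14`. -/
def SameButCheck (s s' : State) : Prop :=
  s'.mem = s.mem ∧ ∀ r, r ≠ 9 → r ≠ 10 → r ≠ 11 → r ≠ 14 → s'.reg r = s.reg r

lemma SameButCheck.set {s s' : State} (h : SameButCheck s s') {x : ℕ} (v : ℕ)
    (hx : x = 9 ∨ x = 10 ∨ x = 11 ∨ x = 14) : SameButCheck s (s'.set x v) := by
  refine ⟨h.1, fun r h1 h2 h3 h4 => ?_⟩
  rw [State.set_reg, if_neg (by omega), h.2 r h1 h2 h3 h4]

lemma SameButCheck.tables {s s' : State} (h : SameButCheck s s')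
    (hT : Tables n (adjTable G) D P s) : Tables n (adjTable G) D P s' where
  reg0 := by rw [h.2 0 (by decide) (by decide) (by decide) (by decide), hT.reg0]
  reg1 := by rw [h.2 1 (by decide) (by decide) (by decide) (by decide), hT.reg1]
  reg13 := by rw [h.2 13 (by decide) (by decide) (by decide) (by decide), hT.reg13]
  memA := by rw [h.1]; exact hT.memA
  memD := by rw [h.1]; exact hT.memD
  memP := by rw [h.1]; exact hT.memP

lemma checkStep_ends (hB : 10 * (n * n) + 10 * n + 10 < B) {s : State}
    (hT : Tables n (adjTable G) D P s) {k i j : ℕ} {b : ℕ → Fin n} (hk : s.reg 7 = k)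
    (hkn : k ≤ 3 * n + 3) (hb : Buffer k b s) (hi : i < k) (hj : j < k) (h9 : s.reg 9 = i)
    (h10 : s.reg 10 = j) {Q : State → Prop} (h1 : adjTable G (b i) (b j) = cyc k i j → Q s)
    (h2 : adjTable G (b i) (b j) ≠ cyc k i j → Q (s.set 11 1)) :
    Ends B (.ite (.bin .eq bufferAdj cycExpr) .skip (.assign 11 (.const 1))) s 60 Q := by
  have hi' := (b i).2
  have hij := index_lt (b i) (b j)
  have hbi := hb i hi
  have hbj := hb j hj
  have hr13 := hT.reg13
  have e1 : bufferAdj.eval s = adjTable G (b i) (b j) := by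
    simp only [bufferAdj, Expr.eval, Op.eval, hr13, h9, h10, hbi, hbj, hT.reg0, hT.memA]
  have e2 : cycExpr.eval s = cyc k i j := by
    simp only [cycExpr, Expr.eval, Op.eval, h9, h10, hk, cyc]
  have e3 : (Expr.bin .eq bufferAdj cycExpr).eval s =
      if adjTable G (b i) (b j) = cyc k i j then 1 else 0 := by
    rw [Expr.eval, e1, e2]
    rfl
  have hle := adjTable_le G (b i) (b j)
  have f1 : bufferAdj.Fits B s := by
    simp only [bufferAdj, Expr.Fits, Expr.eval, Op.eval, hr13, h9, h10, hbi, hbj, hT.reg0, hT.memA]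
    omega
  have f2 : cycExpr.Fits B s := by
    simp only [cycExpr, Expr.Fits, Expr.eval, Op.eval, h9, h10, hk]
    split_ifs <;> omega
  refine Ends.mono (Ends.ite (T := 3) ⟨f1, f2, (Op.eval_eq_le _ _).trans_lt (by omega)⟩ ?_ ?_)
    (by simp [Expr.cost, bufferAdj, cycExpr]) (fun _ h => h)
  · intro h
    rw [e3] at h
    exact (Ends.skip (h1 (by by_contra hcon; simp [hcon] at h))).mono (by omega) (fun _ h => h)
  · intro h
    rw [e3] at h
    refine (Ends.assign ?_ (h2 fun hcon => by simp [hcon] at h)).mono (by simp [Expr.cost])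
      (fun _ h => h)
    simp only [Expr.Fits]; omega

/-- All `k ^ 2` entries are compared with those of a cycle. Register `14` is flipped once per row
and so ends as the parity of `k`, without any division. -/
lemma checkCycle_ends (hB : 10 * (n * n) + 10 * n + 10 < B) {s : State}
    (hT : Tables n (adjTable G) D P s) {k : ℕ} {b : ℕ → Fin n} (hk : s.reg 7 = k)
    (hkn : k ≤ 3 * n + 3) (hb : Buffer k b s) :
    Ends B checkCycle s (700 * (n + 1) ^ 2) (fun s' => SameButCheck s s' ∧ s'.reg 14 = k % 2 ∧
      s'.reg 11 ≤ 1 ∧ (s'.reg 11 = 0 ↔ IsCyc G k b)) := by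
  refine Ends.mono (Ends.seq (Ends.assign ?_ (Ends.seq (Ends.assign ?_
    (Ends.forLoop (N := k) (T := k * (60 + 8) + 11)
      (I := fun i s' => SameButCheck s s' ∧ s'.reg 14 = i % 2 ∧ s'.reg 11 ≤ 1 ∧
        (s'.reg 11 = 0 ↔ ∀ i' < i, ∀ j' < k, adjTable G (b i') (b j') = cyc k i' j'))
      (by decide) (by omega) (by omega) ?_ ?_ ?_))))) ?_ (fun _ h => h)
  · simp only [Expr.Fits]; omega
  · simp only [Expr.Fits]; omega
  · simp [hk]
  · refine ⟨⟨rfl, fun r h1 h2 h3 h4 => ?_⟩, by simp [Expr.eval],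
      by simp [Expr.eval], by simp [Expr.eval]⟩
    simp [h1, h3, h4]
  · rintro i hi s' ⟨hs, h14, h11le, h11⟩ h9 h7
    refine Ends.mono (Ends.seq (Ends.assign ⟨?_, ?_, ?_⟩ (Ends.forLoop (N := k) (T := 60)
      (I := fun j s' => SameButCheck s s' ∧ s'.reg 14 = (i + 1) % 2 ∧ s'.reg 9 = i ∧
        s'.reg 11 ≤ 1 ∧ (s'.reg 11 = 0 ↔ ∀ i' j', j' < k → (i' < i ∨ i' = i ∧ j' < j) →
          adjTable G (b i') (b j') = cyc k i' j'))
      (by decide) (by omega) (by omega) ?_ ?_ ?_))) ?_ ?_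
    · simp only [Expr.Fits]; omega
    · simp only [Expr.Fits]; omega
    · simp only [Expr.eval, Op.eval]; omega
    · simpa using h7
    · refine ⟨(hs.set _ (by decide)).set _ (by decide), ?_, by simp [h9],
        by simpa using h11le, ?_⟩
      · simp only [State.set_reg, Expr.eval, Op.eval]
        simp only [show (14 : ℕ) ≠ 10 by decide, if_true, if_false]
        omega
      · simp only [State.set_reg]
        rw [if_neg (by decide), if_neg (by decide), h11]
        constructor
        · intro h i' j' hj' hij
          exact h i' (by omega) j' hj'
        · intro h i' hi' j' hj'
          exact h i' j' hj' (Or.inl hi')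
    · rintro j hj s'' ⟨hs', h14', h9', h11le', h11'⟩ h10 h7'
      refine checkStep_ends hB (hs'.tables hT) h7' hkn
        (fun x hx => by rw [hs'.1]; exact hb x hx) hi hj h9' h10 ?_ ?_
      · intro heq
        refine ⟨h10, h7', hs'.set _ (by decide), by simpa using h14', by simpa using h9',
          by simpa using h11le', ?_⟩
        simp only [State.set_reg]
        rw [if_neg (by decide), h11']
        refine ⟨fun h i' j' hj' hij => ?_, fun h i' j' hj' hij => h i' j' hj' (by omega)⟩
        by_cases hlast : i' = i ∧ j' = j
        · rw [hlast.1, hlast.2, heq]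
        · exact h i' j' hj' (by omega)
      · intro hne
        refine ⟨by simpa using h10, by simpa using h7',
          (hs'.set _ (by decide)).set _ (by decide), by simpa using h14', by simpa using h9',
          by simp, ?_⟩
        simp only [State.set_reg]
        rw [if_neg (by decide), if_pos trivial]
        refine ⟨fun h => absurd h one_ne_zero, fun h => absurd (h i j hj (by omega)) hne⟩
    · simp only [Expr.cost]; omega
    · rintro s'' ⟨hs', h14', h9', h11le', h11'⟩
      refine ⟨h9', ?_, hs'.set _ (by decide), by simpa using h14', by simpa using h11le', ?_⟩
      · rw [hs'.2 7 (by decide) (by decide) (by decide) (by decide), hk]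
      · simp only [State.set_reg]
        rw [if_neg (by decide), h11']
        constructor
        · intro h i' hi' j' hj'
          exact h i' j' hj' (by omega)
        · intro h i' j' hj' hij
          exact h i' (by omega) j' hj'
  · simp only [Expr.cost]
    have h1 : k * (k * (60 + 8) + 11 + 8) ≤ (3 * n + 3) * ((3 * n + 3) * (60 + 8) + 11 + 8) :=
      Nat.mul_le_mul hkn (by omega)
    nlinarith

end RAM

namespace RAM

/-! ## The algorithm -/

/-- Unless a hole has been found, try the cycle formed by shortest paths between the vertices in
the registers `3`, `4`, `5`; register `6` is set to its length if it is a long odd hole. -/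
def testTriple (ℓ : ℕ) : Program :=
  .ite (.reg 6) .skip (.seq (.assign 7 (.const 0)) (.seq (follow 4 3) (.seq (follow 5 4)
    (.seq (follow 3 5) (.seq checkCycle (.ite (.reg 11) .skip (.ite (.reg 14)
      (.ite (.bin .lt (.reg 7) (.const ℓ)) .skip (.assign 6 (.reg 7))) .skip)))))))

/-- Test all triples of vertices. -/
def search (ℓ : ℕ) : Program := forLoop 3 0 (forLoop 4 0 (forLoop 5 0 (testTriple ℓ)))

/-- Find a long odd hole formed by three shortest paths. -/
def findHole (ℓ : ℕ) : Program :=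
  .seq (.assign 1 (.bin .mul (.reg 0) (.reg 0)))
    (.seq (.assign 13 (.bin .add (.bin .add (.reg 1) (.reg 1)) (.reg 1)))
      (.seq (forLoop 3 0 (.store (addrD 3 3) (.const 1)))
        (.seq distances (.seq (.assign 6 (.const 0)) (.seq (search ℓ)
          (.seq (.assign 0 (.reg 6)) (.assign 1 (.reg 13))))))))

variable {n B ℓ : ℕ} {G : SimpleGraph (Fin n)} {D : Fin n → Fin n → ℕ} {P : Fin n → Fin n → Fin n}

/-- The length of the cycle formed by the paths from `u` to `v`, to `w`, and back. -/
def tripleLength (D : Fin n → Fin n → ℕ) (u v w : Fin n) : ℕ :=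
  (D v u - 1) + (D w v - 1) + (D u w - 1)

/-- The cycle formed by the paths from `u` to `v`, to `w`, and back. -/
def tripleSeq (D : Fin n → Fin n → ℕ) (P : Fin n → Fin n → Fin n) (u v w : Fin n) : ℕ → Fin n :=
  concat₃ (fun i => (P v)^[i] u) (fun i => (P w)^[i] v) (fun i => (P u)^[i] w)
    (D v u - 1) (D w v - 1)

/-- The triple yields a long odd hole. -/
def Good (ℓ : ℕ) (G : SimpleGraph (Fin n)) (D : Fin n → Fin n → ℕ) (P : Fin n → Fin n → Fin n)
    (u v w : Fin n) : Prop :=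
  ℓ ≤ tripleLength D u v w ∧ tripleLength D u v w % 2 = 1 ∧
    IsCyc G (tripleLength D u v w) (tripleSeq D P u v w)

/-- Register `6` holds the length of a long odd hole, and the buffer holds its vertices. -/
def Found (ℓ : ℕ) (G : SimpleGraph (Fin n)) (s : State) : Prop :=
  ∃ b, Buffer (s.reg 6) b s ∧ ℓ ≤ s.reg 6 ∧ s.reg 6 % 2 = 1 ∧ IsCyc G (s.reg 6) b

/-- The vertices of the hole are distinct. This shows that register `6` fits into a word. -/
lemma Found.le_card (hℓ : 5 ≤ ℓ) {s : State} (h : Found ℓ G s) : s.reg 6 ≤ n := by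
  obtain ⟨b, -, hle, -, hcyc⟩ := h
  have hc := hcyc.isHoleSeq (by omega)
  have hinj : Function.Injective (fun i : Fin (s.reg 6) => b i) := by
    intro i j hij
    have := hc.inj i j i.2 j.2 (by simpa [Nat.mod_eq_of_lt i.2, Nat.mod_eq_of_lt j.2] using hij)
    exact Fin.ext this
  simpa only [Fintype.card_fin] using Fintype.card_le_of_injective _ hinj

/-- The state after the triples before `(u, v, w)` have been tested. -/
def TestState (ℓ : ℕ) (G : SimpleGraph (Fin n)) (D : Fin n → Fin n → ℕ)
    (P : Fin n → Fin n → Fin n) (u v w : ℕ) (s : State) : Prop :=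
  Tables n (adjTable G) D P s ∧
    (s.reg 6 = 0 ∧ (∀ a b c, Before a b c u v w → ¬ Good ℓ G D P a b c) ∨ Found ℓ G s)

lemma TestState.set {u v w : ℕ} {s : State} (h : TestState ℓ G D P u v w s) {x y : ℕ}
    (h0 : x ≠ 0) (h1 : x ≠ 1) (h6 : x ≠ 6) (h13 : x ≠ 13) :
    TestState ℓ G D P u v w (s.set x y) := by
  have e6 : (s.set x y).reg 6 = s.reg 6 := by rw [State.set_reg, if_neg h6.symm]
  refine ⟨h.1.set y h0 h1 h13, ?_⟩
  rw [e6]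
  refine h.2.imp_right ?_
  rintro ⟨b, hb⟩
  refine ⟨b, ?_⟩
  rw [e6]
  exact hb

lemma TestState.congr {u v w u' v' w' : ℕ} {s : State} (h : TestState ℓ G D P u v w s)
    (hb : ∀ a b c : Fin n, Before a b c u' v' w' → Before a b c u v w) :
    TestState ℓ G D P u' v' w' s :=
  ⟨h.1, h.2.imp_left fun h' => ⟨h'.1, fun a b c h => h'.2 a b c (hb a b c h)⟩⟩

lemma TestState.step {u v w : Fin n} {s : State} (hT : Tables n (adjTable G) D P s)
    (h6 : s.reg 6 = 0) (h : ∀ a b c, Before a b c u v w → ¬ Good ℓ G D P a b c)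
    (hbad : ¬ Good ℓ G D P u v w) : TestState ℓ G D P u v (w + 1) s := by
  refine ⟨hT, Or.inl ⟨h6, fun a b c habc => ?_⟩⟩
  by_cases hlt : Before a b c u v w
  · exact h a b c hlt
  · have : a = u ∧ b = v ∧ c = w := by
      simp only [Before, Fin.ext_iff] at *
      omega
    obtain ⟨rfl, rfl, rfl⟩ := this
    exact hbad

lemma testTriple_ends (hℓ : 5 ≤ ℓ) (hB : 10 * (n * n) + 10 * n + 10 < B) (hℓB : ℓ < B)
    (hD : ∀ i j, D i j ≤ n + 2) {u v w : Fin n} {s : State} (h : TestState ℓ G D P u v w s)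
    (h3 : s.reg 3 = u) (h4 : s.reg 4 = v) (h5 : s.reg 5 = w) :
    Ends B (testTriple ℓ) s (900 * (n + 1) ^ 2) (fun s' => TestState ℓ G D P u v (w + 1) s' ∧
      ∀ r ≤ 5, s'.reg r = s.reg r) := by
  obtain ⟨hT, hor⟩ := h
  have hm : ∀ i j, D i j - 1 ≤ n + 1 := fun i j => by have := hD i j; omega
  have hpow : n + 1 ≤ (n + 1) ^ 2 := by nlinarith
  have h6B : s.reg 6 < B := by
    rcases hor with h | h
    · omega
    · have := h.le_card hℓ
      omega
  have hfound : ∀ {s : State}, Found ℓ G s → s.reg 6 ≠ 0 := by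
    rintro s ⟨b, _, h1, _⟩
    omega
  refine Ends.mono (Ends.ite (T := 850 * (n + 1) ^ 2 + 20) ?_ ?_ ?_) ?_ (fun _ h => h)
  · simp only [Expr.Fits]
    exact h6B
  · intro hne
    refine Ends.mono (Ends.skip ⟨⟨hT, Or.inr ?_⟩, fun _ _ => rfl⟩) (by omega) (fun _ h => h)
    exact hor.resolve_left fun h => hne h.1
  swap
  · simp only [Expr.cost]; omega
  intro h6
  replace h6 : s.reg 6 = 0 := h6
  obtain ⟨_, hbefore⟩ := hor.resolve_right fun h => hfound h h6
  have hT7 : Tables n (adjTable G) D P (s.set 7 0) :=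
    hT.set 0 (by decide) (by decide) (by decide)
  refine Ends.mono (T := 2 + (50 * (n + 1) + (50 * (n + 1) + (50 * (n + 1) +
    (700 * (n + 1) ^ 2 + 15))))) (Ends.seq (Ends.assign ?_ (Ends.seq ?_))) (by omega)
    (fun _ h => h)
  · simp only [Expr.Fits]; omega
  refine (follow_ends hB hD hT7 (va := v) (vx := u) (k := 0) (b := fun _ => u) (by decide)
    (by decide) (by simpa using h4) (by simpa using h3) (by simp) (by omega)
    (fun i hi => absurd hi (Nat.not_lt_zero i))).mono le_rfl ?_
  rintro s₁ ⟨hT₁, hr₁, h7₁, hb₁⟩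
  have hr₁' : ∀ r ≤ 6, s₁.reg r = s.reg r := fun r hr => by
    rw [hr₁ r hr, State.set_reg, if_neg (by omega)]
  have hvu := hm v u
  have hwv := hm w v
  have huw := hm u w
  refine Ends.seq ((follow_ends hB hD hT₁ (va := w) (vx := v) (by decide)
    (by decide) (by rw [hr₁' 5 (by decide), h5]) (by rw [hr₁' 4 (by decide), h4]) h7₁ (by omega)
    hb₁).mono le_rfl ?_)
  rintro s₂ ⟨hT₂, hr₂, h7₂, hb₂⟩
  refine Ends.seq ((follow_ends hB hD hT₂ (va := u) (vx := w) (by decide)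
    (by decide) (by rw [hr₂ 3 (by decide), hr₁' 3 (by decide), h3])
    (by rw [hr₂ 5 (by decide), hr₁' 5 (by decide), h5]) h7₂ (by omega) hb₂).mono le_rfl ?_)
  rintro s₃ ⟨hT₃, hr₃, h7₃, hb₃⟩
  have hr₃' : ∀ r ≤ 6, s₃.reg r = s.reg r := fun r hr => by rw [hr₃ r hr, hr₂ r hr, hr₁' r hr]
  rw [Nat.zero_add] at h7₃ hb₃
  change s₃.reg 7 = tripleLength D u v w at h7₃
  change Buffer (tripleLength D u v w) _ s₃ at hb₃
  -- Each path was stored without its last vertex, which is the first vertex of the next one.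
  have hbuf : Buffer (tripleLength D u v w) (tripleSeq D P u v w) s₃ := by
    intro i hi
    rw [hb₃ i hi]
    congr 1
    simp only [append, tripleSeq, concat₃]
    split_ifs <;> first | rfl | omega
  have hlen : tripleLength D u v w ≤ 3 * n + 3 := by
    simp only [tripleLength]
    omega
  refine Ends.seq ((checkCycle_ends hB hT₃ h7₃ hlen hbuf).mono le_rfl ?_)
  rintro s₄ ⟨hs₄, h14, h11le, h11⟩
  have hr₄ : ∀ r ≤ 6, s₄.reg r = s.reg r := fun r hr => by
    rw [hs₄.2 r (by omega) (by omega) (by omega) (by omega), hr₃' r hr]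
  have h7₄ : s₄.reg 7 = tripleLength D u v w := by
    rw [hs₄.2 7 (by decide) (by decide) (by decide) (by decide), h7₃]
  have hbad : ¬ Good ℓ G D P u v w →
      TestState ℓ G D P u v (w + 1) s₄ ∧ ∀ r ≤ 5, s₄.reg r = s.reg r := fun hbad =>
    ⟨TestState.step (hs₄.tables hT₃) (by rw [hr₄ 6 le_rfl, h6]) hbefore hbad,
      fun r hr => hr₄ r (by omega)⟩
  refine Ends.mono (Ends.ite (T := 12) ?_ (fun hne => ?_) (fun hz => ?_)) (by simp [Expr.cost])
    (fun _ h => h)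
  · simp only [Expr.Fits]; omega
  · exact Ends.mono (Ends.skip (hbad fun hg => hne (h11.2 (hg.2.2.congr fun _ _ => rfl))))
      (by omega) (fun _ h => h)
  have hcyc := h11.1 hz
  refine Ends.mono (Ends.ite (T := 9) ?_ (fun hne => ?_) (fun hz => ?_)) (by simp [Expr.cost])
    (fun _ h => h)
  · simp only [Expr.Fits]; omega
  swap
  · refine Ends.mono (Ends.skip (hbad fun hg => ?_)) (by omega) (fun _ h => h)
    have h1 := hg.2.1
    replace hz : s₄.reg 14 = 0 := hz
    omega
  replace hne : s₄.reg 14 ≠ 0 := hne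
  have hlt : (Expr.bin .lt (.reg 7) (.const ℓ)).eval s₄ =
      if tripleLength D u v w < ℓ then 1 else 0 := by
    rw [← h7₄]
    rfl
  refine Ends.mono (Ends.ite (T := 3) ⟨?_, ?_, (Op.eval_lt_le _ _).trans_lt (by omega)⟩
    (fun hlt' => ?_) (fun hlt' => ?_)) (by simp [Expr.cost]) (fun _ h => h)
  · simp only [Expr.Fits]; omega
  · simpa only [Expr.Fits] using hℓB
  · rw [hlt] at hlt'
    refine Ends.mono (Ends.skip (hbad fun hg => hlt' ?_)) (by omega) (fun _ h => h)
    exact if_neg (by have := hg.1; omega)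
  · rw [hlt] at hlt'
    have hle : ℓ ≤ tripleLength D u v w := by
      by_contra hcon
      rw [if_pos (by omega)] at hlt'
      omega
    refine Ends.mono (Ends.assign ?_ ⟨⟨?_, Or.inr ?_⟩, fun r hr => ?_⟩) (by simp [Expr.cost])
      (fun _ h => h)
    · simp only [Expr.Fits]; omega
    · exact (hs₄.tables hT₃).set _ (by decide) (by decide) (by decide)
    · have e6 : (s₄.set 6 ((Expr.reg 7).eval s₄)).reg 6 = tripleLength D u v w := by
        simpa [Expr.eval] using h7₄
      refine ⟨tripleSeq D P u v w, ?_⟩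
      rw [e6]
      refine ⟨fun i hi => ?_, hle, by omega, hcyc⟩
      rw [State.set_mem, hs₄.1]
      exact hbuf i hi
    · rw [State.set_reg, if_neg (by omega), hr₄ r (by omega)]

lemma search_ends (hℓ : 5 ≤ ℓ) (hB : 10 * (n * n) + 10 * n + 10 < B) (hℓB : ℓ < B)
    (hD : ∀ i j, D i j ≤ n + 2) {s : State} (h : TestState ℓ G D P 0 0 0 s) :
    Ends B (search ℓ) s (n * (n * (n * (900 * (n + 1) ^ 2 + 8) + 6 + 8) + 6 + 8) + 6)
      (TestState ℓ G D P n 0 0) := by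
  refine Ends.forLoop (I := fun u s => TestState ℓ G D P u 0 0 s) (by decide) (by omega) (by omega)
    h.1.reg0 (h.set (by decide) (by decide) (by decide) (by decide)) ?_
  intro u hu s hs h3 _
  refine (Ends.forLoop (N := n) (I := fun v s => TestState ℓ G D P u v 0 s ∧ s.reg 3 = u)
    (by decide) (by omega) (by omega) hs.1.reg0
    ⟨hs.set (by decide) (by decide) (by decide) (by decide), by simpa using h3⟩ ?_).mono le_rfl ?_
  swap
  · intro s' hs'
    refine ⟨hs'.2, hs'.1.1.reg0, (hs'.1.congr ?_).set (by decide) (by decide) (by decide)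
      (by decide)⟩
    intro a b c
    have := b.2
    simp only [Before]
    omega
  intro v hv s hs h4 _
  refine (Ends.forLoop (N := n) (I := fun w s => TestState ℓ G D P u v w s ∧ s.reg 3 = u ∧
    s.reg 4 = v) (by decide) (by omega) (by omega) hs.1.1.reg0
    ⟨hs.1.set (by decide) (by decide) (by decide) (by decide), by simpa using hs.2,
      by simpa using h4⟩ ?_).mono le_rfl ?_
  swap
  · intro s' hs'
    refine ⟨hs'.2.2, hs'.1.1.reg0, (hs'.1.congr ?_).set (by decide) (by decide) (by decide)
      (by decide), by simpa using hs'.2.1⟩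
    intro a b c
    have := c.2
    simp only [Before]
    omega
  intro w hw s hs h5 _
  refine (testTriple_ends hℓ hB hℓB hD (u := ⟨u, hu⟩) (v := ⟨v, hv⟩) (w := ⟨w, hw⟩) hs.1 hs.2.1
    hs.2.2 h5).mono le_rfl ?_
  intro s' hs'
  refine ⟨by rw [hs'.2 5 le_rfl, h5], hs'.1.1.reg0,
    hs'.1.set (by decide) (by decide) (by decide) (by decide), ?_, ?_⟩
  · simpa [hs'.2] using hs.2.1
  · simpa [hs'.2] using hs.2.2

lemma _root_.IsDist.le_card {m : ℕ} {x y : Fin n} (h : IsDist G m x y) : m ≤ n := by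
  obtain ⟨p, hp, f, hx, hy, hf⟩ := h.1.exists_seq
  have hpm : p = m := by
    by_contra hne
    refine h.2 p (by omega) ?_
    have := Reach.of_seq hf (Nat.zero_le p) le_rfl
    rwa [hx, hy] at this
  subst hpm
  have hP := isPathSeq_of_shortest hf (by rw [hx, hy]; exact h.2)
  have hinj : Function.Injective (fun i : Fin (p + 1) => f i) := fun i j hij =>
    Fin.ext (hP.inj i j (by omega) (by omega) hij)
  have := Fintype.card_le_of_injective _ hinj
  simp only [Fintype.card_fin] at this
  omega

/-- If there is a clean shortest long odd hole, some triple is good. -/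
lemma exists_good (hℓ : 5 ≤ ℓ) (hG : IsCandidate ℓ G) (hD : IsDistTable G n D P)
    (hC : ∃ C : Hole G, C.IsShortestLongOdd ℓ ∧ C.IsClean) : ∃ u v w, Good ℓ G D P u v w := by
  obtain ⟨C, hC, hcl⟩ := hC
  obtain ⟨u, v, w, m₁, m₂, m₃, d₁, d₂, d₃, hle, hodd, hall⟩ := exists_triple hℓ hG hC hcl
  have e₁ := hD.eq_of_isDist d₁.le_card d₁
  have e₂ := hD.eq_of_isDist d₂.le_card d₂
  have e₃ := hD.eq_of_isDist d₃.le_card d₃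
  obtain ⟨w₁, t₁⟩ := hD.walk e₁
  obtain ⟨w₂, t₂⟩ := hD.walk e₂
  obtain ⟨w₃, t₃⟩ := hD.walk e₃
  have hlen : tripleLength D u v w = m₁ + m₂ + m₃ := by
    simp only [tripleLength, e₁, e₂, e₃]
    omega
  refine ⟨u, v, w, by omega, by omega, ?_⟩
  have := isCyc_of_isHoleSeq (hall _ _ _ w₁ rfl t₁ w₂ rfl t₂ w₃ rfl t₃)
  rw [hlen]
  simpa only [tripleSeq, e₁, e₂, Nat.add_sub_cancel] using this

/-- Memory beyond the adjacency matrix is zero, which reads as an empty distance table with every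
predecessor equal to vertex `0`. -/
lemma tables_inputState (G : SimpleGraph (Fin n)) :
    Tables n (adjTable G) (fun _ _ => 0) (fun u _ => ⟨0, u.pos⟩)
      (((inputState G).set 1 (n * n)).set 13 (n * n + n * n + n * n)) where
  reg0 := by simp [inputState]
  reg1 := by simp
  reg13 := by simp
  memA i j := by
    simp only [State.set_mem, inputState, adjTable]
    by_cases hij : G.Adj i j
    · rw [if_pos ⟨i, j, rfl, hij⟩, if_pos hij]
    · rw [if_neg hij, if_neg]
      rintro ⟨i', j', h, hadj⟩
      obtain ⟨rfl, rfl⟩ := index_inj h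
      exact hij hadj
  memD i j := by
    simp only [State.set_mem, inputState]
    refine if_neg ?_
    rintro ⟨i', j', h, -⟩
    have := index_lt i' j'
    omega
  memP i j := by
    simp only [State.set_mem, inputState]
    refine if_neg ?_
    rintro ⟨i', j', h, -⟩
    have := index_lt i' j'
    omega

lemma diagonal_ends (hB : 10 * (n * n) + 10 * n + 10 < B) {s : State}
    (hT : Tables n (adjTable G) (fun _ _ => 0) P s) :
    Ends B (forLoop 3 0 (.store (addrD 3 3) (.const 1))) s (n * (9 + 8) + 6)
      (Tables n (adjTable G) (fun u v => if u = v then 1 else 0) P) := by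
  refine Ends.mono (Ends.forLoop (I := fun i s =>
    Tables n (adjTable G) (fun u v => if u = v ∧ u.val < i then 1 else 0) P s) (by decide)
    (by omega) (by omega) hT.reg0 (by simpa using hT.set 0 (by decide) (by decide) (by decide))
    ?_) le_rfl (fun s hs => by simpa using hs)
  intro i hi s hs h3 h0
  have h3' : s.reg 3 = (⟨i, hi⟩ : Fin n) := h3
  refine Ends.mono (Ends.store (hs.addrD_fits h3' h3' (by omega)) ?_ ⟨h3, h0, ?_⟩)
    (by simp [Expr.cost, addrD, idx]) (fun _ h => h)
  · simp only [Expr.Fits]; omega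
  · rw [hs.addrD_eval h3' h3']
    have := (hs.putD ⟨i, hi⟩ ⟨i, hi⟩ 1).set (x := 3) (i + 1) (by decide) (by decide) (by decide)
    convert this using 3 with u v
    · simp only [Fin.ext_iff]
      split_ifs <;> first | rfl | omega
    · rfl

/-- If a triple passed the test, the buffer holds a long odd hole. If none did, `exists_good` rules
out a clean shortest one. The time is dominated by `n ^ 3` tests of quadratic cost. -/
lemma findHole_ends (hℓ : 5 ≤ ℓ) (hG : IsCandidate ℓ G) (hB : 10 * (n * n) + 10 * n + 10 < B)
    (hℓB : ℓ < B) : Ends B (findHole ℓ) (inputState G) (5000 * (n + 1) ^ 5) (fun s =>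
      ReportsLongOddHole ℓ G s ∨
        (s.reg 0 = 0 ∧ ¬ ∃ C : Hole G, C.IsShortestLongOdd ℓ ∧ C.IsClean)) := by
  have h0 : (inputState G).reg 0 = n := rfl
  refine Ends.mono (Ends.seq (Ends.assign ⟨?_, ?_, ?_⟩ (Ends.seq (Ends.assign ⟨⟨?_, ?_, ?_⟩, ?_, ?_⟩
    (Ends.seq (T' := (n * (n * (n * (n * (100 + 8) + 6 + 8) + 6 + 8) + 6 + 8) + 6) + (2 +
      ((n * (n * (n * (900 * (n + 1) ^ 2 + 8) + 6 + 8) + 6 + 8) + 6) + (2 + 2)))) (Ends.mono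
      (diagonal_ends (G := G) hB (P := fun u _ => ⟨0, u.pos⟩) ?_) le_rfl ?_)))))) ?_ (fun _ h => h)
  · simp only [Expr.Fits]; omega
  · simp only [Expr.Fits]; omega
  · simp only [Expr.eval, Op.eval, h0]; omega
  · simp only [Expr.Fits, Expr.eval, Op.eval, State.set_reg, h0, if_true]; omega
  · simp only [Expr.Fits, Expr.eval, Op.eval, State.set_reg, h0, if_true]; omega
  · simp only [Expr.eval, Op.eval, State.set_reg, h0, if_true]; omega
  · simp only [Expr.Fits, Expr.eval, Op.eval, State.set_reg, h0, if_true]; omega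
  · simp only [Expr.eval, Op.eval, State.set_reg, h0, if_true]; omega
  · have := tables_inputState G
    simpa only [Expr.eval, Op.eval, State.set_reg, h0, if_true] using this
  swap
  · simp only [Expr.cost]
    ring_nf
    omega
  intro s hs
  refine Ends.seq (Ends.mono (distances_ends hB hs (.initial _)) le_rfl ?_)
  rintro s ⟨D, P, hT, hD⟩
  refine Ends.seq (Ends.assign ?_ (Ends.seq (Ends.mono (search_ends (D := D) (P := P) (G := G) hℓ
    hB hℓB hD.le ⟨hT.set 0 (by decide) (by decide) (by decide), Or.inl ⟨by simp [Expr.eval], ?_⟩⟩)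
    le_rfl ?_)))
  · simp only [Expr.Fits]; omega
  · intro a b c h
    simp only [Before] at h
    omega
  rintro s ⟨hT, hs⟩
  have h6 : s.reg 6 < B := by
    rcases hs with h | h
    · omega
    · have := h.le_card hℓ
      omega
  refine Ends.seq (Ends.assign h6 (Ends.assign ?_ ?_))
  · simp [Expr.Fits, hT.reg13]
    omega
  rcases hs with ⟨hs, hbad⟩ | ⟨b, hb, hle, hodd, hc⟩
  · refine Or.inr ⟨by simp [Expr.eval, hs], fun hC => ?_⟩
    obtain ⟨u, v, w, h⟩ := exists_good hℓ hG hD hC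
    exact hbad u v w (Or.inl u.2) h
  · refine Or.inl ⟨(hc.isHoleSeq (by omega)).toHole (by omega), ⟨hle, Nat.odd_iff.2 hodd⟩,
      by simp [Expr.eval, IsHoleSeq.toHole], fun i => ?_⟩
    have hi : i.val < s.reg 6 := i.2
    have hv : ((((hc.isHoleSeq (by omega)).toHole (by omega)).emb i : Fin n) : ℕ) = b i :=
      congrArg (fun j => (b j).val) (Nat.mod_eq_of_lt hi)
    rw [hv, ← hb i hi]
    simp [Expr.eval, hT.reg13]

/-- The word size suffices. -/
lemma word_bound (n ℓ : ℕ) : 10 * (n * n) + 10 * n + 10 < (n + 2) ^ (ℓ + 10) ∧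
    ℓ < (n + 2) ^ (ℓ + 10) := by
  have h1 : 2 ^ (ℓ + 6) ≤ (n + 2) ^ (ℓ + 6) := Nat.pow_le_pow_left (by omega) _
  have h2 : ℓ + 6 < 2 ^ (ℓ + 6) := Nat.lt_two_pow_self
  have h3 : 2 ^ 6 ≤ 2 ^ (ℓ + 6) := Nat.pow_le_pow_right (by omega) (by omega)
  have h4 : 2 ^ 2 ≤ (n + 2) ^ 2 := Nat.pow_le_pow_left (by omega) _
  have h5 : (n + 2) ^ (ℓ + 10) = (n + 2) ^ (ℓ + 6) * ((n + 2) ^ 2 * (n + 2) ^ 2) := by ring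
  constructor <;> nlinarith [Nat.mul_le_mul h4 h4,
    Nat.mul_le_mul (h3.trans h1) (le_refl ((n + 2) ^ 2 * (n + 2) ^ 2))]

end RAM

/-- For each fixed `ℓ ≥ 5` there is one word RAM program, with words of `O(log n)` bits, which on
every candidate `G` with `n` vertices halts after `O(n ^ 5)` steps, and either reports a long odd
hole of `G`, or reports failure (register `0` holds `0`), in which case `G` has no clean shortest
long odd hole. (`(n + 1) ^ 5` rather than `n ^ 5` only matters for the graph with no vertices.) -/
theorem theorem3p6 (ℓ : ℕ) (hℓ : 5 ≤ ℓ) :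
    ∃ (p : RAM.Program) (c d : ℕ), ∀ (n : ℕ) (G : SimpleGraph (Fin n)), IsCandidate ℓ G →
      ∃ (t : ℕ) (s : RAM.State),
        RAM.Exec ((n + 2) ^ d) p (RAM.inputState G) t s ∧
        t ≤ c * (n + 1) ^ 5 ∧
        (RAM.ReportsLongOddHole ℓ G s ∨
          (s.reg 0 = 0 ∧ ¬ ∃ C : Hole G, C.IsShortestLongOdd ℓ ∧ C.IsClean)) := by
  -- The exponent grows with `ℓ` because the constant `ℓ` in the program must itself fit into a
  -- word, even for tiny `n`.
  refine ⟨RAM.findHole ℓ, 5000, ℓ + 10, fun n G hG => ?_⟩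
  obtain ⟨hB, hℓB⟩ := RAM.word_bound n ℓ
  exact RAM.findHole_ends hℓ hG hB hℓB
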